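/- Let $S$ be a closed orientable (hyperbolic) surface of genus $g \geq 4$, i.e. a space homeomorphic to the quotient of the $4g$-gon by the side identifications with boundary word $\prod_{k=1}^{g} a_k b_k a_k^{-1} b_k^{-1}$. Then there exist quasi-isometric embeddings $\psi : \pi_1(S) \to \mathsf{SL}(4,\mathbb{R})$ and $\rho : \pi_1(S) \to \mathsf{SL}(6,\mathbb{R})$ which are not limits of Anosov representations of $\pi_1(S)$ into $\mathsf{SL}(4,\mathbb{R})$ and $\mathsf{SL}(6,\mathbb{R})$, respectively, and such that moreover $\rho$ is strongly irreducible. Here, for a finitely generated group $\Gamma$ with word length $|\cdot|_\Gamma$ with respect to a finite generating set, and with $\sigma_1(A) \geq \dots \geq \sigma_d(A)$ the singular values of $A \in \mathsf{SL}(d,\mathbb{R})$: - a representation $\rho : \Gamma \to \mathsf{SL}(d,\mathbb{R})$ is a quasi-isometric embedding if there are $J, K > 0$ with $\frac1K e^{|\gamma|_\Gamma/J} \leq \sigma_1(\rho(\gamma))/\sigma_d(\rho(\gamma)) \leq K e^{J|\gamma|_\Gamma}$ for all $\gamma \in \Gamma$; - $\rho$ is $P_i$-Anosov, $1 \leq i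 \leq d/2$, if there are $C, a > 0$ with $\sigma_i(\rho(\gamma))/\sigma_{i+1}(\rho(\gamma)) \geq C e^{a|\gamma|_\Gamma}$ for all $\gamma \in \Gamma$, and Anosov if it is $P_i$-Anosov for some such $i$; - $\rho$ is a limit of Anosov representations if there are Anosov representations $\rho_n : \Gamma \to \mathsf{SL}(d,\mathbb{R})$ with $\rho_n(\gamma) \to \rho(\gamma)$ for every $\gamma \in \Gamma$; - $\rho$ is strongly irreducible if, for every finite-index subgroup $H \leq \Gamma$, the only $\rho(H)$-invariant linear subspaces of $\mathbb{R}^d$ are $0$ and $\mathbb{R}^d$. -/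

import Mathlib

open Filter Topology

/-! ### Closed orientable surfaces -/

/-- The closed unit disc, regarded as a polygon with `4 g` sides. -/
abbrev SurfaceDisc : Type := Metric.closedBall (0 : ℂ) 1

/-- The boundary point of the disc at position `s`, when the boundary circle is divided into `4 g`
arcs (the sides), the `j`-th side running counterclockwise from position `j` to position
`j + 1`, for `0 ≤ j < 4 g`. -/
noncomputable def sidePoint (g : ℕ) (s : ℝ) : SurfaceDisc :=
  ⟨(Circle.exp (2 * Real.pi * s / (4 * g)) : ℂ), by
    rw [mem_closedBall_zero_iff, Circle.norm_coe]⟩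

/-- The side identifications of the `4 g`-gon with boundary word
`a₀ b₀ a₀⁻¹ b₀⁻¹ ⋯ a_{g-1} b_{g-1} a_{g-1}⁻¹ b_{g-1}⁻¹`: for each `k < g`, side `4k` is glued to side
`4k + 2`, and side `4k + 1` to side `4k + 3`, in both cases reversing the direction. -/
inductive SideIdent (g : ℕ) : SurfaceDisc → SurfaceDisc → Prop
  | a (k : ℕ) (hk : k < g) (t : ℝ) (ht : t ∈ Set.Icc (0 : ℝ) 1) :
      SideIdent g (sidePoint g (4 * k + t)) (sidePoint g (4 * k + 3 - t))
  | b (k : ℕ) (hk : k < g) (t : ℝ) (ht : t ∈ Set.Icc (0 : ℝ) 1) :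
      SideIdent g (sidePoint g (4 * k + 1 + t)) (sidePoint g (4 * k + 4 - t))

/-- The standard closed orientable surface of genus `g ≥ 1`, with the quotient topology
(`Quot` divides by the equivalence relation generated by the side identifications). -/
abbrev StandardSurface (g : ℕ) : Type := Quot (SideIdent g)

/-- `S` is a closed orientable surface of genus `g` (for `g ≥ 1`). -/
def IsClosedOrientableSurface (S : Type*) [TopologicalSpace S] (g : ℕ) : Prop :=
  Nonempty (S ≃ₜ StandardSurface g)

/-! ### Word length and singular values -/

section Representations

variable {Γ : Type*} [Group Γ] {d : ℕ}

/-- The word length of `γ` with respect to a generating set `T`. -/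
noncomputable def wordLength (T : Set Γ) (γ : Γ) : ℕ :=
  sInf {n : ℕ | ∃ l : List Γ, (∀ x ∈ l, x ∈ T ∨ x⁻¹ ∈ T) ∧ l.prod = γ ∧ l.length = n}

/-- The `i`-th singular value `σ_i(A)`, for `1 ≤ i ≤ d`, in decreasing order. Mathlib's
sequence of singular values starts with index `0`. -/
noncomputable def sigma (i : ℕ) (A : Matrix.SpecialLinearGroup (Fin d) ℝ) : ℝ :=
  (Matrix.toEuclideanLin (A : Matrix (Fin d) (Fin d) ℝ)).singularValues (i - 1)

/-! ### Classes of representations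

The definitions below ask for the estimates with respect to some finite generating set; they
then hold, with other constants, for every finite generating set. -/

/-- `ρ` is a quasi-isometric embedding (of a finitely generated group). -/
def IsQuasiIsometricEmbedding (ρ : Γ →* Matrix.SpecialLinearGroup (Fin d) ℝ) : Prop :=
  ∃ T : Set Γ, T.Finite ∧ Subgroup.closure T = ⊤ ∧
    ∃ J K : ℝ, 0 < J ∧ 0 < K ∧ ∀ γ : Γ,
      1 / K * Real.exp (1 / J * wordLength T γ) ≤ sigma 1 (ρ γ) / sigma d (ρ γ) ∧
      sigma 1 (ρ γ) / sigma d (ρ γ) ≤ K * Real.exp (J * wordLength T γ)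

/-- `ρ` is `P_i`-Anosov (meant for `1 ≤ i ≤ d / 2`). -/
def IsPAnosov (i : ℕ) (ρ : Γ →* Matrix.SpecialLinearGroup (Fin d) ℝ) : Prop :=
  ∃ T : Set Γ, T.Finite ∧ Subgroup.closure T = ⊤ ∧
    ∃ C a : ℝ, 0 < C ∧ 0 < a ∧ ∀ γ : Γ,
      C * Real.exp (a * wordLength T γ) ≤ sigma i (ρ γ) / sigma (i + 1) (ρ γ)

/-- `ρ` is Anosov: it is `P_i`-Anosov for some `1 ≤ i ≤ d / 2`. -/
def IsAnosov (ρ : Γ →* Matrix.SpecialLinearGroup (Fin d) ℝ) : Prop :=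
  ∃ i : ℕ, 1 ≤ i ∧ 2 * i ≤ d ∧ IsPAnosov i ρ

/-- `ρ` is a limit of Anosov representations in `Hom(Γ, SL(d, ℝ))` with the topology of pointwise
convergence. -/
def IsLimitOfAnosov (ρ : Γ →* Matrix.SpecialLinearGroup (Fin d) ℝ) : Prop :=
  ∃ η : ℕ → (Γ →* Matrix.SpecialLinearGroup (Fin d) ℝ), (∀ n, IsAnosov (η n)) ∧
    ∀ γ : Γ, Tendsto (fun n => η n γ) atTop (𝓝 (ρ γ))

/-- `ρ` (with `d ≥ 1`) is strongly irreducible: no finite-index subgroup of `Γ` preserves a subspace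
of `ℝ^d` other than `0` and `ℝ^d`. -/
def IsStronglyIrreducible (ρ : Γ →* Matrix.SpecialLinearGroup (Fin d) ℝ) : Prop :=
  ∀ H : Subgroup Γ, H.FiniteIndex → ∀ W : Submodule ℝ (Fin d → ℝ),
    (∀ h ∈ H, ∀ w ∈ W, (ρ h : Matrix (Fin d) (Fin d) ℝ).mulVec w ∈ W) → W = ⊥ ∨ W = ⊤

end Representations

/-! The obstruction to being a limit of Anosov representations is a complex eigenvalue. Suppose that
a real matrix has simple eigenvalues and that those in positions i and i + 1, ordered by modulus,
form a conjugate pair separated in modulus from the others. Nearby real matrices have the same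
property, because their spectra are also stable under conjugation. Hence the ratio σ_i / σ_{i+1} of
the powers of a nearby matrix stays bounded (`eventually_singularValues_pow_le`), which is
impossible for a P_i-Anosov representation and an element of infinite order. A representation with
such an element for every i ≤ d / 2 is therefore not a limit of Anosov representations
(`not_isLimitOfAnosov`).

Both representations are built from a Fuchsian representation A into SL(2, ℝ), from which they
inherit the quasi-isometric embedding property. The first is |χ|⁻¹ A ⊕ χ for a character χ to ℂˣ,
acting on ℂ = ℝ² (`exists_rep_four`). The second is A ⊗ B for a representation B to SL(3, ℝ) whose
values on two handles are a dilation of an axis combined with a rotation by one radian of a plane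
(`exists_rep_six`). The values of χ and B on the standard generators may be chosen freely as long as
they commute within each handle, and they are tuned to place a conjugate pair in each required
position. For strong irreducibility, B is trivial on the generators b_k. Powers of A(b_k) ⊗ 1
together with 1 generate all of M₂(ℝ) ⊗ 1, so an invariant subspace has the form ℝ² ⊗ U, and powers
of the two values of B have no common invariant subspace U (`isStronglyIrreducible_tensorRep`). What
is needed of the surface group is collected in `FuchsianSystem`.

This structure is obtained from the triangle group with angles π/4g, π/4g, π/2, generated by the
reflections in the sides of a triangle of the barycentric subdivision of the regular 4g-gon. The
group permutes the 8g flags of the glued polygon, and the surface group is the stabilizer of one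
flag. Homomorphisms from this stabilizer are given by voltages: elements of the target attached to
the crossings of triangle sides, subject only to the Coxeter relations (`VoltageData`). This yields
both the lift A to SL(2, ℝ) and the auxiliary χ and B, without a presentation of the surface group.

Geometry enters through the hyperboloid model. The length argument of Tits shows that the triangle
is a strict fundamental domain (`traceForm_nonneg_of_length_lt`, `smul_eq_of_mem_chamber`). This
gives proper discontinuity, freeness of the surface group action, cocompactness, and by an argument
of Milnor–Švarc type the exponential lower bound for A (`exists_exp_wordLength_le`). Finally the
polygon with glued sides is identified with the quotient of the hyperbolic plane
(`nonempty_homeomorph_hypQuotient`), so that covering theory identifies the stabilizer with the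
fundamental group. -/

/-! ### Singular values -/

section SingularValues

open Module

variable {E : Type*} [NormedAddCommGroup E] [InnerProductSpace ℝ E] [FiniteDimensional ℝ E]

/-- The squared norm of T v is the quadratic form of the adjoint of T composed with T, which is
diagonal in its eigenbasis with entries σ_j². -/
theorem norm_sq_apply_eq_sum_singularValues (T : E →ₗ[ℝ] E) {d : ℕ} (hd : finrank ℝ E = d) (v : E) :
    ‖T v‖ ^ 2 = ∑ j : Fin d, T.singularValues j ^ 2 *
      ((T.isSymmetric_adjoint_comp_self.eigenvectorBasis hd).repr v j) ^ 2 := by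
  set b := T.isSymmetric_adjoint_comp_self.eigenvectorBasis hd with hb
  have h1 : ‖T v‖ ^ 2 = inner ℝ v ((LinearMap.adjoint T ∘ₗ T) v) := by
    rw [LinearMap.comp_apply, LinearMap.adjoint_inner_right, real_inner_self_eq_norm_sq]
  rw [h1, ← b.sum_inner_mul_inner]
  refine Finset.sum_congr rfl fun j _ => ?_
  rw [T.sq_singularValues_fin hd, ← b.repr_apply_apply ((LinearMap.adjoint T ∘ₗ T) v),
    real_inner_comm, ← b.repr_apply_apply, hb,
    LinearMap.IsSymmetric.eigenvectorBasis_apply_self_apply]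
  simp only [RCLike.ofReal_real_eq_id, id]
  ring

theorem norm_sq_eq_sum_singularBasis (T : E →ₗ[ℝ] E) {d : ℕ} (hd : finrank ℝ E = d) (v : E) :
    ‖v‖ ^ 2 = ∑ j : Fin d, ((T.isSymmetric_adjoint_comp_self.eigenvectorBasis hd).repr v j) ^ 2 := by
  rw [← (T.isSymmetric_adjoint_comp_self.eigenvectorBasis hd).repr.norm_map v,
    EuclideanSpace.norm_sq_eq]
  simp

theorem norm_apply_le_singularValues_zero (T : E →ₗ[ℝ] E) (v : E) :
    ‖T v‖ ≤ T.singularValues 0 * ‖v‖ := by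
  refine le_of_sq_le_sq ?_ (mul_nonneg (T.singularValues_nonneg 0) (norm_nonneg v))
  rw [mul_pow, norm_sq_apply_eq_sum_singularValues T rfl, norm_sq_eq_sum_singularBasis T rfl,
    Finset.mul_sum]
  gcongr with j
  · exact T.singularValues_nonneg _
  · exact T.singularValues_antitone (Nat.zero_le _)

theorem singularValues_last_mul_le (T : E →ₗ[ℝ] E) {d : ℕ} (hd : finrank ℝ E = d) (v : E) :
    T.singularValues (d - 1) * ‖v‖ ≤ ‖T v‖ := by
  refine le_of_sq_le_sq ?_ (norm_nonneg _)
  rw [mul_pow, norm_sq_apply_eq_sum_singularValues T hd, norm_sq_eq_sum_singularBasis T hd,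
    Finset.mul_sum]
  gcongr with j
  · exact T.singularValues_nonneg _
  · exact T.singularValues_antitone (by omega)

theorem exists_norm_apply_eq_singularValues (T : E →ₗ[ℝ] E) {d : ℕ} (hd : finrank ℝ E = d)
    (i : Fin d) : ∃ v : E, ‖v‖ = 1 ∧ ‖T v‖ = T.singularValues i := by
  set b := T.isSymmetric_adjoint_comp_self.eigenvectorBasis hd with hb
  refine ⟨b i, by simp, ?_⟩
  rw [← sq_eq_sq₀ (norm_nonneg _) (T.singularValues_nonneg _),
    norm_sq_apply_eq_sum_singularValues T hd, ← hb]
  simp [ite_pow]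

/-- F is the span of the singular vectors with index in s. For s an initial or a final segment it is
the test space of the min-max principle. -/
theorem finrank_ker_repr (T : E →ₗ[ℝ] E) {d : ℕ} (hd : finrank ℝ E = d) (s : Finset (Fin d)) :
    ∃ F : Submodule ℝ E, finrank ℝ F = s.card ∧ ∀ v ∈ F, ∀ j ∉ s,
      (T.isSymmetric_adjoint_comp_self.eigenvectorBasis hd).repr v j = 0 := by
  set b := T.isSymmetric_adjoint_comp_self.eigenvectorBasis hd with hb
  refine ⟨Submodule.span ℝ (b '' s), ?_, ?_⟩
  · have hli : LinearIndependent ℝ (fun i : s => b i) :=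
      b.orthonormal.linearIndependent.comp _ Subtype.val_injective
    have h := finrank_span_eq_card hli
    rw [← Fintype.card_coe s, ← h, Set.image_eq_range]
    rfl
  · intro v hv j hj
    induction hv using Submodule.span_induction with
    | mem x hx =>
      obtain ⟨i, hi, rfl⟩ := hx
      have : i ≠ j := fun h => hj (by simpa [h] using hi)
      simp [this.symm]
    | zero => simp
    | add x y _ _ hx hy => simp [hx, hy]
    | smul a x _ hx => simp [hx]

theorem exists_ne_zero_mem_inf {V : Type*} [AddCommGroup V] [Module ℝ V] [FiniteDimensional ℝ V]
    (S F : Submodule ℝ V) (h : finrank ℝ V < finrank ℝ S + finrank ℝ F) :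
    ∃ v ∈ S, v ∈ F ∧ v ≠ 0 := by
  have h1 := Submodule.finrank_sup_add_finrank_inf_eq S F
  have h2 := Submodule.finrank_le (S ⊔ F)
  have h3 : 0 < finrank ℝ ↥(S ⊓ F) := by omega
  have : S ⊓ F ≠ ⊥ := by
    intro h0
    rw [h0] at h3
    simp at h3
  obtain ⟨v, hv, h0⟩ := Submodule.exists_mem_ne_zero_of_ne_bot this
  exact ⟨v, hv.1, hv.2, h0⟩

theorem finrank_range_prodMap_subtype (F : Submodule ℝ E) :
    finrank ℝ (LinearMap.range (F.subtype.prodMap F.subtype)) = 2 * finrank ℝ F := by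
  rw [LinearMap.finrank_range_of_inj, finrank_prod, two_mul]
  exact Prod.map_injective.2 ⟨F.subtype_injective, F.subtype_injective⟩

/-- A lower min-max bound, for a real operator acting on pairs of vectors (the real and imaginary
parts of complex vectors). -/
theorem le_singularValues (T : E →ₗ[ℝ] E) {d : ℕ} (hd : finrank ℝ E = d) {k : ℕ} (hk : k < d)
    (S : Submodule ℝ (E × E)) (hS : 2 * k < finrank ℝ S) {c : ℝ}
    (h : ∀ v ∈ S, c ^ 2 * (‖v.1‖ ^ 2 + ‖v.2‖ ^ 2) ≤ ‖T v.1‖ ^ 2 + ‖T v.2‖ ^ 2) :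
    c ≤ T.singularValues k := by
  obtain ⟨F, hF, hF0⟩ := finrank_ker_repr T hd (Finset.univ.filter fun j : Fin d => k ≤ j)
  have hcard : (Finset.univ.filter fun j : Fin d => k ≤ j).card = d - k := by
    have := Fin.card_Ici (⟨k, hk⟩ : Fin d)
    rw [← this]
    congr 1
    ext j
    simp [Fin.le_def]
  rw [hcard] at hF
  -- F × F has real dimension 2(d - k) in a space of dimension 2d, so it meets S, whose dimension
  -- exceeds 2k.
  obtain ⟨v, hvS, ⟨w, rfl⟩, hv0⟩ := exists_ne_zero_mem_inf S
    (LinearMap.range (F.subtype.prodMap F.subtype)) (by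
      rw [finrank_range_prodMap_subtype, finrank_prod, hd, hF]; omega)
  have key : ∀ x ∈ F, ‖T x‖ ^ 2 ≤ T.singularValues k ^ 2 * ‖x‖ ^ 2 := by
    intro x hx
    rw [norm_sq_apply_eq_sum_singularValues T hd, norm_sq_eq_sum_singularBasis T hd x,
      Finset.mul_sum]
    refine Finset.sum_le_sum fun j _ => ?_
    by_cases hj : k ≤ j
    · gcongr
      · exact T.singularValues_nonneg _
      · exact T.singularValues_antitone hj
    · rw [hF0 x hx j (by simpa using hj)]
      simp
  have h1 := h _ hvS
  have h2 := key _ w.1.2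
  have h3 := key _ w.2.2
  simp only [LinearMap.prodMap_apply, Submodule.subtype_apply] at h1 hv0
  have hpos : 0 < ‖(w.1 : E)‖ ^ 2 + ‖(w.2 : E)‖ ^ 2 := by
    rcases eq_or_ne (w.1 : E) 0 with h0 | h0
    · rcases eq_or_ne (w.2 : E) 0 with h0' | h0'
      · exact absurd (by rw [h0, h0']; rfl) hv0
      · have := norm_pos_iff.2 h0'
        positivity
    · have := norm_pos_iff.2 h0
      positivity
  refine le_of_sq_le_sq (le_of_mul_le_mul_right ?_ hpos) (T.singularValues_nonneg _)
  linarith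

/-- An upper min-max bound, for a real operator acting on pairs of vectors. -/
theorem singularValues_le (T : E →ₗ[ℝ] E) {d : ℕ} (hd : finrank ℝ E = d) {k : ℕ} (hk : k < d)
    (S : Submodule ℝ (E × E)) (hS : 2 * d < finrank ℝ S + 2 * (k + 1)) {c : ℝ} (hc : 0 ≤ c)
    (h : ∀ v ∈ S, ‖T v.1‖ ^ 2 + ‖T v.2‖ ^ 2 ≤ c ^ 2 * (‖v.1‖ ^ 2 + ‖v.2‖ ^ 2)) :
    T.singularValues k ≤ c := by
  obtain ⟨F, hF, hF0⟩ := finrank_ker_repr T hd (Finset.univ.filter fun j : Fin d => j ≤ k)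
  have hcard : (Finset.univ.filter fun j : Fin d => (j : ℕ) ≤ k).card = k + 1 := by
    have := Fin.card_Iic (⟨k, hk⟩ : Fin d)
    rw [← this]
    congr 1
    ext j
    simp [Fin.le_def]
  rw [hcard] at hF
  obtain ⟨v, hvS, ⟨w, rfl⟩, hv0⟩ := exists_ne_zero_mem_inf S
    (LinearMap.range (F.subtype.prodMap F.subtype)) (by
      rw [finrank_range_prodMap_subtype, finrank_prod, hd, hF]; omega)
  have key : ∀ x ∈ F, T.singularValues k ^ 2 * ‖x‖ ^ 2 ≤ ‖T x‖ ^ 2 := by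
    intro x hx
    rw [norm_sq_apply_eq_sum_singularValues T hd, norm_sq_eq_sum_singularBasis T hd x,
      Finset.mul_sum]
    refine Finset.sum_le_sum fun j _ => ?_
    by_cases hj : j ≤ k
    · gcongr
      · exact T.singularValues_nonneg _
      · exact T.singularValues_antitone hj
    · rw [hF0 x hx j (by simpa using hj)]
      simp
  have h1 := h _ hvS
  have h2 := key _ w.1.2
  have h3 := key _ w.2.2
  simp only [LinearMap.prodMap_apply, Submodule.subtype_apply] at h1 hv0
  have hpos : 0 < ‖(w.1 : E)‖ ^ 2 + ‖(w.2 : E)‖ ^ 2 := by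
    rcases eq_or_ne (w.1 : E) 0 with h0 | h0
    · rcases eq_or_ne (w.2 : E) 0 with h0' | h0'
      · exact absurd (by rw [h0, h0']; rfl) hv0
      · have := norm_pos_iff.2 h0'
        positivity
    · have := norm_pos_iff.2 h0
      positivity
  refine le_of_sq_le_sq (le_of_mul_le_mul_right ?_ hpos) hc
  linarith

end SingularValues

/-! ### Growth of powers of matrices with distinct eigenvalues -/

section Growth

variable {d : ℕ}

/-- A matrix with distinct complex eigenvalues has an eigenbasis. -/
theorem exists_eigenbasis (M : Matrix (Fin d) (Fin d) ℂ) (μ : Fin d → ℂ)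
    (hμ : Function.Injective μ) (h : ∀ j, M.charpoly.IsRoot (μ j)) :
    ∃ b : Module.Basis (Fin d) ℂ (Fin d → ℂ), ∀ j, M.mulVec (b j) = μ j • b j := by
  classical
  have hv : ∀ j, ∃ v, Module.End.HasEigenvector (Matrix.toLin' M) (μ j) v := fun j => by
    have : Module.End.HasEigenvalue (Matrix.toLin' M) (μ j) := by
      rw [Module.End.hasEigenvalue_iff_isRoot_charpoly, Matrix.charpoly_toLin']
      exact h j
    exact this.exists_hasEigenvector
  choose v hv using hv
  have hli := Module.End.eigenvectors_linearIndependent' (Matrix.toLin' M) μ hμ v hv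
  refine ⟨basisOfPiSpaceOfLinearIndependent hli, fun j => ?_⟩
  simpa using (hv j).apply_eq_smul

/-- The powers of a diagonalizable matrix grow, on a sum of eigenspaces, at most at the largest
and at least at the smallest rate. -/
theorem exists_pow_bounds (M : Matrix (Fin d) (Fin d) ℂ) (μ : Fin d → ℂ)
    (b : Module.Basis (Fin d) ℂ (Fin d → ℂ)) (hb : ∀ j, M.mulVec (b j) = μ j • b j) :
    ∃ K : ℝ, 0 < K ∧ ∀ s : Set (Fin d), ∀ v ∈ Submodule.span ℂ (b '' s), ∀ r : ℝ, 0 ≤ r →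
      ∀ n : ℕ,
      ((∀ j ∈ s, ‖μ j‖ ≤ r) →
        ‖WithLp.toLp 2 ((M ^ n).mulVec v)‖ ≤ K * r ^ n * ‖WithLp.toLp 2 v‖) ∧
      ((∀ j ∈ s, r ≤ ‖μ j‖) →
        r ^ n * ‖WithLp.toLp 2 v‖ ≤ K * ‖WithLp.toLp 2 ((M ^ n).mulVec v)‖) := by
  classical
  -- The ℓ¹ norm of the eigencoordinates: powers of M scale each of its terms separately, so the
  -- bounds hold for N with constant 1, and K only accounts for the equivalence with the Euclidean
  -- norm.
  set N : (Fin d → ℂ) → ℝ := fun v => ∑ j, ‖b.repr v j‖ with hN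
  have hup : ∃ K₁ : ℝ, 0 < K₁ ∧ ∀ v : Fin d → ℂ, ‖WithLp.toLp 2 v‖ ≤ K₁ * N v := by
    refine ⟨1 + ∑ j, ‖WithLp.toLp 2 (b j)‖, by positivity, fun v => ?_⟩
    have h1 : WithLp.toLp 2 v = ∑ j, b.repr v j • WithLp.toLp 2 (b j) := by
      have := congrArg (WithLp.linearEquiv 2 ℂ (Fin d → ℂ)).symm (b.sum_repr v)
      rw [map_sum] at this
      simpa using this.symm
    rw [h1]
    refine (norm_sum_le _ _).trans ?_
    rw [hN, Finset.mul_sum]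
    refine Finset.sum_le_sum fun j _ => ?_
    rw [norm_smul, mul_comm]
    gcongr
    have := Finset.single_le_sum (f := fun j => ‖WithLp.toLp 2 (b j)‖)
      (fun i _ => norm_nonneg _) (Finset.mem_univ j)
    linarith
  have hlo : ∃ K₂ : ℝ, 0 < K₂ ∧ ∀ v : Fin d → ℂ, N v ≤ K₂ * ‖WithLp.toLp 2 v‖ := by
    let L : Fin d → (EuclideanSpace ℂ (Fin d) →L[ℂ] ℂ) := fun j =>
      LinearMap.toContinuousLinearMap
        ((b.coord j) ∘ₗ (WithLp.linearEquiv 2 ℂ (Fin d → ℂ)).toLinearMap)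
    refine ⟨1 + ∑ j, ‖L j‖, by positivity, fun v => ?_⟩
    have : N v ≤ ∑ j, ‖L j‖ * ‖WithLp.toLp 2 v‖ := by
      refine Finset.sum_le_sum fun j _ => ?_
      exact (L j).le_opNorm (WithLp.toLp 2 v)
    rw [← Finset.sum_mul] at this
    nlinarith [norm_nonneg (WithLp.toLp 2 v)]
  obtain ⟨K₁, hK₁, h₁⟩ := hup
  obtain ⟨K₂, hK₂, h₂⟩ := hlo
  have hpow : ∀ (n : ℕ) (v : Fin d → ℂ) j, b.repr ((M ^ n).mulVec v) j = μ j ^ n * b.repr v j := by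
    intro n
    have hlin : ∀ v : Fin d → ℂ, ∀ j, b.repr (M.mulVec v) j = μ j * b.repr v j := by
      intro v j
      have h1 : M.mulVec v = ∑ i, (b.repr v i * μ i) • b i := by
        conv_lhs => rw [← b.sum_repr v]
        rw [Matrix.mulVec_sum]
        refine Finset.sum_congr rfl fun i _ => ?_
        rw [Matrix.mulVec_smul, hb, smul_smul]
      rw [h1, b.repr_sum_self, mul_comm]
    induction n with
    | zero => intro v j; simp
    | succ n ih =>
      intro v j
      rw [pow_succ, ← Matrix.mulVec_mulVec, ih, hlin, pow_succ]
      ring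
  have hNpow : ∀ (n : ℕ) (v : Fin d → ℂ),
      N ((M ^ n).mulVec v) = ∑ j, ‖μ j‖ ^ n * ‖b.repr v j‖ := by
    intro n v
    refine Finset.sum_congr rfl fun j _ => ?_
    rw [hpow, norm_mul, norm_pow]
  have hsupp : ∀ s : Set (Fin d), ∀ v ∈ Submodule.span ℂ (b '' s), ∀ j ∉ s, b.repr v j = 0 := by
    intro s v hv j hj
    have := (b.mem_span_image (m := v) (s := s)).1 hv
    by_contra h0
    exact hj (this (by simpa using h0))
  refine ⟨K₁ * K₂, by positivity, fun s v hv r hr n => ⟨fun h => ?_, fun h => ?_⟩⟩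
  · have h3 : N ((M ^ n).mulVec v) ≤ r ^ n * N v := by
      rw [hNpow, hN, Finset.mul_sum]
      refine Finset.sum_le_sum fun j _ => ?_
      by_cases hj : j ∈ s
      · gcongr
        exact h j hj
      · rw [hsupp s v hv j hj]
        simp
    calc _ ≤ K₁ * N ((M ^ n).mulVec v) := h₁ _
      _ ≤ K₁ * (r ^ n * (K₂ * ‖WithLp.toLp 2 v‖)) := by
        gcongr
        exact h3.trans (by gcongr; exact h₂ v)
      _ = _ := by ring
  · have h3 : r ^ n * N v ≤ N ((M ^ n).mulVec v) := by
      rw [hNpow, hN, Finset.mul_sum]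
      refine Finset.sum_le_sum fun j _ => ?_
      by_cases hj : j ∈ s
      · gcongr
        exact h j hj
      · rw [hsupp s v hv j hj]
        simp
    calc _ ≤ r ^ n * (K₁ * N v) := by gcongr; exact h₁ v
      _ = K₁ * (r ^ n * N v) := by ring
      _ ≤ K₁ * (K₂ * ‖WithLp.toLp 2 ((M ^ n).mulVec v)‖) := by
        exact mul_le_mul_of_nonneg_left (h3.trans (h₂ _)) hK₁.le
      _ = _ := by ring

/-- A monic split polynomial that is small at a point has a root nearby. -/
theorem exists_root_near (M : Matrix (Fin d) (Fin d) ℂ) (z : ℂ) {δ : ℝ} (hδ : 0 < δ)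
    (h : ‖M.charpoly.eval z‖ < δ ^ d) : ∃ w, M.charpoly.IsRoot w ∧ ‖z - w‖ < δ := by
  by_contra! hcon
  have hs : M.charpoly.Splits := IsAlgClosed.splits _
  have h1 : M.charpoly = (M.charpoly.roots.map fun a => Polynomial.X - Polynomial.C a).prod :=
    hs.eq_prod_roots_of_monic M.charpoly_monic
  have h2 : M.charpoly.roots.card = d := by
    rw [← hs.natDegree_eq_card_roots, Matrix.charpoly_natDegree_eq_dim, Fintype.card_fin]
  -- The value at z is the product of the differences between z and the d roots, so it has modulus
  -- at least δ^d if all of these have modulus at least δ.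
  have h3 : ∀ s : Multiset ℂ, (∀ w ∈ s, δ ≤ ‖z - w‖) →
      δ ^ s.card ≤ ‖((s.map fun a => Polynomial.X - Polynomial.C a).prod).eval z‖ := by
    intro s
    induction s using Multiset.induction with
    | empty => simp
    | cons a s ih =>
      intro hs
      simp only [Multiset.card_cons, Multiset.map_cons, Multiset.prod_cons, Polynomial.eval_mul,
        Polynomial.eval_sub, Polynomial.eval_X, Polynomial.eval_C, norm_mul, pow_succ']
      exact mul_le_mul (hs a (by simp)) (ih fun w hw => hs w (by simp [hw])) (by positivity)
        (norm_nonneg _)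
  have h4 := h3 M.charpoly.roots fun w hw => hcon w (Polynomial.isRoot_of_mem_roots hw)
  rw [← h1, h2] at h4
  linarith

/-- A real matrix, with complex coefficients. -/
noncomputable def complexify (M : Matrix (Fin d) (Fin d) ℝ) : Matrix (Fin d) (Fin d) ℂ :=
  M.map Complex.ofRealHom

theorem complexify_pow (M : Matrix (Fin d) (Fin d) ℝ) (n : ℕ) :
    complexify (M ^ n) = complexify M ^ n :=
  map_pow (Complex.ofRealHom.mapMatrix) M n

theorem continuous_complexify : Continuous (complexify (d := d)) :=
  continuous_id.matrix_map Complex.continuous_ofReal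

theorem isRoot_conj (M : Matrix (Fin d) (Fin d) ℝ) {z : ℂ} (h : (complexify M).charpoly.IsRoot z) :
    (complexify M).charpoly.IsRoot ((starRingEnd ℂ) z) := by
  have hm : (complexify M).charpoly = M.charpoly.map Complex.ofRealHom :=
    Matrix.charpoly_map M Complex.ofRealHom
  rw [hm] at h ⊢
  rw [Polynomial.IsRoot.def, Polynomial.eval_map] at h ⊢
  have := congrArg (starRingEnd ℂ) h
  rw [Polynomial.hom_eval₂, map_zero] at this
  rw [← this]
  congr 1
  ext x
  simp

theorem continuous_charpoly_eval (z : ℂ) :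
    Continuous fun M : Matrix (Fin d) (Fin d) ℂ => M.charpoly.eval z := by
  have : (fun M : Matrix (Fin d) (Fin d) ℂ => M.charpoly.eval z) =
      fun M => (Matrix.scalar (Fin d) z - M).det := by
    funext M
    rw [Matrix.eval_charpoly]
  rw [this]
  exact (continuous_const.sub continuous_id).matrix_det

/-- The real pair of vectors underlying a complex vector. -/
noncomputable def reIm (d : ℕ) :
    (Fin d → ℂ) →ₗ[ℝ] EuclideanSpace ℝ (Fin d) × EuclideanSpace ℝ (Fin d) where
  toFun v := (WithLp.toLp 2 fun i => (v i).re, WithLp.toLp 2 fun i => (v i).im)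
  map_add' v w := by ext <;> simp
  map_smul' c v := by ext <;> simp

theorem reIm_injective : Function.Injective (reIm d) := by
  intro v w h
  funext i
  have h1 := congrArg (fun x => x.1 i) h
  have h2 := congrArg (fun x => x.2 i) h
  exact Complex.ext h1 h2

theorem norm_sq_reIm (v : Fin d → ℂ) :
    ‖(reIm d v).1‖ ^ 2 + ‖(reIm d v).2‖ ^ 2 = ‖WithLp.toLp 2 v‖ ^ 2 := by
  simp only [EuclideanSpace.norm_sq_eq, reIm, LinearMap.coe_mk, AddHom.coe_mk,
    ← Finset.sum_add_distrib]
  refine Finset.sum_congr rfl fun i _ => ?_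
  rw [Complex.sq_norm, Complex.normSq_apply]
  simp [sq]

theorem reIm_complexify_mulVec (M : Matrix (Fin d) (Fin d) ℝ) (v : Fin d → ℂ) :
    reIm d ((complexify M).mulVec v) =
      (Matrix.toEuclideanLin M (reIm d v).1, Matrix.toEuclideanLin M (reIm d v).2) := by
  ext i <;>
  simp [reIm, complexify, Matrix.mulVec, dotProduct, Matrix.toLpLin_apply, Complex.re_sum,
    Complex.im_sum]

/-- If a real matrix with distinct eigenvalues has a pair of eigenvalues of equal modulus in
positions `i`, `i + 1`, then so do all nearby matrices when the pair is complex conjugate, and the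
corresponding singular values of their powers stay comparable. -/
theorem eventually_singularValues_pow_le (M₀ : Matrix (Fin d) (Fin d) ℝ) (μ : Fin d → ℂ)
    (hμ : Function.Injective μ) (hroot : ∀ j, (complexify M₀).charpoly.IsRoot (μ j))
    (i : ℕ) (hi : i + 1 < d)
    (hconj : (starRingEnd ℂ) (μ ⟨i, by omega⟩) = μ ⟨i + 1, hi⟩)
    (hlt : ∀ j : Fin d, (j : ℕ) < i → ‖μ ⟨i, by omega⟩‖ < ‖μ j‖)
    (hgt : ∀ j : Fin d, i + 1 < (j : ℕ) → ‖μ j‖ < ‖μ ⟨i, by omega⟩‖) :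
    ∀ᶠ M in 𝓝 M₀, ∃ C : ℝ, ∀ n : ℕ,
      (Matrix.toEuclideanLin (M ^ n)).singularValues i ≤
        C * (Matrix.toEuclideanLin (M ^ n)).singularValues (i + 1) := by
  -- A δ so small that the discs of radius δ about the eigenvalues are disjoint and that moving all
  -- eigenvalues by less than δ keeps the strict inequalities between moduli.
  obtain ⟨δ, hδ, hδ1, hδ2, hδ3⟩ : ∃ δ : ℝ, 0 < δ ∧ (∀ j k, j ≠ k → 2 * δ < ‖μ j - μ k‖) ∧
      (∀ j : Fin d, (j : ℕ) < i → ‖μ ⟨i, by omega⟩‖ + 2 * δ < ‖μ j‖) ∧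
      (∀ j : Fin d, i + 1 < (j : ℕ) → ‖μ j‖ + 2 * δ < ‖μ ⟨i, by omega⟩‖) := by
    have e : ∀ {a b : ℝ}, a < b → ∀ᶠ δ : ℝ in 𝓝[>] 0, a + 2 * δ < b := by
      intro a b hab
      have : Tendsto (fun δ : ℝ => a + 2 * δ) (𝓝[>] 0) (𝓝 (a + 2 * 0)) :=
        (Continuous.tendsto (by fun_prop) 0).mono_left nhdsWithin_le_nhds
      rw [mul_zero, add_zero] at this
      exact this.eventually_lt_const hab
    have h1 : ∀ᶠ δ : ℝ in 𝓝[>] 0, ∀ j k, j ≠ k → 2 * δ < ‖μ j - μ k‖ := by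
      simp only [eventually_all]
      intro j k hjk
      simpa using e (norm_pos_iff.2 (sub_ne_zero.2 (hμ.ne hjk)))
    have h2 : ∀ᶠ δ : ℝ in 𝓝[>] 0,
        ∀ j : Fin d, (j : ℕ) < i → ‖μ ⟨i, by omega⟩‖ + 2 * δ < ‖μ j‖ := by
      simp only [eventually_all]
      exact fun j hj => e (hlt j hj)
    have h3 : ∀ᶠ δ : ℝ in 𝓝[>] 0,
        ∀ j : Fin d, i + 1 < (j : ℕ) → ‖μ j‖ + 2 * δ < ‖μ ⟨i, by omega⟩‖ := by
      simp only [eventually_all]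
      exact fun j hj => e (hgt j hj)
    obtain ⟨δ, hδ, h⟩ := (eventually_mem_nhdsWithin.and (h1.and (h2.and h3))).exists
    exact ⟨δ, hδ, h⟩
  have hev : ∀ᶠ M in 𝓝 M₀, ∀ j, ‖(complexify M).charpoly.eval (μ j)‖ < δ ^ d := by
    simp only [eventually_all]
    intro j
    have hc : Tendsto (fun M => ‖(complexify M).charpoly.eval (μ j)‖) (𝓝 M₀)
        (𝓝 ‖(complexify M₀).charpoly.eval (μ j)‖) :=
      (((continuous_charpoly_eval (μ j)).comp continuous_complexify).norm).tendsto M₀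
    rw [(hroot j : _ = _), norm_zero] at hc
    exact hc.eventually_lt_const (by positivity)
  filter_upwards [hev] with M hM
  choose μ' hr' hd' using fun j => exists_root_near (complexify M) (μ j) hδ (hM j)
  obtain ⟨ν, hν, hνr, hνd, hνc⟩ : ∃ ν : Fin d → ℂ, Function.Injective ν ∧
      (∀ j, (complexify M).charpoly.IsRoot (ν j)) ∧ (∀ j, ‖μ j - ν j‖ < δ) ∧
      ‖ν ⟨i + 1, hi⟩‖ = ‖ν ⟨i, by omega⟩‖ := by
    classical
    have hne : (⟨i, by omega⟩ : Fin d) ≠ ⟨i + 1, hi⟩ := by simp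
    -- Near μ_{i+1} the conjugate of the root found near μ_i is taken, so that the two moduli agree
    -- exactly and not just approximately.
    set ν := Function.update μ' ⟨i + 1, hi⟩ ((starRingEnd ℂ) (μ' ⟨i, by omega⟩)) with hνdef
    have hνd : ∀ j, ‖μ j - ν j‖ < δ := by
      intro j
      rcases eq_or_ne j ⟨i + 1, hi⟩ with rfl | hj
      · rw [hνdef, Function.update_self, ← hconj, ← map_sub, RCLike.norm_conj]
        exact hd' _
      · rw [hνdef, Function.update_of_ne hj]
        exact hd' j
    refine ⟨ν, ?_, ?_, hνd, ?_⟩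
    · intro j k hjk
      by_contra h
      have h1 := hνd j
      have h2 := hνd k
      rw [← hjk, norm_sub_rev] at h2
      have h3 := norm_sub_le_norm_sub_add_norm_sub (μ j) (ν j) (μ k)
      linarith [hδ1 j k h]
    · intro j
      rcases eq_or_ne j ⟨i + 1, hi⟩ with rfl | hj
      · rw [hνdef, Function.update_self]
        exact isRoot_conj M (hr' _)
      · rw [hνdef, Function.update_of_ne hj]
        exact hr' j
    · rw [hνdef, Function.update_self, Function.update_of_ne hne, RCLike.norm_conj]
  obtain ⟨b, hb⟩ := exists_eigenbasis _ ν hν hνr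
  obtain ⟨K, hK, hpow⟩ := exists_pow_bounds _ ν b hb
  set r := ‖ν ⟨i, by omega⟩‖ with hr
  have hnear : ∀ j, |‖μ j‖ - ‖ν j‖| < δ := fun j => (abs_norm_sub_norm_le _ _).trans_lt (hνd j)
  have hnear' : ∀ j, ‖μ j‖ - ‖ν j‖ < δ ∧ ‖ν j‖ - ‖μ j‖ < δ := fun j => by
    have := abs_lt.1 (hnear j)
    exact ⟨this.2, by linarith⟩
  -- The index sets {j ≤ i + 1} and {j ≥ i} both contain the pair. The first gives a lower bound for
  -- the singular value with index i + 1, the second an upper bound for that with index i, both with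
  -- the same rate r^n.
  have hlarge : ∀ j ∈ {j : Fin d | (j : ℕ) ≤ i + 1}, r ≤ ‖ν j‖ := by
    intro j hj
    rcases Nat.lt_or_ge j i with h | h
    · linarith [hδ2 j h, (hnear' j).1, (hnear' ⟨i, by omega⟩).2]
    · rcases Nat.eq_or_lt_of_le h with h | h
      · have : j = ⟨i, by omega⟩ := Fin.ext h.symm
        rw [this]
      · have : j = ⟨i + 1, hi⟩ := Fin.ext (le_antisymm hj h)
        rw [this, hνc]
  have hsmall : ∀ j ∈ {j : Fin d | i ≤ (j : ℕ)}, ‖ν j‖ ≤ r := by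
    intro j hj
    rcases Nat.lt_or_ge (i + 1) j with h | h
    · linarith [hδ3 j h, (hnear' j).2, (hnear' ⟨i, by omega⟩).1]
    · rcases Nat.eq_or_lt_of_le h with h | h
      · have : j = ⟨i + 1, hi⟩ := Fin.ext h
        rw [this, hνc]
      · have : j = ⟨i, by omega⟩ := Fin.ext (le_antisymm (Nat.le_of_lt_succ h) hj)
        rw [this]
  have hfin : ∀ s : Set (Fin d), ∀ m, s.ncard = m → Module.finrank ℝ
      (((Submodule.span ℂ (b '' s)).restrictScalars ℝ).map (reIm d)) = 2 * m := by
    intro s m hs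
    classical
    rw [LinearEquiv.finrank_eq (Submodule.equivMapOfInjective _ reIm_injective _).symm]
    have h1 : Module.finrank ℝ ((Submodule.span ℂ (b '' s)).restrictScalars ℝ) =
        2 * Module.finrank ℂ (Submodule.span ℂ (b '' s)) :=
      finrank_real_of_complex (Submodule.span ℂ (b '' s))
    rw [h1]
    have hli : LinearIndependent ℂ (fun i : s => b i) :=
      b.linearIndependent.comp _ Subtype.val_injective
    have h2 := finrank_span_eq_card hli
    rw [Set.image_eq_range]
    rw [h2, ← hs, Set.ncard_eq_toFinset_card', Set.toFinset_card]
  have hcard1 : ({j : Fin d | (j : ℕ) ≤ i + 1}).ncard = i + 2 := by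
    have := Fin.card_Iic (⟨i + 1, hi⟩ : Fin d)
    rw [Set.ncard_eq_toFinset_card', ← this]
    congr 1
    ext j
    simp [Fin.le_def]
  have hcard2 : ({j : Fin d | i ≤ (j : ℕ)}).ncard = d - i := by
    have := Fin.card_Ici (⟨i, by omega⟩ : Fin d)
    rw [Set.ncard_eq_toFinset_card', ← this]
    congr 1
    ext j
    simp [Fin.le_def]
  refine ⟨K * K, fun n => ?_⟩
  have hdim : Module.finrank ℝ (EuclideanSpace ℝ (Fin d)) = d := by simp
  have hlow : K⁻¹ * r ^ n ≤ (Matrix.toEuclideanLin (M ^ n)).singularValues (i + 1) := by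
    refine le_singularValues _ hdim hi _ (by rw [hfin _ _ hcard1]; omega) ?_
    rintro _ ⟨v, hv, rfl⟩
    have h1 := (hpow _ v hv r (norm_nonneg _) n).2 hlarge
    rw [← complexify_pow] at h1
    have h2 := norm_sq_reIm ((complexify (M ^ n)).mulVec v)
    rw [reIm_complexify_mulVec] at h2
    rw [h2, norm_sq_reIm, ← mul_pow]
    refine pow_le_pow_left₀ (by positivity) ?_ 2
    rw [mul_assoc, inv_mul_le_iff₀ hK]
    exact h1
  have hupp : (Matrix.toEuclideanLin (M ^ n)).singularValues i ≤ K * r ^ n := by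
    refine singularValues_le _ hdim (by omega) _ (by rw [hfin _ _ hcard2]; omega)
      (by positivity) ?_
    rintro _ ⟨v, hv, rfl⟩
    have h1 := (hpow _ v hv r (norm_nonneg _) n).1 hsmall
    rw [← complexify_pow] at h1
    have h2 := norm_sq_reIm ((complexify (M ^ n)).mulVec v)
    rw [reIm_complexify_mulVec] at h2
    rw [h2, norm_sq_reIm, ← mul_pow]
    exact pow_le_pow_left₀ (norm_nonneg _) h1 2
  rw [inv_mul_le_iff₀ hK] at hlow
  calc _ ≤ K * r ^ n := hupp
    _ ≤ K * (K * _) := by gcongr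
    _ = _ := by ring

end Growth

/-! ### Word length -/

section WordLength

variable {Γ : Type*} [Group Γ] {d : ℕ}

theorem wordLength_le {T : Set Γ} {γ : Γ} (l : List Γ) (hl : ∀ x ∈ l, x ∈ T ∨ x⁻¹ ∈ T)
    (hp : l.prod = γ) : wordLength T γ ≤ l.length :=
  Nat.sInf_le ⟨l, hl, hp, rfl⟩

theorem exists_list_of_mem_closure_eq_top {T : Set Γ} (hT : Subgroup.closure T = ⊤) (γ : Γ) :
    ∃ l : List Γ, (∀ x ∈ l, x ∈ T ∨ x⁻¹ ∈ T) ∧ l.prod = γ := by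
  have h : γ ∈ Submonoid.closure (T ∪ T⁻¹) := by
    rw [← Subgroup.closure_toSubmonoid, hT]
    trivial
  obtain ⟨l, hl, hp⟩ := Submonoid.exists_list_of_mem_closure h
  exact ⟨l, hl, hp⟩

theorem exists_list_length_eq_wordLength {T : Set Γ} (hT : Subgroup.closure T = ⊤) (γ : Γ) :
    ∃ l : List Γ, (∀ x ∈ l, x ∈ T ∨ x⁻¹ ∈ T) ∧ l.prod = γ ∧ l.length = wordLength T γ := by
  have hne : {n : ℕ | ∃ l : List Γ, (∀ x ∈ l, x ∈ T ∨ x⁻¹ ∈ T) ∧ l.prod = γ ∧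
      l.length = n}.Nonempty := by
    obtain ⟨l, hl, hp⟩ := exists_list_of_mem_closure_eq_top hT γ
    exact ⟨l.length, l, hl, hp, rfl⟩
  exact Nat.sInf_mem hne

theorem finite_setOf_wordLength_le {T : Set Γ} (hf : T.Finite) (hT : Subgroup.closure T = ⊤)
    (N : ℕ) : {γ : Γ | wordLength T γ ≤ N}.Finite := by
  have hn : ∀ n : ℕ, {γ : Γ | ∃ l : List Γ, (∀ x ∈ l, x ∈ T ∨ x⁻¹ ∈ T) ∧ l.prod = γ ∧
      l.length = n}.Finite := by
    intro n
    induction n with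
    | zero =>
      refine (Set.finite_singleton (1 : Γ)).subset ?_
      rintro γ ⟨l, -, hp, hl⟩
      rw [List.length_eq_zero_iff] at hl
      subst hl
      simpa using hp.symm
    | succ n ih =>
      have hfin : (T ∪ T⁻¹).Finite := hf.union hf.inv
      refine (Set.Finite.image2 (fun a b : Γ => a * b) hfin ih).subset ?_
      rintro γ ⟨l, hl, hp, hlen⟩
      obtain ⟨a, l', rfl⟩ := List.exists_cons_of_length_eq_add_one hlen
      refine ⟨a, hl a (by simp), l'.prod, ⟨l', fun x hx => hl x (by simp [hx]), rfl, ?_⟩, ?_⟩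
      · simpa using hlen
      · simpa using hp
  refine ((Set.finite_Iic N).biUnion fun n _ => hn n).subset ?_
  intro γ hγ
  obtain ⟨l, hl, hp, hlen⟩ := exists_list_length_eq_wordLength hT γ
  exact Set.mem_biUnion (show wordLength T γ ∈ Set.Iic N from hγ) ⟨l, hl, hp, hlen⟩

/-- Balls for a finite generating set are finite, while the powers of γ are pairwise distinct. -/
theorem exists_lt_wordLength_pow {T : Set Γ} (hf : T.Finite) (hT : Subgroup.closure T = ⊤)
    {γ : Γ} (hγ : ∀ n : ℕ, n ≠ 0 → γ ^ n ≠ 1) (N : ℕ) : ∃ n : ℕ, N < wordLength T (γ ^ n) := by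
  by_contra! h
  have hinj : Function.Injective fun n : ℕ => γ ^ n :=
    injective_pow_iff_not_isOfFinOrder.2 fun hfin => by
      obtain ⟨n, hn, h1⟩ := isOfFinOrder_iff_pow_eq_one.1 hfin
      exact hγ n hn.ne' h1
  exact Set.infinite_of_injective_forall_mem hinj (fun n => h n)
    (finite_setOf_wordLength_le hf hT N)

end WordLength

/-! ### Singular values of elements of `SL(d, ℝ)` -/

section Ratio

variable {d : ℕ}

theorem toEuclideanLin_inv_apply (A : Matrix.SpecialLinearGroup (Fin d) ℝ)
    (v : EuclideanSpace ℝ (Fin d)) :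
    Matrix.toEuclideanLin (A⁻¹ : Matrix.SpecialLinearGroup (Fin d) ℝ).1
      (Matrix.toEuclideanLin A.1 v) = v := by
  have h : (A⁻¹).1 * A.1 = 1 := by
    rw [← Matrix.SpecialLinearGroup.coe_mul, inv_mul_cancel, Matrix.SpecialLinearGroup.coe_one]
  simp only [Matrix.toLpLin_apply, Matrix.mulVec_mulVec, h, Matrix.one_mulVec]

theorem sigma_last_pos (hd : 0 < d) (A : Matrix.SpecialLinearGroup (Fin d) ℝ) : 0 < sigma d A := by
  obtain ⟨w, hw, h⟩ := exists_norm_apply_eq_singularValues (Matrix.toEuclideanLin A.1) (d := d)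
    (by simp) ⟨d - 1, by omega⟩
  rw [sigma, ← h, norm_pos_iff]
  intro h0
  have := toEuclideanLin_inv_apply A w
  rw [h0, map_zero] at this
  rw [← this, norm_zero] at hw
  exact zero_ne_one hw

theorem le_sigma_ratio (hd : 0 < d) (A : Matrix.SpecialLinearGroup (Fin d) ℝ)
    (v w : EuclideanSpace ℝ (Fin d)) {c : ℝ} (hc : 0 ≤ c) (hw : w ≠ 0)
    (h : c * ‖v‖ * ‖Matrix.toEuclideanLin A.1 w‖ ≤ ‖Matrix.toEuclideanLin A.1 v‖ * ‖w‖)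
    (hv : v ≠ 0) :
    c ≤ sigma 1 A / sigma d A := by
  rw [le_div_iff₀ (sigma_last_pos hd A)]
  have h1 := norm_apply_le_singularValues_zero (Matrix.toEuclideanLin A.1) v
  have h2 := singularValues_last_mul_le (Matrix.toEuclideanLin A.1) (d := d) (by simp) w
  have hv' := norm_pos_iff.2 hv
  have hw' := norm_pos_iff.2 hw
  refine le_of_mul_le_mul_right ?_ (mul_pos hv' hw')
  calc c * sigma d A * (‖v‖ * ‖w‖) = c * ‖v‖ * (sigma d A * ‖w‖) := by ring
    _ ≤ c * ‖v‖ * ‖Matrix.toEuclideanLin A.1 w‖ := by gcongr; exact h2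
    _ ≤ _ := h
    _ ≤ (sigma 1 A * ‖v‖) * ‖w‖ := by gcongr; exact h1
    _ = _ := by ring

/-- The largest singular value is bounded by the operator norm of A, and the inverse of the smallest
one by that of A⁻¹. This product is submultiplicative, hence grows at most exponentially in the word
length. -/
theorem sigma_ratio_le (hd : 0 < d) (A : Matrix.SpecialLinearGroup (Fin d) ℝ) :
    sigma 1 A / sigma d A ≤ ‖Matrix.toEuclideanCLM (n := Fin d) (𝕜 := ℝ) A.1‖ *
      ‖Matrix.toEuclideanCLM (n := Fin d) (𝕜 := ℝ) (A⁻¹).1‖ := by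
  rw [div_le_iff₀ (sigma_last_pos hd A)]
  obtain ⟨v, hv, h⟩ := exists_norm_apply_eq_singularValues (Matrix.toEuclideanLin A.1) (d := d)
    (by simp) ⟨0, hd⟩
  obtain ⟨w, hw, h'⟩ := exists_norm_apply_eq_singularValues (Matrix.toEuclideanLin A.1) (d := d)
    (by simp) ⟨d - 1, by omega⟩
  have e1 : sigma 1 A = ‖Matrix.toEuclideanCLM (n := Fin d) (𝕜 := ℝ) A.1 v‖ := h.symm
  have e2 : sigma d A = ‖Matrix.toEuclideanLin A.1 w‖ := h'.symm
  have h1 := (Matrix.toEuclideanCLM (n := Fin d) (𝕜 := ℝ) A.1).le_opNorm v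
  have h2 := (Matrix.toEuclideanCLM (n := Fin d) (𝕜 := ℝ) (A⁻¹).1).le_opNorm
    (Matrix.toEuclideanLin A.1 w)
  have h3 : Matrix.toEuclideanCLM (n := Fin d) (𝕜 := ℝ) (A⁻¹).1 (Matrix.toEuclideanLin A.1 w) = w :=
    toEuclideanLin_inv_apply A w
  rw [h3, hw] at h2
  rw [hv, mul_one] at h1
  rw [e1, e2, mul_assoc]
  nlinarith [norm_nonneg (Matrix.toEuclideanCLM (n := Fin d) (𝕜 := ℝ) A.1)]

end Ratio

/-! ### Criteria for quasi-isometric embeddings and for not being a limit of Anosov representations.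
-/

section Criteria

variable {Γ : Type*} [Group Γ] {d : ℕ}

/-- Only the lower bound matters in the definition of a quasi-isometric embedding. -/
theorem isQuasiIsometricEmbedding_of_le (hd : 0 < d)
    (ρ : Γ →* Matrix.SpecialLinearGroup (Fin d) ℝ) {T : Set Γ} (hf : T.Finite)
    (hT : Subgroup.closure T = ⊤) {J K : ℝ} (hJ : 0 < J) (hK : 0 < K)
    (h : ∀ γ, 1 / K * Real.exp (1 / J * wordLength T γ) ≤ sigma 1 (ρ γ) / sigma d (ρ γ)) :
    IsQuasiIsometricEmbedding ρ := by
  let N : Γ → ℝ := fun γ => ‖Matrix.toEuclideanCLM (n := Fin d) (𝕜 := ℝ) (ρ γ).1‖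
  have hN : ∀ a b, N (a * b) ≤ N a * N b := by
    intro a b
    simp only [N, map_mul, Matrix.SpecialLinearGroup.coe_mul]
    exact norm_mul_le _ _
  have hN0 : ∀ a, 0 ≤ N a := fun a => norm_nonneg _
  have hN1 : N 1 ≤ 1 := by
    simp only [N, map_one, Matrix.SpecialLinearGroup.coe_one]
    exact ContinuousLinearMap.norm_id_le
  obtain ⟨D, hD⟩ : ∃ D : ℝ, ∀ x, (x ∈ T ∨ x⁻¹ ∈ T) → N x ≤ D ∧ N x⁻¹ ≤ D := by
    have hfin : (T ∪ T⁻¹).Finite := hf.union hf.inv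
    obtain ⟨D, hD⟩ := (hfin.image N).bddAbove
    refine ⟨D, fun x hx => ⟨hD ⟨x, hx, rfl⟩, hD ⟨x⁻¹, ?_, rfl⟩⟩⟩
    rcases hx with hx | hx
    · exact Or.inr (by simpa using hx)
    · exact Or.inl hx
  set D' := max D 1
  have hD'1 : 1 ≤ D' := le_max_right _ _
  have hlist : ∀ l : List Γ, (∀ x ∈ l, x ∈ T ∨ x⁻¹ ∈ T) →
      N l.prod ≤ D' ^ l.length ∧ N l.prod⁻¹ ≤ D' ^ l.length := by
    intro l
    induction l with
    | nil => intro _; simpa using hN1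
    | cons a l ih =>
      intro hl
      obtain ⟨h1, h2⟩ := ih fun x hx => hl x (by simp [hx])
      obtain ⟨h3, h4⟩ := hD a (hl a (by simp))
      have h3' : N a ≤ D' := h3.trans (le_max_left _ _)
      have h4' : N a⁻¹ ≤ D' := h4.trans (le_max_left _ _)
      rw [List.prod_cons, List.length_cons, mul_inv_rev]
      constructor
      · rw [pow_succ']
        exact (hN _ _).trans (mul_le_mul h3' h1 (hN0 _) (by positivity))
      · rw [pow_succ]
        exact (hN _ _).trans (mul_le_mul h2 h4' (hN0 _) (by positivity))
  -- Both γ and γ⁻¹ have norm at most D' ^ |γ|, so 2 log D' is an exponent for the upper bound;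
  -- enlarging J and K weakens the lower bound.
  set J' := max J (2 * Real.log D')
  set K' := max K 1
  have hJ' : 0 < J' := lt_of_lt_of_le hJ (le_max_left _ _)
  have hK' : 0 < K' := lt_of_lt_of_le hK (le_max_left _ _)
  refine ⟨T, hf, hT, J', K', hJ', hK', fun γ => ⟨?_, ?_⟩⟩
  · refine le_trans ?_ (h γ)
    gcongr
    · exact le_max_left _ _
    · exact le_max_left _ _
  · obtain ⟨l, hl, hp, hlen⟩ := exists_list_length_eq_wordLength hT γ
    obtain ⟨h1, h2⟩ := hlist l hl
    rw [hp, hlen] at h1 h2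
    have h3 := sigma_ratio_le hd (ρ γ)
    rw [← map_inv] at h3
    calc _ ≤ N γ * N γ⁻¹ := h3
      _ ≤ D' ^ wordLength T γ * D' ^ wordLength T γ := mul_le_mul h1 h2 (hN0 _) (by positivity)
      _ = Real.exp (2 * Real.log D' * wordLength T γ) := by
        have h4 : 2 * Real.log D' * (wordLength T γ : ℝ) =
            ((wordLength T γ + wordLength T γ : ℕ) : ℝ) * Real.log D' := by push_cast; ring
        rw [← pow_add, h4, Real.exp_nat_mul, Real.exp_log (by linarith)]
      _ ≤ 1 * Real.exp (J' * wordLength T γ) := by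
        rw [one_mul]
        gcongr
        exact le_max_right _ _
      _ ≤ _ := by
        gcongr
        exact le_max_right _ _

/-- The matrix `M` has distinct complex eigenvalues, which can be ordered in such a way that those
in positions `i` and `i + 1` (counting from `0`) are complex conjugate and their modulus separates
the other eigenvalues. -/
def HasConjPairAt (M : Matrix (Fin d) (Fin d) ℝ) (i : ℕ) : Prop :=
  ∃ (hi : i + 1 < d) (μ : Fin d → ℂ), Function.Injective μ ∧
    (∀ j, (complexify M).charpoly.IsRoot (μ j)) ∧
    (starRingEnd ℂ) (μ ⟨i, by omega⟩) = μ ⟨i + 1, hi⟩ ∧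
    (∀ j : Fin d, (j : ℕ) < i → ‖μ ⟨i, by omega⟩‖ < ‖μ j‖) ∧
    (∀ j : Fin d, i + 1 < (j : ℕ) → ‖μ j‖ < ‖μ ⟨i, by omega⟩‖)

/-- An obstruction to being a limit of Anosov representations: for every `i` some element of
infinite order has a complex conjugate pair of eigenvalues in positions `i` and `i + 1`. -/
theorem not_isLimitOfAnosov (ρ : Γ →* Matrix.SpecialLinearGroup (Fin d) ℝ)
    (h : ∀ i : ℕ, 1 ≤ i → 2 * i ≤ d → ∃ γ : Γ, (∀ n : ℕ, n ≠ 0 → γ ^ n ≠ 1) ∧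
      HasConjPairAt (ρ γ).1 (i - 1)) : ¬ IsLimitOfAnosov ρ := by
  rintro ⟨η, hη, hlim⟩
  choose! γ hγ hpair using h
  have hev : ∀ i ∈ Finset.Icc 1 d, 2 * i ≤ d → ∀ᶠ n in atTop, ∃ C : ℝ, ∀ k : ℕ,
      (Matrix.toEuclideanLin ((η n (γ i)).1 ^ k)).singularValues (i - 1) ≤
        C * (Matrix.toEuclideanLin ((η n (γ i)).1 ^ k)).singularValues (i - 1 + 1) := by
    intro i hi hid
    obtain ⟨hi', μ, h1, h2, h3, h4, h5⟩ := hpair i (Finset.mem_Icc.1 hi).1 hid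
    have hc : Tendsto (fun n => (η n (γ i)).1) atTop (𝓝 (ρ (γ i)).1) :=
      (continuous_subtype_val.tendsto _).comp (hlim (γ i))
    exact hc.eventually (eventually_singularValues_pow_le _ μ h1 h2 (i - 1) hi' h3 h4 h5)
  -- The index for which `η n` is Anosov may depend on n. As there are finitely many indices, one n
  -- can be chosen that violates all of them.
  have hev' : ∀ᶠ n in atTop, ∀ i ∈ Finset.Icc 1 d, 2 * i ≤ d → ∃ C : ℝ, ∀ k : ℕ,
      (Matrix.toEuclideanLin ((η n (γ i)).1 ^ k)).singularValues (i - 1) ≤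
        C * (Matrix.toEuclideanLin ((η n (γ i)).1 ^ k)).singularValues (i - 1 + 1) := by
    rw [Finset.eventually_all]
    intro i hi
    by_cases hid : 2 * i ≤ d
    · filter_upwards [hev i hi hid] with n hn _ using hn
    · exact Eventually.of_forall fun n h => absurd h hid
  obtain ⟨n, hn⟩ := hev'.exists
  obtain ⟨i, hi1, hid, T, hf, hT, C, a, hC, ha, hAn⟩ := hη n
  obtain ⟨C', hC'⟩ := hn i (Finset.mem_Icc.2 ⟨hi1, by omega⟩) hid
  obtain ⟨N, hN⟩ : ∃ N : ℕ, C' < C * Real.exp (a * N) := by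
    have : Tendsto (fun N : ℕ => C * Real.exp (a * N)) atTop atTop :=
      (Real.tendsto_exp_atTop.comp
        (tendsto_natCast_atTop_atTop.const_mul_atTop ha)).const_mul_atTop hC
    exact (this.eventually_gt_atTop C').exists
  obtain ⟨k, hk⟩ := exists_lt_wordLength_pow hf hT (hγ i hi1 hid) N
  have h1 := hAn (γ i ^ k)
  have h2 := hC' k
  have h3 : C * Real.exp (a * N) ≤ C * Real.exp (a * wordLength T (γ i ^ k)) := by
    gcongr
  rw [map_pow] at h1
  have e1 : sigma i (η n (γ i) ^ k) =
      (Matrix.toEuclideanLin ((η n (γ i)).1 ^ k)).singularValues (i - 1) := by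
    rw [sigma, Matrix.SpecialLinearGroup.coe_pow]
  have e2 : sigma (i + 1) (η n (γ i) ^ k) =
      (Matrix.toEuclideanLin ((η n (γ i)).1 ^ k)).singularValues (i - 1 + 1) := by
    rw [sigma, Matrix.SpecialLinearGroup.coe_pow, Nat.sub_add_cancel hi1, Nat.add_sub_cancel]
  rw [← e1, ← e2] at h2
  have hpos : 0 < C * Real.exp (a * wordLength T (γ i ^ k)) := by positivity
  -- If this singular value vanished, the quotient would be 0 by the convention x / 0 = 0, contrary
  -- to its positive lower bound.
  have hs2 : 0 < sigma (i + 1) (η n (γ i) ^ k) := by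
    have h0 : 0 ≤ sigma (i + 1) (η n (γ i) ^ k) := by
      rw [e2]; exact LinearMap.singularValues_nonneg _ _
    refine lt_of_le_of_ne h0 fun h => ?_
    rw [← h, div_zero] at h1
    linarith
  rw [le_div_iff₀ hs2] at h1
  have := le_of_mul_le_mul_right (h1.trans h2) hs2
  linarith

end Criteria

/-! ### Direct sums and tensor products of matrices -/

section Eigenvalues

variable {d : ℕ}

theorem isRoot_charpoly_of_mulVec {M : Matrix (Fin d) (Fin d) ℂ} {z : ℂ} {v : Fin d → ℂ}
    (hv : v ≠ 0) (h : M.mulVec v = z • v) : M.charpoly.IsRoot z := by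
  rw [Polynomial.IsRoot.def, Matrix.eval_charpoly, ← Matrix.exists_mulVec_eq_zero_iff]
  refine ⟨v, hv, ?_⟩
  rw [Matrix.sub_mulVec, h, Matrix.scalar_apply, ← Matrix.smul_one_eq_diagonal,
    Matrix.smul_mulVec, Matrix.one_mulVec, sub_self]

/-- The sum of the squares of the entries. -/
def frobSq (A : Matrix (Fin 2) (Fin 2) ℝ) : ℝ := ∑ i, ∑ j, A i j ^ 2

/-- One column of A has squared norm at least half of the sum, which gives v among the standard
basis vectors. Since det A = 1, the inverse has the same entries up to sign and position, and w is
the longer column of A⁻¹, so that A w is a basis vector. -/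
theorem exists_expanded_and_contracted (A : Matrix.SpecialLinearGroup (Fin 2) ℝ) :
    ∃ v w : Fin 2 → ℝ, v ≠ 0 ∧ w ≠ 0 ∧
      (frobSq A.1 / 2) ^ 2 * (∑ i, v i ^ 2) * (∑ i, A.1.mulVec w i ^ 2) ≤
        (∑ i, A.1.mulVec v i ^ 2) * (∑ i, w i ^ 2) := by
  have hdet : A.1 0 0 * A.1 1 1 - A.1 0 1 * A.1 1 0 = 1 := by
    rw [← Matrix.det_fin_two]; exact A.2
  simp only [frobSq, Fin.sum_univ_two]
  set a := A.1 0 0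
  set b := A.1 0 1
  set c := A.1 1 0
  set e := A.1 1 1
  have hF : 0 ≤ a ^ 2 + b ^ 2 + (c ^ 2 + e ^ 2) := by positivity
  obtain ⟨v, hv0, hv1, hv⟩ : ∃ v : Fin 2 → ℝ, v ≠ 0 ∧ v 0 ^ 2 + v 1 ^ 2 = 1 ∧
      (a ^ 2 + b ^ 2 + (c ^ 2 + e ^ 2)) / 2 ≤
        (A.1.mulVec v 0) ^ 2 + (A.1.mulVec v 1) ^ 2 := by
    rcases le_total (a ^ 2 + c ^ 2) (b ^ 2 + e ^ 2) with h | h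
    · refine ⟨![0, 1], fun h => by simpa using congrFun h 1, by simp, ?_⟩
      simp only [Matrix.mulVec, dotProduct, Fin.sum_univ_two, Matrix.cons_val_zero,
        Matrix.cons_val_one, mul_zero, mul_one, zero_add]
      linarith
    · refine ⟨![1, 0], fun h => by simpa using congrFun h 0, by simp, ?_⟩
      simp only [Matrix.mulVec, dotProduct, Fin.sum_univ_two, Matrix.cons_val_zero,
        Matrix.cons_val_one, mul_zero, mul_one, add_zero]
      linarith
  obtain ⟨w, hw0, hw1, hw⟩ : ∃ w : Fin 2 → ℝ, w ≠ 0 ∧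
      (A.1.mulVec w 0) ^ 2 + (A.1.mulVec w 1) ^ 2 = 1 ∧
      (a ^ 2 + b ^ 2 + (c ^ 2 + e ^ 2)) / 2 ≤ w 0 ^ 2 + w 1 ^ 2 := by
    rcases le_total (e ^ 2 + c ^ 2) (b ^ 2 + a ^ 2) with h | h
    · have e1 : A.1.mulVec ![-b, a] 0 = 0 := by
        simp only [Matrix.mulVec, dotProduct, Fin.sum_univ_two, Matrix.cons_val_zero,
          Matrix.cons_val_one]
        ring
      have e2 : A.1.mulVec ![-b, a] 1 = 1 := by
        simp only [Matrix.mulVec, dotProduct, Fin.sum_univ_two, Matrix.cons_val_zero,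
          Matrix.cons_val_one]
        linarith
      refine ⟨![-b, a], fun h => ?_, by rw [e1, e2]; norm_num, ?_⟩
      · rw [h] at e2; simp at e2
      · simp only [Matrix.cons_val_zero, Matrix.cons_val_one]; nlinarith
    · have e1 : A.1.mulVec ![e, -c] 0 = 1 := by
        simp only [Matrix.mulVec, dotProduct, Fin.sum_univ_two, Matrix.cons_val_zero,
          Matrix.cons_val_one]
        linarith
      have e2 : A.1.mulVec ![e, -c] 1 = 0 := by
        simp only [Matrix.mulVec, dotProduct, Fin.sum_univ_two, Matrix.cons_val_zero,
          Matrix.cons_val_one]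
        ring
      refine ⟨![e, -c], fun h => ?_, by rw [e1, e2]; norm_num, ?_⟩
      · rw [h] at e1; simp at e1
      · simp only [Matrix.cons_val_zero, Matrix.cons_val_one]; nlinarith
  refine ⟨v, w, hv0, hw0, ?_⟩
  rw [hv1, hw1, mul_one, mul_one, sq]
  exact mul_le_mul hv hw (by positivity) (by positivity)

/-- A lower bound of the ratio of the extreme singular values, in coordinates. -/
theorem le_sigma_ratio_of_sum_sq (hd : 0 < d) (A : Matrix.SpecialLinearGroup (Fin d) ℝ)
    (v w : Fin d → ℝ) {c : ℝ} (hc : 0 ≤ c) (hv : v ≠ 0) (hw : w ≠ 0)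
    (h : c ^ 2 * (∑ i, v i ^ 2) * (∑ i, A.1.mulVec w i ^ 2) ≤
      (∑ i, A.1.mulVec v i ^ 2) * (∑ i, w i ^ 2)) :
    c ≤ sigma 1 A / sigma d A := by
  have hn : ∀ x : Fin d → ℝ, ‖WithLp.toLp 2 x‖ ^ 2 = ∑ i, x i ^ 2 := fun x => by
    simp [EuclideanSpace.norm_sq_eq]
  have hm : ∀ x : Fin d → ℝ, ‖Matrix.toEuclideanLin A.1 (WithLp.toLp 2 x)‖ ^ 2 =
      ∑ i, A.1.mulVec x i ^ 2 := fun x => by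
    rw [Matrix.toLpLin_toLp, ← hn]
    rfl
  refine le_sigma_ratio hd A (WithLp.toLp 2 v) (WithLp.toLp 2 w) hc (by simpa using hw) ?_
    (by simpa using hv)
  refine le_of_sq_le_sq ?_ (by positivity)
  rw [mul_pow, mul_pow, mul_pow, hm, hm, hn, hn]
  exact h

/-- An element of `SL(2, ℝ)` with `|tr| = ν + ν⁻¹` has eigenvalues `± ν`, `± ν⁻¹`. -/
theorem exists_eigenvectors_of_abs_trace {ν : ℝ} (hν : 0 < ν)
    (A : Matrix.SpecialLinearGroup (Fin 2) ℝ) (h : |A.1.trace| = ν + ν⁻¹) :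
    ∃ s : ℝ, |s| = 1 ∧ (∃ v : Fin 2 → ℝ, v ≠ 0 ∧ A.1.mulVec v = (s * ν) • v) ∧
      ∃ w : Fin 2 → ℝ, w ≠ 0 ∧ A.1.mulVec w = (s * ν⁻¹) • w := by
  have hdet : A.1 0 0 * A.1 1 1 - A.1 0 1 * A.1 1 0 = 1 := by
    rw [← Matrix.det_fin_two]; exact A.2
  have key : ∀ z : ℝ, z ^ 2 - A.1.trace * z + 1 = 0 →
      ∃ v : Fin 2 → ℝ, v ≠ 0 ∧ A.1.mulVec v = z • v := by
    intro z hz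
    have h0 : (A.1 - z • (1 : Matrix (Fin 2) (Fin 2) ℝ)).det = 0 := by
      rw [Matrix.det_fin_two]
      simp only [Matrix.sub_apply, Matrix.smul_apply, Matrix.one_apply_eq, ne_eq, zero_ne_one,
        not_false_eq_true, Matrix.one_apply_ne, one_ne_zero, smul_eq_mul]
      rw [Matrix.trace_fin_two] at hz
      linarith
    obtain ⟨v, hv, h1⟩ := Matrix.exists_mulVec_eq_zero_iff.2 h0
    refine ⟨v, hv, ?_⟩
    rwa [Matrix.sub_mulVec, Matrix.smul_mulVec, Matrix.one_mulVec, sub_eq_zero] at h1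
  have hν' : ν * ν⁻¹ = 1 := mul_inv_cancel₀ hν.ne'
  rcases abs_eq_abs.1 (h.trans (abs_of_pos (by positivity : 0 < ν + ν⁻¹)).symm) with h | h
  · exact ⟨1, by simp, key _ (by rw [h]; linear_combination -hν'),
      key _ (by rw [h]; linear_combination -hν')⟩
  · exact ⟨-1, by simp, key _ (by rw [h]; linear_combination -hν'),
      key _ (by rw [h]; linear_combination -hν')⟩

end Eigenvalues

/-! ### The direct sum and tensor product representations. -/

section Constructions

variable {Γ : Type*} [Group Γ] {d : ℕ}

/-- A homomorphism to matrices of determinant one. -/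
def toSL (f : Γ →* Matrix (Fin d) (Fin d) ℝ) (h : ∀ γ, (f γ).det = 1) :
    Γ →* Matrix.SpecialLinearGroup (Fin d) ℝ where
  toFun γ := ⟨f γ, h γ⟩
  map_one' := Subtype.ext f.map_one
  map_mul' a b := Subtype.ext (f.map_mul a b)

/-- The real `2 × 2` matrix of the multiplication by a complex number. -/
def mulMatrix (z : ℂ) : Matrix (Fin 2) (Fin 2) ℝ := !![z.re, -z.im; z.im, z.re]

/-- The direct sum of `|χ|⁻¹ A` and `χ`. -/
noncomputable def directSumRep (A : Γ →* Matrix.SpecialLinearGroup (Fin 2) ℝ) (χ : Γ →* ℂˣ) :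
    Γ →* Matrix.SpecialLinearGroup (Fin 4) ℝ :=
  toSL
    { toFun := fun γ => Matrix.reindex (finSumFinEquiv (m := 2) (n := 2))
        (finSumFinEquiv (m := 2) (n := 2))
        (Matrix.fromBlocks (‖(χ γ : ℂ)‖⁻¹ • (A γ).1) 0 0 (mulMatrix (χ γ)))
      map_one' := by
        have : mulMatrix 1 = 1 := by
          ext i j; fin_cases i <;> fin_cases j <;> simp [mulMatrix]
        simp [this, Matrix.fromBlocks_one]
      map_mul' := fun a b => by
        have : ∀ z w : ℂ, mulMatrix (z * w) = mulMatrix z * mulMatrix w := by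
          intro z w
          ext i j
          fin_cases i <;> fin_cases j <;> simp [mulMatrix, Matrix.mul_apply, Fin.sum_univ_two] <;>
            ring
        simp only [map_mul, Units.val_mul, norm_mul, Matrix.SpecialLinearGroup.coe_mul, this,
          Matrix.reindex_apply, mul_inv]
        rw [Matrix.submatrix_mul_equiv, Matrix.fromBlocks_multiply]
        simp [smul_smul, mul_comm] }
    (fun γ => by
      have h0 : ‖(χ γ : ℂ)‖ ≠ 0 := by simp
      have h1 : (mulMatrix (χ γ)).det = ‖(χ γ : ℂ)‖ ^ 2 := by
        rw [mulMatrix, Matrix.det_fin_two_of, Complex.sq_norm, Complex.normSq_apply]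
        ring
      simp only [MonoidHom.coe_mk, OneHom.coe_mk, Matrix.det_reindex_self,
        Matrix.det_fromBlocks_zero₂₁, Matrix.det_smul, h1, (A γ).2, Fintype.card_fin]
      field_simp)

/-- The tensor product of representations to `SL(2, ℝ)` and `SL(3, ℝ)`. -/
noncomputable def tensorRep (A : Γ →* Matrix.SpecialLinearGroup (Fin 2) ℝ)
    (B : Γ →* Matrix.SpecialLinearGroup (Fin 3) ℝ) :
    Γ →* Matrix.SpecialLinearGroup (Fin 6) ℝ :=
  toSL
    { toFun := fun γ => Matrix.reindex (finProdFinEquiv (m := 2) (n := 3))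
        (finProdFinEquiv (m := 2) (n := 3)) (Matrix.kroneckerMap (· * ·) (A γ).1 (B γ).1)
      map_one' := by
        simp only [map_one, Matrix.SpecialLinearGroup.coe_one, Matrix.reindex_apply]
        rw [Matrix.one_kronecker_one, Matrix.submatrix_one_equiv]
      map_mul' := fun a b => by
        simp only [map_mul, Matrix.SpecialLinearGroup.coe_mul, Matrix.reindex_apply]
        rw [Matrix.mul_kronecker_mul, Matrix.submatrix_mul_equiv] }
    (fun γ => by
      simp only [MonoidHom.coe_mk, OneHom.coe_mk, Matrix.det_reindex_self, Matrix.det_kronecker,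
        (A γ).2, (B γ).2, one_pow, mul_one])

theorem reindex_mulVec {R m n : Type*} [CommSemiring R] [Fintype m] [Fintype n] (e : m ≃ n)
    (M : Matrix m m R) (v : m → R) :
    (Matrix.reindex e e M).mulVec (v ∘ e.symm) = M.mulVec v ∘ e.symm := by
  rw [Matrix.reindex_apply, Matrix.submatrix_mulVec_equiv]
  simp [Function.comp_assoc]

theorem kronecker_mulVec_mul {R m n : Type*} [CommSemiring R] [Fintype m] [Fintype n]
    (M : Matrix m m R) (N : Matrix n n R) (v : m → R) (u : n → R) :
    (Matrix.kroneckerMap (· * ·) M N).mulVec (fun p => v p.1 * u p.2) =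
      fun p => M.mulVec v p.1 * N.mulVec u p.2 := by
  funext p
  simp only [Matrix.mulVec, dotProduct, Matrix.kroneckerMap_apply,
    Fintype.sum_prod_type, Finset.sum_mul_sum]
  exact Finset.sum_congr rfl fun i _ => Finset.sum_congr rfl fun j _ => by ring

variable (A : Γ →* Matrix.SpecialLinearGroup (Fin 2) ℝ)

/-- The test vectors lie in the first summand, where the scalar |χ|⁻¹ cancels from the ratio. -/
theorem half_frobSq_le_directSumRep (χ : Γ →* ℂˣ) (γ : Γ) :
    frobSq (A γ).1 / 2 ≤ sigma 1 (directSumRep A χ γ) / sigma 4 (directSumRep A χ γ) := by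
  obtain ⟨v, w, hv, hw, h⟩ := exists_expanded_and_contracted (A γ)
  set t := ‖(χ γ : ℂ)‖⁻¹
  set e := finSumFinEquiv (m := 2) (n := 2)
  have hM : ∀ x : Fin 2 → ℝ, (directSumRep A χ γ).1.mulVec (Sum.elim x 0 ∘ e.symm) =
      Sum.elim (t • (A γ).1.mulVec x) 0 ∘ e.symm := fun x => by
    refine (reindex_mulVec e _ _).trans ?_
    rw [Matrix.fromBlocks_mulVec]
    simp [Matrix.smul_mulVec, t]
  have hs : ∀ x : Fin 2 → ℝ, ∑ i, (Sum.elim x (0 : Fin 2 → ℝ) ∘ e.symm) i ^ 2 = ∑ i, x i ^ 2 := by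
    intro x
    refine (e.symm.sum_comp fun i => Sum.elim x (0 : Fin 2 → ℝ) i ^ 2).trans ?_
    simp
  have hne : ∀ x : Fin 2 → ℝ, x ≠ 0 → Sum.elim x (0 : Fin 2 → ℝ) ∘ e.symm ≠ 0 := by
    intro x hx h0
    exact hx (funext fun i => by simpa using congrFun h0 (e (Sum.inl i)))
  refine le_sigma_ratio_of_sum_sq (by norm_num) _ _ _ ?_ (hne v hv) (hne w hw) ?_
  · rw [frobSq]; positivity
  · simp only [hM, hs, Pi.smul_apply, smul_eq_mul, mul_pow, ← Finset.mul_sum]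
    nlinarith [mul_le_mul_of_nonneg_left h (sq_nonneg t)]

/-- The test vectors are v ⊗ u and w ⊗ u with the same u, so that the norms of u and B u cancel
whatever B is. -/
theorem half_frobSq_le_tensorRep (B : Γ →* Matrix.SpecialLinearGroup (Fin 3) ℝ) (γ : Γ) :
    frobSq (A γ).1 / 2 ≤ sigma 1 (tensorRep A B γ) / sigma 6 (tensorRep A B γ) := by
  obtain ⟨v, w, hv, hw, h⟩ := exists_expanded_and_contracted (A γ)
  set e := finProdFinEquiv (m := 2) (n := 3)
  let u : Fin 3 → ℝ := Pi.single 0 1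
  have hM : ∀ x : Fin 2 → ℝ, (tensorRep A B γ).1.mulVec ((fun p => x p.1 * u p.2) ∘ e.symm) =
      (fun p => (A γ).1.mulVec x p.1 * (B γ).1.mulVec u p.2) ∘ e.symm := fun x => by
    refine (reindex_mulVec e _ _).trans ?_
    rw [kronecker_mulVec_mul]
  have hs : ∀ (x : Fin 2 → ℝ) (y : Fin 3 → ℝ),
      ∑ i, ((fun p : Fin 2 × Fin 3 => x p.1 * y p.2) ∘ e.symm) i ^ 2 =
        (∑ i, x i ^ 2) * ∑ i, y i ^ 2 := by
    intro x y
    refine (e.symm.sum_comp fun p : Fin 2 × Fin 3 => (x p.1 * y p.2) ^ 2).trans ?_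
    rw [Fintype.sum_prod_type, Finset.sum_mul_sum]
    exact Finset.sum_congr rfl fun i _ => Finset.sum_congr rfl fun j _ => by ring
  have hne : ∀ x : Fin 2 → ℝ, x ≠ 0 →
      (fun p : Fin 2 × Fin 3 => x p.1 * u p.2) ∘ e.symm ≠ 0 := by
    intro x hx h0
    exact hx (funext fun i => by simpa [u] using congrFun h0 (e (i, 0)))
  refine le_sigma_ratio_of_sum_sq (by norm_num) _ _ _ ?_ (hne v hv) (hne w hw) ?_
  · rw [frobSq]; positivity
  · simp only [hM, hs]
    have h1 : 0 ≤ ∑ i, u i ^ 2 := by positivity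
    have h2 : 0 ≤ ∑ i, (B γ).1.mulVec u i ^ 2 := by positivity
    nlinarith [mul_le_mul_of_nonneg_left h (mul_nonneg h1 h2)]

end Constructions

/-! ### Eigenvalues of direct sums and tensor products -/

section EigenvaluesOfReps

variable {Γ : Type*} [Group Γ] {d : ℕ}

theorem complexify_mulVec_ofReal {m : ℕ} (M : Matrix (Fin m) (Fin m) ℝ) (v : Fin m → ℝ) :
    (complexify M).mulVec (fun i => (v i : ℂ)) = fun i => ((M.mulVec v i : ℝ) : ℂ) := by
  funext i
  simp [complexify, Matrix.mulVec, dotProduct]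

theorem isRoot_charpoly_of_real {M : Matrix (Fin d) (Fin d) ℝ} {c : ℝ} {v : Fin d → ℝ}
    (hv : v ≠ 0) (h : M.mulVec v = c • v) : (complexify M).charpoly.IsRoot (c : ℂ) := by
  refine isRoot_charpoly_of_mulVec (v := fun i => (v i : ℂ)) (fun h0 => hv ?_) ?_
  · funext i
    simpa using congrFun h0 i
  · rw [complexify_mulVec_ofReal, h]
    funext i
    simp

variable (A : Γ →* Matrix.SpecialLinearGroup (Fin 2) ℝ)

theorem isRoot_directSumRep_left (χ : Γ →* ℂˣ) (γ : Γ) {c : ℝ} {v : Fin 2 → ℝ} (hv : v ≠ 0)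
    (h : (A γ).1.mulVec v = c • v) :
    (complexify (directSumRep A χ γ).1).charpoly.IsRoot ((‖(χ γ : ℂ)‖⁻¹ * c : ℝ) : ℂ) := by
  set e := finSumFinEquiv (m := 2) (n := 2)
  refine isRoot_charpoly_of_real (v := Sum.elim v 0 ∘ e.symm) (fun h0 => hv ?_) ?_
  · exact funext fun i => by simpa using congrFun h0 (e (Sum.inl i))
  · refine (reindex_mulVec e _ _).trans ?_
    rw [Matrix.fromBlocks_mulVec]
    funext i
    obtain ⟨j, rfl⟩ := e.surjective i
    rcases j with j | j <;> simp [Matrix.smul_mulVec, h, mul_assoc]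

/-- The vector (1, -i) is an eigenvector, with eigenvalue z, of the real matrix of multiplication by
z. -/
theorem isRoot_directSumRep_right (χ : Γ →* ℂˣ) (γ : Γ) :
    (complexify (directSumRep A χ γ).1).charpoly.IsRoot (χ γ : ℂ) := by
  set e := finSumFinEquiv (m := 2) (n := 2)
  refine isRoot_charpoly_of_mulVec (v := Sum.elim 0 ![1, -Complex.I] ∘ e.symm) (fun h0 => ?_) ?_
  · simpa using congrFun h0 (e (Sum.inr 0))
  · refine (reindex_mulVec e (((Matrix.fromBlocks (‖(χ γ : ℂ)‖⁻¹ • (A γ).1) 0 0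
      (mulMatrix (χ γ)))).map Complex.ofRealHom) _).trans ?_
    rw [Matrix.fromBlocks_map, Matrix.fromBlocks_mulVec]
    funext i
    obtain ⟨j, rfl⟩ := e.surjective i
    rcases j with j | j
    · simp
    · fin_cases j <;>
      · apply Complex.ext <;> simp [mulMatrix]

theorem isRoot_tensorRep (B : Γ →* Matrix.SpecialLinearGroup (Fin 3) ℝ) (γ : Γ) {c : ℝ}
    {v : Fin 2 → ℝ} (hv : v ≠ 0) (h : (A γ).1.mulVec v = c • v) {z : ℂ} {u : Fin 3 → ℂ}
    (hu : u ≠ 0) (hz : (complexify (B γ).1).mulVec u = z • u) :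
    (complexify (tensorRep A B γ).1).charpoly.IsRoot (c * z) := by
  set e := finProdFinEquiv (m := 2) (n := 3)
  refine isRoot_charpoly_of_mulVec (v := (fun p => (v p.1 : ℂ) * u p.2) ∘ e.symm)
    (fun h0 => ?_) ?_
  · obtain ⟨i, hi⟩ := Function.ne_iff.1 hv
    obtain ⟨j, hj⟩ := Function.ne_iff.1 hu
    have := congrFun h0 (e (i, j))
    simp only [Function.comp_apply, Equiv.symm_apply_apply, Pi.zero_apply, mul_eq_zero,
      Complex.ofReal_eq_zero] at this
    exact this.elim hi hj
  · have hk : complexify (tensorRep A B γ).1 = Matrix.reindex e e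
        (Matrix.kroneckerMap (· * ·) (complexify (A γ).1) (complexify (B γ).1)) := by
      ext i j
      change ((_ * _ : ℝ) : ℂ) = _
      push_cast
      rfl
    rw [hk]
    refine (reindex_mulVec e _ _).trans ?_
    rw [kronecker_mulVec_mul _ _ (fun i => (v i : ℂ)) u, complexify_mulVec_ofReal, h, hz]
    funext i
    simp
    ring

end EigenvaluesOfReps

/-! ### Conjugate pairs of eigenvalues in prescribed positions. -/

section ConjPairs

theorem conj_ne_self_of_im {z : ℂ} (hz : z.im ≠ 0) : (starRingEnd ℂ) z ≠ z := fun h => by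
  rw [Complex.conj_eq_iff_im] at h
  exact hz h

theorem ofReal_ne_of_im {z : ℂ} (hz : z.im ≠ 0) (c : ℝ) : (c : ℂ) ≠ z := fun h => by
  rw [← h] at hz
  simp at hz

theorem ofReal_ne_conj_of_im {z : ℂ} (hz : z.im ≠ 0) (c : ℝ) : (c : ℂ) ≠ (starRingEnd ℂ) z :=
  ofReal_ne_of_im (by simpa using hz) c

theorem ne_of_norm_lt {z w : ℂ} (h : ‖w‖ < ‖z‖) : z ≠ w := fun h' => by
  rw [h'] at h
  exact lt_irrefl _ h

theorem injective_of_lt {n : ℕ} {μ : Fin n → ℂ} (h : ∀ j k, j < k → μ j ≠ μ k) :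
    Function.Injective μ := by
  intro j k hjk
  by_contra hne
  rcases lt_or_gt_of_ne hne with h' | h'
  · exact h _ _ h' hjk
  · exact h _ _ h' hjk.symm

theorem hasConjPairAt_zero_of_roots {M : Matrix (Fin 4) (Fin 4) ℝ} {z : ℂ} {c₁ c₂ : ℝ}
    (hz : z.im ≠ 0) (h : (complexify M).charpoly.IsRoot z)
    (h₁ : (complexify M).charpoly.IsRoot (c₁ : ℂ)) (h₂ : (complexify M).charpoly.IsRoot (c₂ : ℂ))
    (h01 : |c₁| < ‖z‖) (h12 : |c₂| < |c₁|) : HasConjPairAt M 0 := by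
  have hc : (c₁ : ℂ) ≠ c₂ := fun h => by
    rw [Complex.ofReal_inj] at h
    rw [h] at h12
    exact lt_irrefl _ h12
  refine ⟨by norm_num, ![z, (starRingEnd ℂ) z, c₁, c₂], injective_of_lt ?_, ?_, ?_, ?_, ?_⟩
  · intro j k hjk
    fin_cases j <;> fin_cases k <;> first
      | exact absurd hjk (by decide)
      | exact (conj_ne_self_of_im hz).symm
      | exact (ofReal_ne_of_im hz _).symm
      | exact (ofReal_ne_conj_of_im hz _).symm
      | exact hc
  · intro j
    fin_cases j
    exacts [h, isRoot_conj M h, h₁, h₂]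
  · rfl
  · intro j hj
    exact absurd hj (by omega)
  · intro j hj
    fin_cases j
    · exact absurd hj (by decide)
    · exact absurd hj (by decide)
    · simpa using h01
    · simpa using h12.trans h01

theorem hasConjPairAt_one_of_roots {M : Matrix (Fin 4) (Fin 4) ℝ} {z : ℂ} {c₁ c₂ : ℝ}
    (hz : z.im ≠ 0) (h : (complexify M).charpoly.IsRoot z)
    (h₁ : (complexify M).charpoly.IsRoot (c₁ : ℂ)) (h₂ : (complexify M).charpoly.IsRoot (c₂ : ℂ))
    (h01 : ‖z‖ < |c₁|) (h12 : |c₂| < ‖z‖) : HasConjPairAt M 1 := by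
  have hc : (c₁ : ℂ) ≠ c₂ := fun h => by
    rw [Complex.ofReal_inj] at h
    rw [h] at h01
    exact lt_irrefl _ (h12.trans h01)
  refine ⟨by norm_num, ![c₁, z, (starRingEnd ℂ) z, c₂], injective_of_lt ?_, ?_, ?_, ?_, ?_⟩
  · intro j k hjk
    fin_cases j <;> fin_cases k <;> first
      | exact absurd hjk (by decide)
      | exact (conj_ne_self_of_im hz).symm
      | exact (ofReal_ne_of_im hz _).symm
      | exact (ofReal_ne_conj_of_im hz _).symm
      | exact ofReal_ne_of_im hz _
      | exact ofReal_ne_conj_of_im hz _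
      | exact hc
  · intro j
    fin_cases j
    exacts [h₁, h, isRoot_conj M h, h₂]
  · rfl
  · intro j hj
    fin_cases j
    · simpa using h01
    all_goals exact absurd hj (by decide)
  · intro j hj
    fin_cases j
    iterate 3 exact absurd hj (by decide)
    simpa using h12

/-- Six eigenvalues, four of them in two conjugate pairs. -/
theorem injective_two_conj_pairs {z w : ℂ} {c₁ c₂ : ℝ} (hz : z.im ≠ 0) (hw : w.im ≠ 0)
    (hzw : ‖w‖ < ‖z‖) (hc : (c₁ : ℂ) ≠ c₂) :
    Function.Injective ![(c₁ : ℂ), c₂, z, (starRingEnd ℂ) z, w, (starRingEnd ℂ) w] := by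
  refine injective_of_lt fun j k hjk => ?_
  fin_cases j <;> fin_cases k <;> first
    | exact absurd hjk (by decide)
    | exact hc
    | exact (conj_ne_self_of_im hz).symm
    | exact (conj_ne_self_of_im hw).symm
    | exact ofReal_ne_of_im hz _
    | exact ofReal_ne_conj_of_im hz _
    | exact ofReal_ne_of_im hw _
    | exact ofReal_ne_conj_of_im hw _
    | exact ne_of_norm_lt (by simpa using hzw)

variable {M : Matrix (Fin 6) (Fin 6) ℝ} {z w : ℂ} {c₁ c₂ : ℝ}

/-- The six eigenvalues are listed in a fixed order, for which distinctness is checked once; σ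
rearranges them so that z and its conjugate occupy positions i and i + 1. The other eigenvalues need
only be on the correct side of |z|, in any order. -/
theorem hasConjPairAt_of_perm (hz : z.im ≠ 0) (hw : w.im ≠ 0) (hzw : ‖w‖ < ‖z‖)
    (hc : |c₂| < |c₁|) (h : (complexify M).charpoly.IsRoot z)
    (h' : (complexify M).charpoly.IsRoot w)
    (h₁ : (complexify M).charpoly.IsRoot (c₁ : ℂ)) (h₂ : (complexify M).charpoly.IsRoot (c₂ : ℂ))
    (σ : Equiv.Perm (Fin 6)) (i : ℕ) (hi : i + 1 < 6) (hσ : σ ⟨i, by omega⟩ = 2)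
    (hσ' : σ ⟨i + 1, hi⟩ = 3)
    (hlt : ∀ j : Fin 6, (j : ℕ) < i → ‖z‖ <
      ‖![(c₁ : ℂ), c₂, z, (starRingEnd ℂ) z, w, (starRingEnd ℂ) w] (σ j)‖)
    (hgt : ∀ j : Fin 6, i + 1 < (j : ℕ) →
      ‖![(c₁ : ℂ), c₂, z, (starRingEnd ℂ) z, w, (starRingEnd ℂ) w] (σ j)‖ < ‖z‖) :
    HasConjPairAt M i := by
  have hne : (c₁ : ℂ) ≠ c₂ := fun h => by
    rw [Complex.ofReal_inj] at h
    rw [h] at hc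
    exact lt_irrefl _ hc
  have e1 : ![(c₁ : ℂ), c₂, z, (starRingEnd ℂ) z, w, (starRingEnd ℂ) w] (σ ⟨i, by omega⟩) = z := by
    rw [hσ]; rfl
  have e2 : ![(c₁ : ℂ), c₂, z, (starRingEnd ℂ) z, w, (starRingEnd ℂ) w] (σ ⟨i + 1, hi⟩) =
      (starRingEnd ℂ) z := by
    rw [hσ']; rfl
  refine ⟨hi, fun j => ![(c₁ : ℂ), c₂, z, (starRingEnd ℂ) z, w, (starRingEnd ℂ) w] (σ j),
    (injective_two_conj_pairs hz hw hzw hne).comp σ.injective, ?_, ?_, ?_, ?_⟩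
  · intro j
    change (complexify M).charpoly.IsRoot
      (![(c₁ : ℂ), c₂, z, (starRingEnd ℂ) z, w, (starRingEnd ℂ) w] (σ j))
    generalize σ j = k
    fin_cases k
    exacts [h₁, h₂, h, isRoot_conj M h, h', isRoot_conj M h']
  · simp only [e1, e2]
  · simpa only [e1] using hlt
  · simpa only [e1] using hgt

theorem hasConjPairAt_six_zero (hz : z.im ≠ 0) (hw : w.im ≠ 0) (hzw : ‖w‖ < ‖z‖)
    (hc : |c₂| < |c₁|) (h : (complexify M).charpoly.IsRoot z)
    (h' : (complexify M).charpoly.IsRoot w)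
    (h₁ : (complexify M).charpoly.IsRoot (c₁ : ℂ)) (h₂ : (complexify M).charpoly.IsRoot (c₂ : ℂ))
    (hcz : |c₁| < ‖z‖) : HasConjPairAt M 0 := by
  -- Arrangement: z, z̄, c₁, c₂, w, w̄.
  refine hasConjPairAt_of_perm hz hw hzw hc h h' h₁ h₂
    (Equiv.swap 0 2 * Equiv.swap 1 3) 0 (by norm_num) (by decide) (by decide) ?_ ?_
  · intro j hj
    exact absurd hj (by omega)
  · intro j hj
    fin_cases j
    · exact absurd hj (by decide)
    · exact absurd hj (by decide)
    · change ‖(c₁ : ℂ)‖ < _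
      simpa using hcz
    · change ‖(c₂ : ℂ)‖ < _
      simpa using hc.trans hcz
    · exact hzw
    · change ‖(starRingEnd ℂ) w‖ < _
      simpa using hzw

theorem hasConjPairAt_six_one (hz : z.im ≠ 0) (hw : w.im ≠ 0) (hzw : ‖w‖ < ‖z‖)
    (hc : |c₂| < |c₁|) (h : (complexify M).charpoly.IsRoot z)
    (h' : (complexify M).charpoly.IsRoot w)
    (h₁ : (complexify M).charpoly.IsRoot (c₁ : ℂ)) (h₂ : (complexify M).charpoly.IsRoot (c₂ : ℂ))
    (hz1 : ‖z‖ < |c₁|) (hz2 : |c₂| < ‖z‖) : HasConjPairAt M 1 := by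
  -- Arrangement: c₁, z, z̄, c₂, w, w̄.
  refine hasConjPairAt_of_perm hz hw hzw hc h h' h₁ h₂
    (Equiv.swap 1 3 * Equiv.swap 1 2) 1 (by norm_num) (by decide) (by decide) ?_ ?_
  · intro j hj
    fin_cases j
    · change _ < ‖(c₁ : ℂ)‖
      simpa using hz1
    all_goals exact absurd hj (by decide)
  · intro j hj
    fin_cases j
    iterate 3 exact absurd hj (by decide)
    · change ‖(c₂ : ℂ)‖ < _
      simpa using hz2
    · exact hzw
    · change ‖(starRingEnd ℂ) w‖ < _
      simpa using hzw

theorem hasConjPairAt_six_two (hz : z.im ≠ 0) (hw : w.im ≠ 0) (hzw : ‖w‖ < ‖z‖)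
    (hc : |c₂| < |c₁|) (h : (complexify M).charpoly.IsRoot z)
    (h' : (complexify M).charpoly.IsRoot w)
    (h₁ : (complexify M).charpoly.IsRoot (c₁ : ℂ)) (h₂ : (complexify M).charpoly.IsRoot (c₂ : ℂ))
    (hz2 : ‖z‖ < |c₂|) : HasConjPairAt M 2 := by
  refine hasConjPairAt_of_perm hz hw hzw hc h h' h₁ h₂ 1 2 (by norm_num) (by decide) (by decide)
    ?_ ?_
  · intro j hj
    fin_cases j
    · change _ < ‖(c₁ : ℂ)‖
      simpa using hz2.trans hc
    · change _ < ‖(c₂ : ℂ)‖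
      simpa using hz2
    all_goals exact absurd hj (by decide)
  · intro j hj
    fin_cases j
    iterate 4 exact absurd hj (by decide)
    · exact hzw
    · change ‖(starRingEnd ℂ) w‖ < _
      simpa using hzw

end ConjPairs

/-! ### The two representations -/

/-- The properties of a Fuchsian surface group that the construction uses: a quasi-isometric
embedding `A` in `SL(2, ℝ)`, three handles on which `A` is hyperbolic, and homomorphisms to
arbitrary groups with prescribed values on these handles. -/
structure FuchsianSystem (Γ : Type*) [Group Γ] where
  /-- the Fuchsian representation -/
  A : Γ →* Matrix.SpecialLinearGroup (Fin 2) ℝ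
  /-- the first generators of the handles -/
  a : Fin 3 → Γ
  /-- the second generators of the handles -/
  b : Fin 3 → Γ
  /-- the common spectral radius of the generators -/
  ν : ℝ
  one_lt_ν : 1 < ν
  trace_a : ∀ k, |(A (a k)).1.trace| = ν + ν⁻¹
  trace_b : ∀ k, |(A (b k)).1.trace| = ν + ν⁻¹
  -- Three elements and the identity are the least number that can span the four-dimensional space
  -- of matrices, whence three handles.
  span_b : ∀ V : Submodule ℝ (Matrix (Fin 2) (Fin 2) ℝ), 1 ∈ V → (∀ k, (A (b k)).1 ∈ V) → V = ⊤
  -- If the two values on each handle commute, every commutator in the surface relation becomes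
  -- trivial.
  exists_hom : ∀ (H : Type) [Group H] (x y : Fin 3 → H), (∀ k, Commute (x k) (y k)) →
    ∃ θ : Γ →* H, ∀ k, θ (a k) = x k ∧ θ (b k) = y k
  -- In SL(2, ℝ) the sum of the squared entries is σ₁² + σ₁⁻², comparable to σ₁ / σ₂ = σ₁².
  exists_le : ∃ T : Set Γ, T.Finite ∧ Subgroup.closure T = ⊤ ∧ ∃ J K : ℝ, 0 < J ∧ 0 < K ∧
    ∀ γ, 1 / K * Real.exp (1 / J * wordLength T γ) ≤ frobSq (A γ).1

namespace FuchsianSystem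

variable {Γ : Type*} [Group Γ] (D : FuchsianSystem Γ)

theorem ν_pos : 0 < D.ν := zero_lt_one.trans D.one_lt_ν

theorem inv_ν_lt_one : D.ν⁻¹ < 1 := inv_lt_one_of_one_lt₀ D.one_lt_ν

theorem pow_ne_one {γ : Γ} (h : |(D.A γ).1.trace| = D.ν + D.ν⁻¹) (n : ℕ) (hn : n ≠ 0) :
    γ ^ n ≠ 1 := by
  intro h1
  obtain ⟨s, hs, ⟨v, hv, hAv⟩, -⟩ := exists_eigenvectors_of_abs_trace D.ν_pos _ h
  have key : ∀ m : ℕ, ((D.A γ).1 ^ m).mulVec v = (s * D.ν) ^ m • v := by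
    intro m
    induction m with
    | zero => simp
    | succ m ih => rw [pow_succ', ← Matrix.mulVec_mulVec, ih, Matrix.mulVec_smul, hAv, smul_smul,
        pow_succ]
  have h2 : (D.A γ).1 ^ n = 1 := by
    rw [← Matrix.SpecialLinearGroup.coe_pow, ← map_pow, h1, map_one,
      Matrix.SpecialLinearGroup.coe_one]
  have h3 := key n
  rw [h2, Matrix.one_mulVec] at h3
  obtain ⟨i, hi⟩ := Function.ne_iff.1 hv
  have h4 : (s * D.ν) ^ n = 1 := by
    have := congrFun h3 i
    simp only [Pi.smul_apply, smul_eq_mul] at this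
    exact mul_right_cancel₀ hi (by rw [← this, one_mul])
  have h5 := congrArg abs h4
  rw [abs_pow, abs_mul, hs, one_mul, abs_of_pos D.ν_pos, abs_one] at h5
  exact (one_lt_pow₀ D.one_lt_ν hn).ne' h5

theorem isQuasiIsometricEmbedding_of_half_frobSq_le {d : ℕ} (hd : 0 < d)
    (ρ : Γ →* Matrix.SpecialLinearGroup (Fin d) ℝ)
    (h : ∀ γ, frobSq (D.A γ).1 / 2 ≤ sigma 1 (ρ γ) / sigma d (ρ γ)) :
    IsQuasiIsometricEmbedding ρ := by
  obtain ⟨T, hf, hT, J, K, hJ, hK, hle⟩ := D.exists_le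
  refine isQuasiIsometricEmbedding_of_le hd ρ hf hT hJ (K := 2 * K) (by positivity) fun γ => ?_
  refine le_trans ?_ (h γ)
  have := hle γ
  have e : 1 / (2 * K) * Real.exp (1 / J * wordLength T γ) =
      1 / K * Real.exp (1 / J * wordLength T γ) / 2 := by
    field_simp
  rw [e]
  gcongr

/-- With χ(a_k) = ν e^i and χ(b_k) = e^i, the eigenvalues at a₀ have moduli ν, ν, 1, ν⁻², and at b₀
they have moduli ν, 1, 1, ν⁻¹. The repeated modulus is that of the nonreal pair χ, χ̄, so a₀
excludes i = 1 and b₀ excludes i = 2. -/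
theorem exists_rep_four (D : FuchsianSystem Γ) :
    ∃ ψ : Γ →* Matrix.SpecialLinearGroup (Fin 4) ℝ,
      IsQuasiIsometricEmbedding ψ ∧ ¬ IsLimitOfAnosov ψ := by
  have hν := D.ν_pos
  have hν1 := D.one_lt_ν
  have hν2 := D.inv_ν_lt_one
  have hsin : Real.sin 1 ≠ 0 := (Real.sin_pos_of_pos_of_le_one one_pos le_rfl).ne'
  let u : ℂˣ := Units.mk0 (Complex.exp Complex.I) (Complex.exp_ne_zero _)
  let t : ℂˣ := Units.mk0 (D.ν : ℂ) (by exact_mod_cast hν.ne')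
  have hu : ‖(u : ℂ)‖ = 1 := by
    have := Complex.norm_exp_ofReal_mul_I 1
    simpa [u] using this
  have hui : (u : ℂ).im ≠ 0 := by
    simpa [u, Complex.exp_im] using hsin
  obtain ⟨χ, hχ⟩ := D.exists_hom ℂˣ (fun _ => t * u) (fun _ => u) fun k => mul_comm _ _
  refine ⟨directSumRep D.A χ, D.isQuasiIsometricEmbedding_of_half_frobSq_le (by norm_num) _
    (half_frobSq_le_directSumRep D.A χ), not_isLimitOfAnosov _ fun i hi1 hi2 => ?_⟩
  obtain rfl | rfl : i = 1 ∨ i = 2 := by omega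
  · refine ⟨D.a 0, D.pow_ne_one (D.trace_a 0), ?_⟩
    obtain ⟨s, hs, ⟨v, hv, hAv⟩, w, hw, hAw⟩ := exists_eigenvectors_of_abs_trace hν _ (D.trace_a 0)
    have hn : ‖(χ (D.a 0) : ℂ)‖ = D.ν := by
      rw [(hχ 0).1, Units.val_mul, norm_mul, hu, mul_one]
      simp [t, abs_of_pos hν]
    refine hasConjPairAt_zero_of_roots ?_ (isRoot_directSumRep_right D.A χ _)
      (isRoot_directSumRep_left D.A χ _ hv hAv) (isRoot_directSumRep_left D.A χ _ hw hAw) ?_ ?_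
    · rw [(hχ 0).1, Units.val_mul]
      simpa [t] using ⟨hν.ne', hui⟩
    · rw [hn, abs_mul, abs_mul, hs, abs_of_pos hν, abs_of_pos (inv_pos.2 hν), one_mul,
        inv_mul_cancel₀ hν.ne']
      exact hν1
    · rw [hn, abs_mul, abs_mul, abs_mul, abs_mul, hs, abs_of_pos hν, abs_of_pos (inv_pos.2 hν)]
      have : D.ν⁻¹ < D.ν := hν2.trans hν1
      gcongr
  · refine ⟨D.b 0, D.pow_ne_one (D.trace_b 0), ?_⟩
    obtain ⟨s, hs, ⟨v, hv, hAv⟩, w, hw, hAw⟩ := exists_eigenvectors_of_abs_trace hν _ (D.trace_b 0)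
    have hn : ‖(χ (D.b 0) : ℂ)‖ = 1 := by
      rw [(hχ 0).2, hu]
    refine hasConjPairAt_one_of_roots ?_ (isRoot_directSumRep_right D.A χ _)
      (isRoot_directSumRep_left D.A χ _ hv hAv) (isRoot_directSumRep_left D.A χ _ hw hAw) ?_ ?_
    · rw [(hχ 0).2]
      exact hui
    · rw [hn, abs_mul, abs_mul, hs, abs_of_pos hν, inv_one, abs_one, one_mul, one_mul]
      exact hν1
    · rw [hn, abs_mul, abs_mul, hs, abs_of_pos (inv_pos.2 hν), inv_one, abs_one, one_mul, one_mul]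
      exact hν2

end FuchsianSystem

/-! ### Two elements of `SL(3, ℝ)` without common invariant subspaces -/

section Spirals

/-- The matrix acting by `r²` on the first axis, and by the similarity `r⁻¹ e^{it}` on the plane
of the other two axes. -/
noncomputable def spiralMatrix (r t : ℝ) : Matrix (Fin 3) (Fin 3) ℝ :=
  !![r ^ 2, 0, 0; 0, r⁻¹ * Real.cos t, -(r⁻¹ * Real.sin t); 0, r⁻¹ * Real.sin t, r⁻¹ * Real.cos t]

theorem det_spiralMatrix {r : ℝ} (hr : r ≠ 0) (t : ℝ) : (spiralMatrix r t).det = 1 := by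
  rw [spiralMatrix, Matrix.det_fin_three]
  simp
  field_simp
  linarith [Real.sin_sq_add_cos_sq t]

theorem spiralMatrix_mul (r s t u : ℝ) :
    spiralMatrix r t * spiralMatrix s u = spiralMatrix (r * s) (t + u) := by
  ext i j
  fin_cases i <;> fin_cases j <;>
    simp [spiralMatrix, Matrix.mul_apply, Fin.sum_univ_three, Real.sin_add, Real.cos_add] <;>
    ring

theorem spiralMatrix_pow (r t : ℝ) (n : ℕ) :
    spiralMatrix r t ^ n = spiralMatrix (r ^ n) (n * t) := by
  induction n with
  | zero =>
    ext i j
    fin_cases i <;> fin_cases j <;> simp [spiralMatrix]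
  | succ n ih =>
    rw [pow_succ, ih, spiralMatrix_mul, pow_succ]
    congr 1
    push_cast
    ring

theorem spiralMatrix_mulVec (r t : ℝ) (u : Fin 3 → ℝ) : (spiralMatrix r t).mulVec u =
    ![r ^ 2 * u 0, r⁻¹ * (Real.cos t * u 1 - Real.sin t * u 2),
      r⁻¹ * (Real.sin t * u 1 + Real.cos t * u 2)] := by
  funext i
  fin_cases i <;> simp [spiralMatrix, Matrix.mulVec, dotProduct, Fin.sum_univ_three] <;> ring

theorem complexify_spiralMatrix_mulVec_axis (r t : ℝ) :
    (complexify (spiralMatrix r t)).mulVec ![1, 0, 0] = ((r ^ 2 : ℝ) : ℂ) • ![1, 0, 0] := by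
  funext i
  fin_cases i <;>
    simp [spiralMatrix, complexify, Matrix.mulVec, dotProduct, Fin.sum_univ_three]

theorem complexify_spiralMatrix_mulVec_plane (r t : ℝ) :
    (complexify (spiralMatrix r t)).mulVec ![0, 1, -Complex.I] =
      ((r⁻¹ : ℝ) * Complex.exp (t * Complex.I)) • ![0, 1, -Complex.I] := by
  funext i
  fin_cases i
  · simp [spiralMatrix, complexify, Matrix.mulVec, dotProduct, Fin.sum_univ_three]
  · simp [spiralMatrix, complexify, Matrix.mulVec, dotProduct, Fin.sum_univ_three,
      Complex.exp_mul_I]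
    ring
  · simp [spiralMatrix, complexify, Matrix.mulVec, dotProduct, Fin.sum_univ_three,
      Complex.exp_mul_I]
    linear_combination ((r : ℂ)⁻¹ * Complex.sin t) * Complex.I_sq

/-- A subspace that is invariant under a spiral matrix and not contained in its axis contains the
plane of the spiral. -/
theorem mem_of_spiralMatrix_invariant {r t : ℝ} (hr : r ≠ 0) (ht : Real.sin t ≠ 0)
    (U : Submodule ℝ (Fin 3 → ℝ)) (hU : ∀ u ∈ U, (spiralMatrix r t).mulVec u ∈ U)
    {u : Fin 3 → ℝ} (hu : u ∈ U) (h : u 1 ≠ 0 ∨ u 2 ≠ 0) :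
    Pi.single 1 1 ∈ U ∧ Pi.single 2 1 ∈ U := by
  set a := r⁻¹ * (Real.cos t * u 1 - Real.sin t * u 2) - r ^ 2 * u 1 with ha
  set b := r⁻¹ * (Real.sin t * u 1 + Real.cos t * u 2) - r ^ 2 * u 2 with hb
  -- Subtracting r² times the vector removes the component along the axis.
  have h1 : ![0, a, b] ∈ U := by
    have := U.sub_mem (hU u hu) (U.smul_mem (r ^ 2) hu)
    rw [spiralMatrix_mulVec] at this
    convert this using 1
    funext i
    fin_cases i <;> simp [ha, hb]
  have hs : r⁻¹ * Real.sin t ≠ 0 := mul_ne_zero (inv_ne_zero hr) ht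
  -- Subtracting the real part r⁻¹ cos t of the similarity leaves a multiple of the quarter turn of
  -- the plane.
  have h2 : ![0, -b, a] ∈ U := by
    have := U.smul_mem (r⁻¹ * Real.sin t)⁻¹
      (U.sub_mem (hU _ h1) (U.smul_mem (r⁻¹ * Real.cos t) h1))
    rw [spiralMatrix_mulVec] at this
    convert this using 1
    funext i
    fin_cases i
    · simp
    · simp
      field_simp
      ring
    · simp
      field_simp
      ring
  have hpos : 0 < a ^ 2 + b ^ 2 := by
    -- This is |u|² |r⁻¹ e^{it} - r²|² in complex notation, nonzero as the second factor has nonzero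
    -- imaginary part.
    have e : a ^ 2 + b ^ 2 = (u 1 ^ 2 + u 2 ^ 2) *
        ((r⁻¹ * Real.cos t - r ^ 2) ^ 2 + (r⁻¹ * Real.sin t) ^ 2) := by
      rw [ha, hb]
      ring
    rw [e]
    have h3 : 0 < (r⁻¹ * Real.sin t) ^ 2 := by positivity
    have h4 : 0 < u 1 ^ 2 + u 2 ^ 2 := by
      rcases h with h | h <;> positivity
    positivity
  constructor
  · have := U.smul_mem (a ^ 2 + b ^ 2)⁻¹ (U.sub_mem (U.smul_mem a h1) (U.smul_mem b h2))
    convert this using 1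
    funext i
    fin_cases i
    · simp
    · simp
      field_simp
    · simp
      ring_nf
      simp
  · have := U.smul_mem (a ^ 2 + b ^ 2)⁻¹ (U.add_mem (U.smul_mem b h1) (U.smul_mem a h2))
    convert this using 1
    funext i
    fin_cases i
    · simp
    · simp
      right
      ring
    · simp
      field_simp
      ring

/-- The element of `SL(3, ℝ)` given by a spiral matrix. -/
noncomputable def spiral (r : ℝ) (hr : r ≠ 0) : Matrix.SpecialLinearGroup (Fin 3) ℝ :=
  ⟨spiralMatrix r 1, det_spiralMatrix hr 1⟩

/-- The spiral with the first two axes exchanged. -/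
noncomputable def spiral' (r : ℝ) (hr : r ≠ 0) : Matrix.SpecialLinearGroup (Fin 3) ℝ :=
  ⟨Matrix.reindex (Equiv.swap 0 1) (Equiv.swap 0 1) (spiralMatrix r 1), by
    rw [Matrix.det_reindex_self, det_spiralMatrix hr 1]⟩

/-- π is irrational, so a nontrivial power of the rotation by one radian is never ± 1. This lets the
irreducibility argument pass to finite-index subgroups. -/
theorem sin_natCast_ne_zero {n : ℕ} (hn : n ≠ 0) : Real.sin (n * 1) ≠ 0 := by
  rw [mul_one]
  intro h
  obtain ⟨k, hk⟩ := Real.sin_eq_zero_iff.1 h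
  have hk0 : k ≠ 0 := by
    rintro rfl
    simp at hk
    exact hn (by exact_mod_cast hk.symm)
  apply irrational_pi
  refine ⟨(n : ℚ) / k, ?_⟩
  push_cast
  rw [div_eq_iff (by exact_mod_cast hk0), ← hk, mul_comm]

/-- Powers of the two spirals have no common invariant subspaces. -/
theorem eq_bot_or_eq_top_of_spiral_invariant {r s : ℝ} (hr : r ≠ 0) (hs : s ≠ 0) {n m : ℕ}
    (hn : n ≠ 0) (hm : m ≠ 0) (U : Submodule ℝ (Fin 3 → ℝ))
    (h₁ : ∀ u ∈ U, ((spiral r hr).1 ^ n).mulVec u ∈ U)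
    (h₂ : ∀ u ∈ U, ((spiral' s hs).1 ^ m).mulVec u ∈ U) : U = ⊥ ∨ U = ⊤ := by
  rw [or_iff_not_imp_left]
  intro hbot
  have hx : ∀ {u : Fin 3 → ℝ}, u ∈ U → (u 1 ≠ 0 ∨ u 2 ≠ 0) →
      Pi.single 1 1 ∈ U ∧ Pi.single 2 1 ∈ U := by
    intro u hu h
    refine mem_of_spiralMatrix_invariant (r := r ^ n) (t := n * 1) (pow_ne_zero n hr)
      (sin_natCast_ne_zero hn) U (fun u hu => ?_) hu h
    rw [← spiralMatrix_pow]
    exact h₁ u hu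
  have hy : ∀ {u : Fin 3 → ℝ}, u ∈ U → (u 0 ≠ 0 ∨ u 2 ≠ 0) →
      Pi.single 0 1 ∈ U ∧ Pi.single 2 1 ∈ U := by
    intro u hu h
    let e := LinearEquiv.funCongrLeft ℝ ℝ (Equiv.swap (0 : Fin 3) 1)
    have hpow : (spiral' s hs).1 ^ m = Matrix.reindex (Equiv.swap 0 1) (Equiv.swap 0 1)
        (spiralMatrix (s ^ m) (m * 1)) := by
      rw [← spiralMatrix_pow]
      exact (map_pow (Matrix.reindexAlgEquiv ℝ ℝ (Equiv.swap (0 : Fin 3) 1))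
        (spiralMatrix s 1) m).symm
    have key := mem_of_spiralMatrix_invariant (r := s ^ m) (t := m * 1) (pow_ne_zero m hs)
      (sin_natCast_ne_zero hm) (U.comap e.toLinearMap) (fun w hw => ?_)
      (u := u ∘ Equiv.swap 0 1) ?_ ?_
    · obtain ⟨k1, k2⟩ := key
      constructor
      · have : e.toLinearMap (Pi.single 1 1) = Pi.single 0 1 := by
          funext i
          fin_cases i <;> rfl
        rwa [Submodule.mem_comap, this] at k1
      · have : e.toLinearMap (Pi.single 2 1) = Pi.single 2 1 := by
          funext i
          fin_cases i <;> rfl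
        rwa [Submodule.mem_comap, this] at k2
    · have h3 := h₂ _ hw
      rw [hpow] at h3
      have h4 := reindex_mulVec (Equiv.swap (0 : Fin 3) 1) (spiralMatrix (s ^ m) (m * 1)) w
      have h5 : w ∘ (Equiv.swap (0 : Fin 3) 1).symm = e.toLinearMap w := rfl
      rw [h5] at h4
      rw [h4] at h3
      exact h3
    · have : e.toLinearMap (u ∘ Equiv.swap 0 1) = u := by
        funext i
        fin_cases i <;> rfl
      rw [Submodule.mem_comap, this]
      exact hu
    · exact h
  obtain ⟨u, hu, hu0⟩ := Submodule.exists_mem_ne_zero_of_ne_bot hbot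
  -- The third axis lies in the planes of both spirals. Once one plane is contained in U, the other
  -- spiral can be applied to that axis and supplies its own plane.
  have hall : Pi.single 0 1 ∈ U ∧ Pi.single 1 1 ∈ U ∧ Pi.single 2 1 ∈ U := by
    by_cases h : u 1 ≠ 0 ∨ u 2 ≠ 0
    · obtain ⟨k1, k2⟩ := hx hu h
      exact ⟨(hy k2 (by simp)).1, k1, k2⟩
    · push Not at h
      have h0 : u 0 ≠ 0 := fun h0 => hu0 (by
        funext i
        fin_cases i
        exacts [h0, h.1, h.2])
      obtain ⟨k1, k2⟩ := hy hu (Or.inl h0)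
      exact ⟨k1, (hx k2 (by simp)).1, k2⟩
  rw [eq_top_iff]
  intro v _
  have : v = v 0 • Pi.single 0 1 + v 1 • Pi.single 1 1 + v 2 • Pi.single 2 1 := by
    funext i
    fin_cases i <;> simp
  rw [this]
  exact U.add_mem (U.add_mem (U.smul_mem _ hall.1) (U.smul_mem _ hall.2.1)) (U.smul_mem _ hall.2.2)

end Spirals

/-! ### Strong irreducibility and the representation in dimension six. -/

section TensorProduct

/-- By Cayley–Hamilton the coefficients obey (α, β) ↦ (tr A · α + β, -α). As |tr A| > 2, the
condition |β| ≤ |α| persists and |α| does not decrease, so α never vanishes. Thus A can be recovered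
from any of its nontrivial powers and the identity. -/
theorem exists_pow_eq_smul_add (A : Matrix.SpecialLinearGroup (Fin 2) ℝ) (h : 2 < |A.1.trace|)
    {n : ℕ} (hn : n ≠ 0) : ∃ α β : ℝ, α ≠ 0 ∧ A.1 ^ n = α • A.1 + β • 1 := by
  have hdet : A.1 0 0 * A.1 1 1 - A.1 0 1 * A.1 1 0 = 1 := by
    rw [← Matrix.det_fin_two]; exact A.2
  have hsq : A.1 * A.1 = A.1.trace • A.1 - 1 := by
    ext i j
    fin_cases i <;> fin_cases j <;>
      simp [Matrix.mul_apply, Fin.sum_univ_two, Matrix.trace_fin_two] <;> linarith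
  have key : ∀ n : ℕ, ∃ α β : ℝ, 1 ≤ |α| ∧ |β| ≤ |α| ∧ A.1 ^ (n + 1) = α • A.1 + β • 1 := by
    intro n
    induction n with
    | zero => exact ⟨1, 0, by simp, by simp, by simp⟩
    | succ n ih =>
      obtain ⟨α, β, h1, h2, h3⟩ := ih
      have h4 : |α| ≤ |A.1.trace * α + β| := by
        have h5 : |A.1.trace * α| - |β| ≤ |A.1.trace * α + β| := by
          have := abs_sub_abs_le_abs_sub (A.1.trace * α) (-β)
          rwa [abs_neg, sub_neg_eq_add] at this
        rw [abs_mul] at h5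
        nlinarith
      refine ⟨A.1.trace * α + β, -α, h1.trans h4, by rwa [abs_neg], ?_⟩
      rw [pow_succ, h3, add_mul, smul_mul_assoc, hsq, smul_mul_assoc, one_mul]
      module
  obtain ⟨k, rfl⟩ := Nat.exists_eq_succ_of_ne_zero hn
  obtain ⟨α, β, h1, -, h3⟩ := key k
  refine ⟨α, β, fun h0 => ?_, h3⟩
  rw [h0, abs_zero] at h1
  linarith

namespace FuchsianSystem

variable {Γ : Type*} [Group Γ]

theorem two_lt_of_eq (D : FuchsianSystem Γ) {x : ℝ} (h : x = D.ν + D.ν⁻¹) : 2 < x := by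
  have h1 := D.one_lt_ν
  have h2 : D.ν * D.ν⁻¹ = 1 := mul_inv_cancel₀ D.ν_pos.ne'
  have h3 := D.inv_ν_lt_one
  nlinarith

/-- Tensor products of the Fuchsian representation with a representation to `SL(3, ℝ)` that is
trivial on the second generators of the handles and irreducible on powers of the others. -/
theorem isStronglyIrreducible_tensorRep (D : FuchsianSystem Γ)
    (B : Γ →* Matrix.SpecialLinearGroup (Fin 3) ℝ)
    (hb : ∀ k, B (D.b k) = 1)
    (hB : ∀ n m : ℕ, n ≠ 0 → m ≠ 0 → ∀ U : Submodule ℝ (Fin 3 → ℝ),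
      (∀ u ∈ U, ((B (D.a 0)).1 ^ n).mulVec u ∈ U) →
      (∀ u ∈ U, ((B (D.a 1)).1 ^ m).mulVec u ∈ U) → U = ⊥ ∨ U = ⊤) :
    IsStronglyIrreducible (tensorRep D.A B) := by
  intro H hH W hW
  have hpow : ∀ γ : Γ, ∃ n : ℕ, n ≠ 0 ∧ γ ^ n ∈ H := fun γ => by
    obtain ⟨n, hn, -, h⟩ := Subgroup.exists_pow_mem_of_index_ne_zero hH.index_ne_zero γ
    exact ⟨n, hn.ne', h⟩
  let e := finProdFinEquiv (m := 2) (n := 3)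
  let E : (Fin 2 × Fin 3 → ℝ) ≃ₗ[ℝ] (Fin 6 → ℝ) := LinearEquiv.funCongrLeft ℝ ℝ e.symm
  let W' : Submodule ℝ (Fin 2 × Fin 3 → ℝ) := W.comap E.toLinearMap
  have hW' : ∀ h ∈ H, ∀ w ∈ W',
      (Matrix.kroneckerMap (· * ·) (D.A h).1 (B h).1).mulVec w ∈ W' := by
    intro h hh w hw
    have h1 := hW h hh _ hw
    have h2 : (tensorRep D.A B h).1.mulVec (w ∘ e.symm) = _ := reindex_mulVec e _ w
    rw [Submodule.mem_comap]
    have h3 : E.toLinearMap w = w ∘ e.symm := rfl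
    rw [h3] at h1
    change (Matrix.kroneckerMap (· * ·) (D.A h).1 (B h).1).mulVec w ∘ e.symm ∈ W
    rw [← h2]
    exact h1
  -- the matrices acting on the first factor and preserving the subspace
  let L : Matrix (Fin 2) (Fin 2) ℝ →ₗ[ℝ] Matrix (Fin 2 × Fin 3) (Fin 2 × Fin 3) ℝ :=
    { toFun := fun C => Matrix.kroneckerMap (· * ·) C 1
      map_add' := fun C C' => Matrix.add_kronecker C C' 1
      map_smul' := fun c C => Matrix.smul_kronecker c C 1 }
  let V : Submodule ℝ (Matrix (Fin 2) (Fin 2) ℝ) :=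
    { carrier := {C | ∀ w ∈ W', (L C).mulVec w ∈ W'}
      add_mem' := fun {C C'} hC hC' w hw => by
        rw [map_add, Matrix.add_mulVec]
        exact W'.add_mem (hC w hw) (hC' w hw)
      zero_mem' := fun w _ => by
        rw [map_zero, Matrix.zero_mulVec]
        exact W'.zero_mem
      smul_mem' := fun c C hC w hw => by
        rw [map_smul, Matrix.smul_mulVec]
        exact W'.smul_mem c (hC w hw) }
  have hV1 : (1 : Matrix (Fin 2) (Fin 2) ℝ) ∈ V := by
    intro w hw
    change (Matrix.kroneckerMap (· * ·) 1 1).mulVec w ∈ W'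
    rw [Matrix.one_kronecker_one, Matrix.one_mulVec]
    exact hw
  have hV : V = ⊤ := by
    refine D.span_b V hV1 fun k => ?_
    obtain ⟨n, hn, hk⟩ := hpow (D.b k)
    -- Only a power of b_k need lie in H; it acts as A(b_k)ⁿ ⊗ 1, and A(b_k) is a combination of
    -- that power and 1.
    obtain ⟨α, β, hα, h1⟩ := exists_pow_eq_smul_add (D.A (D.b k)) (D.two_lt_of_eq (D.trace_b k)) hn
    have h2 : (D.A (D.b k)).1 ^ n ∈ V := by
      intro w hw
      have := hW' _ hk w hw
      rw [map_pow, map_pow, hb, one_pow, Matrix.SpecialLinearGroup.coe_pow,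
        Matrix.SpecialLinearGroup.coe_one] at this
      exact this
    have h3 : (D.A (D.b k)).1 = α⁻¹ • ((D.A (D.b k)).1 ^ n - β • 1) := by
      rw [h1, add_sub_cancel_right, smul_smul, inv_mul_cancel₀ hα, one_smul]
    rw [h3]
    exact V.smul_mem _ (V.sub_mem h2 (V.smul_mem _ hV1))
  have hmem : ∀ (C : Matrix (Fin 2) (Fin 2) ℝ), ∀ w ∈ W', (L C).mulVec w ∈ W' := fun C => by
    have : C ∈ V := hV ▸ Submodule.mem_top
    exact this
  let ι : Fin 2 → (Fin 3 → ℝ) →ₗ[ℝ] (Fin 2 × Fin 3 → ℝ) := fun i =>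
    { toFun := fun u p => (Pi.single i 1 : Fin 2 → ℝ) p.1 * u p.2
      map_add' := fun u v => by funext p; simp [mul_add]
      map_smul' := fun c u => by funext p; simp; ring }
  have hL : ∀ (C : Matrix (Fin 2) (Fin 2) ℝ) i u, (L C).mulVec (ι i u) =
      fun p => C p.1 i * u p.2 := by
    intro C i u
    change (Matrix.kroneckerMap (· * ·) C 1).mulVec
      (fun p => (Pi.single i 1 : Fin 2 → ℝ) p.1 * u p.2) = _
    rw [kronecker_mulVec_mul C 1 (Pi.single i 1) u, Matrix.one_mulVec]
    funext p
    simp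
  -- Invariance under the matrix units of the first factor gives W' = ℝ² ⊗ U, where U is the slice
  -- of vectors u with e₀ ⊗ u in W'.
  let U : Submodule ℝ (Fin 3 → ℝ) := W'.comap (ι 0)
  have hUi : ∀ u ∈ U, ∀ i, ι i u ∈ W' := by
    intro u hu i
    have := hmem (Matrix.single i 0 1) _ hu
    rw [hL] at this
    convert this using 1
    funext p
    simp [ι, Matrix.single_apply, Pi.single_apply, eq_comm]
  have hrow : ∀ w ∈ W', ∀ i, (fun q => w (i, q)) ∈ U := by
    intro w hw i
    have := hmem (Matrix.single 0 i 1) w hw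
    change ι 0 _ ∈ W'
    convert this using 1
    funext p
    simp only [ι, L, LinearMap.coe_mk, AddHom.coe_mk, Matrix.mulVec, dotProduct,
      Matrix.kroneckerMap_apply, Fintype.sum_prod_type, Matrix.single_apply, Matrix.one_apply,
      Pi.single_apply]
    simp only [eq_comm (a := (0 : Fin 2)), ite_and, ite_mul, one_mul, zero_mul, mul_ite, mul_one,
      mul_zero, Finset.sum_ite_eq, Finset.mem_univ, if_true]
    fin_cases i <;> simp
  have hUinv : ∀ γ n, γ ^ n ∈ H → ∀ u ∈ U, ((B γ).1 ^ n).mulVec u ∈ U := by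
    intro γ n hγ u hu
    -- The action on the first factor is undone by an element of M₂ ⊗ 1, leaving 1 ⊗ B(γ)ⁿ.
    have h1 := hmem (D.A (γ ^ n))⁻¹.1 _ (hW' _ hγ _ hu)
    change ι 0 _ ∈ W'
    convert h1 using 1
    change _ = (Matrix.kroneckerMap (· * ·) _ 1).mulVec
      ((Matrix.kroneckerMap (· * ·) _ _).mulVec (fun p => (Pi.single 0 1 : Fin 2 → ℝ) p.1 * u p.2))
    rw [kronecker_mulVec_mul (D.A (γ ^ n)).1 (B (γ ^ n)).1 (Pi.single 0 1) u,
      kronecker_mulVec_mul (D.A (γ ^ n))⁻¹.1 1, Matrix.mulVec_mulVec,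
      ← Matrix.SpecialLinearGroup.coe_mul, inv_mul_cancel, Matrix.SpecialLinearGroup.coe_one,
      Matrix.one_mulVec, Matrix.one_mulVec, map_pow, Matrix.SpecialLinearGroup.coe_pow]
    rfl
  obtain ⟨n, hn, hn'⟩ := hpow (D.a 0)
  obtain ⟨m, hm, hm'⟩ := hpow (D.a 1)
  have hE : ∀ w ∈ W, E.symm w ∈ W' := fun w hw => by
    rw [Submodule.mem_comap]
    simpa using hw
  rcases hB n m hn hm U (hUinv _ n hn') (hUinv _ m hm') with h | h
  · left
    rw [eq_bot_iff]
    intro w hw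
    have : E.symm w = 0 := by
      funext p
      have := hrow _ (hE w hw) p.1
      rw [h, Submodule.mem_bot] at this
      exact congrFun this p.2
    simpa using this
  · right
    rw [eq_top_iff]
    intro w _
    have h1 : E.symm w ∈ W' := by
      have h2 : E.symm w = ∑ i, ι i (fun q => E.symm w (i, q)) := by
        funext p
        simp [ι, Pi.single_apply]
      rw [h2]
      exact W'.sum_mem fun i _ => hUi _ (h ▸ Submodule.mem_top) i
    rw [Submodule.mem_comap] at h1
    simpa using h1

theorem complexify_inv_mulVec {d : ℕ} (B : Matrix.SpecialLinearGroup (Fin d) ℝ) {u : Fin d → ℂ}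
    {z : ℂ} (hz : z ≠ 0) (h : (complexify B.1).mulVec u = z • u) :
    (complexify (B⁻¹).1).mulVec u = z⁻¹ • u := by
  have h1 : complexify (B⁻¹).1 * complexify B.1 = 1 := by
    have h2 : (B⁻¹).1 * B.1 = 1 := by
      rw [← Matrix.SpecialLinearGroup.coe_mul, inv_mul_cancel, Matrix.SpecialLinearGroup.coe_one]
    have h3 := map_mul (Complex.ofRealHom.mapMatrix) (B⁻¹).1 B.1
    rw [h2, map_one] at h3
    exact h3.symm
  have h4 := congrArg (fun x => (complexify (B⁻¹).1).mulVec x) h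
  simp only [Matrix.mulVec_mulVec, h1, Matrix.one_mulVec, Matrix.mulVec_smul] at h4
  rw [eq_inv_smul_iff₀ hz]
  exact h4.symm

/-- The eigenvalues of a tensor product of a hyperbolic matrix with a spiral. -/
theorem exists_roots_tensorRep (D : FuchsianSystem Γ) (B : Γ →* Matrix.SpecialLinearGroup (Fin 3) ℝ)
    {γ : Γ} (hγ : |(D.A γ).1.trace| = D.ν + D.ν⁻¹) {c : ℝ} (hc : 0 < c) {ζ : ℂ} (hζ : ζ.im ≠ 0)
    {u v : Fin 3 → ℂ} (hu : u ≠ 0) (hv : v ≠ 0) (huc : (complexify (B γ).1).mulVec u = (c : ℂ) • u)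
    (hvζ : (complexify (B γ).1).mulVec v = ζ • v) :
    ∃ (z w : ℂ) (c₁ c₂ : ℝ), z.im ≠ 0 ∧ w.im ≠ 0 ∧
      ‖z‖ = D.ν * ‖ζ‖ ∧ ‖w‖ = D.ν⁻¹ * ‖ζ‖ ∧ |c₁| = D.ν * c ∧ |c₂| = D.ν⁻¹ * c ∧
      (complexify (tensorRep D.A B γ).1).charpoly.IsRoot z ∧
      (complexify (tensorRep D.A B γ).1).charpoly.IsRoot w ∧
      (complexify (tensorRep D.A B γ).1).charpoly.IsRoot (c₁ : ℂ) ∧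
      (complexify (tensorRep D.A B γ).1).charpoly.IsRoot (c₂ : ℂ) := by
  have hν := D.ν_pos
  obtain ⟨s, hs, ⟨x, hx, hAx⟩, y, hy, hAy⟩ := exists_eigenvectors_of_abs_trace hν _ hγ
  have hs0 : s ≠ 0 := fun h => by simp [h] at hs
  refine ⟨(s * D.ν : ℝ) * ζ, (s * D.ν⁻¹ : ℝ) * ζ, s * D.ν * c, s * D.ν⁻¹ * c, ?_, ?_, ?_, ?_, ?_, ?_,
    isRoot_tensorRep D.A B γ hx hAx hv hvζ, isRoot_tensorRep D.A B γ hy hAy hv hvζ, ?_, ?_⟩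
  · rw [Complex.im_ofReal_mul]
    exact mul_ne_zero (mul_ne_zero hs0 hν.ne') hζ
  · rw [Complex.im_ofReal_mul]
    exact mul_ne_zero (mul_ne_zero hs0 (inv_ne_zero hν.ne')) hζ
  · rw [norm_mul, Complex.norm_real, Real.norm_eq_abs, abs_mul, hs, abs_of_pos hν, one_mul]
  · rw [norm_mul, Complex.norm_real, Real.norm_eq_abs, abs_mul, hs, abs_of_pos (inv_pos.2 hν),
      one_mul]
  · rw [abs_mul, abs_mul, hs, abs_of_pos hν, one_mul, abs_of_pos hc]
  · rw [abs_mul, abs_mul, hs, abs_of_pos (inv_pos.2 hν), one_mul, abs_of_pos hc]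
  · rw [Complex.ofReal_mul (s * D.ν)]
    exact isRoot_tensorRep D.A B γ hx hAx hu huc
  · rw [Complex.ofReal_mul (s * D.ν⁻¹)]
    exact isRoot_tensorRep D.A B γ hy hAy hu huc

/-- The spiral of parameter r has eigenvalues r² and r⁻¹ e^{± i}. With r = ν² at a₀ the tensor
product has real eigenvalues of moduli ν⁵, ν³ and nonreal pairs of moduli ν⁻¹, ν⁻³: the larger pair
is in positions 3, 4. At a₀⁻¹ the pairs have moduli ν³, ν and the real eigenvalues ν⁻³, ν⁻⁵:
positions 1, 2. With parameter √ν at a₁ the real moduli are ν², 1 and the pairs have moduli ν^{1/2},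
ν^{-3/2}: positions 2, 3. -/
theorem exists_rep_six (D : FuchsianSystem Γ) :
    ∃ ρ : Γ →* Matrix.SpecialLinearGroup (Fin 6) ℝ,
      IsQuasiIsometricEmbedding ρ ∧ ¬ IsLimitOfAnosov ρ ∧ IsStronglyIrreducible ρ := by
  have hν := D.ν_pos
  have hν1 := D.one_lt_ν
  have hν2 : D.ν⁻¹ < D.ν := D.inv_ν_lt_one.trans hν1
  have hsin : Real.sin 1 ≠ 0 := (Real.sin_pos_of_pos_of_le_one one_pos le_rfl).ne'
  set r := D.ν ^ 2 with hr
  have hrpos : 0 < r := by positivity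
  have hr1 : 1 < r := one_lt_pow₀ hν1 two_ne_zero
  have hr2 : r⁻¹ < 1 := inv_lt_one_of_one_lt₀ hr1
  set s := √D.ν with hs
  have hspos : 0 < s := Real.sqrt_pos.2 hν
  have hs2 : s ^ 2 = D.ν := Real.sq_sqrt hν.le
  have hs1 : 1 < s := by
    rw [hs, Real.lt_sqrt zero_le_one, one_pow]
    exact hν1
  have hs3 : s⁻¹ < 1 := inv_lt_one_of_one_lt₀ hs1
  obtain ⟨B, hB⟩ := D.exists_hom (Matrix.SpecialLinearGroup (Fin 3) ℝ)
    ![spiral r hrpos.ne', spiral' s hspos.ne', 1] (fun _ => 1) fun k => Commute.one_right _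
  have hB0 : B (D.a 0) = spiral r hrpos.ne' := (hB 0).1
  have hB1 : B (D.a 1) = spiral' s hspos.ne' := (hB 1).1
  have him : ∀ c : ℝ, c ≠ 0 → ((c : ℂ) * Complex.exp ((1 : ℝ) * Complex.I)).im ≠ 0 := by
    intro c hc
    rw [Complex.im_ofReal_mul, Complex.exp_ofReal_mul_I_im]
    exact mul_ne_zero hc hsin
  have hnorm : ∀ c : ℝ, 0 < c → ‖(c : ℂ) * Complex.exp ((1 : ℝ) * Complex.I)‖ = c := by
    intro c hc
    rw [norm_mul, Complex.norm_exp_ofReal_mul_I, mul_one, Complex.norm_real, Real.norm_eq_abs,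
      abs_of_pos hc]
  have haxis : (![1, 0, 0] : Fin 3 → ℂ) ≠ 0 := fun h => by simpa using congrFun h 0
  have hplane : (![0, 1, -Complex.I] : Fin 3 → ℂ) ≠ 0 := fun h => by simpa using congrFun h 1
  have hax := complexify_spiralMatrix_mulVec_axis r 1
  have hpl := complexify_spiralMatrix_mulVec_plane r 1
  have hinv : ∀ x : ℝ, 0 < x → D.ν⁻¹ * x < D.ν * x := fun x hx => by gcongr
  refine ⟨tensorRep D.A B, D.isQuasiIsometricEmbedding_of_half_frobSq_le (by norm_num) _
    (half_frobSq_le_tensorRep D.A B), not_isLimitOfAnosov _ fun i hi1 hi2 => ?_,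
    D.isStronglyIrreducible_tensorRep B (fun k => (hB k).2) fun n m hn hm U h₁ h₂ => ?_⟩
  · have hcases : i = 1 ∨ i = 2 ∨ i = 3 := by omega
    rcases hcases with rfl | rfl | rfl
    · have htr : |(D.A (D.a 0)⁻¹).1.trace| = D.ν + D.ν⁻¹ := by
        rw [map_inv, ← D.trace_a 0]
        congr 1
        rw [Matrix.SpecialLinearGroup.coe_inv, Matrix.adjugate_fin_two, Matrix.trace_fin_two,
          Matrix.trace_fin_two]
        exact add_comm _ _
      have h1 : (complexify (B (D.a 0)⁻¹).1).mulVec ![1, 0, 0] =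
          (((r ^ 2)⁻¹ : ℝ) : ℂ) • ![1, 0, 0] := by
        rw [map_inv, hB0, Complex.ofReal_inv]
        exact complexify_inv_mulVec _ (by exact_mod_cast (pow_pos hrpos 2).ne') hax
      have h2 : (complexify (B (D.a 0)⁻¹).1).mulVec ![0, 1, -Complex.I] =
          ((r⁻¹ : ℝ) * Complex.exp ((1 : ℝ) * Complex.I))⁻¹ • ![0, 1, -Complex.I] := by
        rw [map_inv, hB0]
        exact complexify_inv_mulVec _
          (fun h => him r⁻¹ (inv_ne_zero hrpos.ne') (by rw [h]; rfl)) hpl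
      have h3 : ((r⁻¹ : ℝ) * Complex.exp ((1 : ℝ) * Complex.I))⁻¹.im ≠ 0 := by
        rw [Complex.inv_im]
        refine div_ne_zero (neg_ne_zero.2 (him r⁻¹ (inv_ne_zero hrpos.ne'))) fun h => ?_
        rw [Complex.normSq_eq_zero] at h
        exact him r⁻¹ (inv_ne_zero hrpos.ne') (by rw [h]; rfl)
      obtain ⟨z, w, c₁, c₂, hz, hw, nz, nw, n₁, n₂, rz, rw', r₁, r₂⟩ :=
        D.exists_roots_tensorRep B htr (inv_pos.2 (pow_pos hrpos 2)) h3 haxis hplane h1 h2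
      rw [norm_inv, hnorm _ (inv_pos.2 hrpos), inv_inv] at nz nw
      refine ⟨(D.a 0)⁻¹, D.pow_ne_one htr, hasConjPairAt_six_zero hz hw ?_ ?_ rz rw' r₁ r₂ ?_⟩
      · rw [nz, nw]
        exact hinv _ hrpos
      · rw [n₁, n₂]
        exact hinv _ (by positivity)
      · rw [n₁, nz]
        have : (r ^ 2)⁻¹ < 1 := inv_lt_one_of_one_lt₀ (one_lt_pow₀ hr1 two_ne_zero)
        have := this.trans hr1
        gcongr
    · let σ : Equiv.Perm (Fin 3) := Equiv.swap 0 1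
      have hσ : ∀ (u : Fin 3 → ℂ) (c : ℂ), (complexify (spiralMatrix s 1)).mulVec u = c • u →
          (complexify (B (D.a 1)).1).mulVec (u ∘ σ.symm) = c • (u ∘ σ.symm) := by
        intro u c hu
        rw [hB1]
        refine (reindex_mulVec σ (complexify (spiralMatrix s 1)) u).trans ?_
        rw [hu]
        rfl
      have hσ0 : ∀ u : Fin 3 → ℂ, u ≠ 0 → u ∘ σ.symm ≠ 0 := fun u hu h => hu (by
        funext i
        have := congrFun h (σ i)
        simpa using this)
      obtain ⟨z, w, c₁, c₂, hz, hw, nz, nw, n₁, n₂, rz, rw', r₁, r₂⟩ :=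
        D.exists_roots_tensorRep B (D.trace_a 1) (pow_pos hspos 2)
          (him s⁻¹ (inv_ne_zero hspos.ne')) (hσ0 _ haxis) (hσ0 _ hplane)
          (hσ _ _ (complexify_spiralMatrix_mulVec_axis s 1))
          (hσ _ _ (complexify_spiralMatrix_mulVec_plane s 1))
      rw [hnorm _ (inv_pos.2 hspos)] at nz nw
      refine ⟨D.a 1, D.pow_ne_one (D.trace_a 1),
        hasConjPairAt_six_one hz hw ?_ ?_ rz rw' r₁ r₂ ?_ ?_⟩
      · rw [nz, nw]
        exact hinv _ (by positivity)
      · rw [n₁, n₂]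
        exact hinv _ (by positivity)
      · rw [n₁, nz]
        have : s⁻¹ < s ^ 2 := hs3.trans (one_lt_pow₀ hs1 two_ne_zero)
        gcongr
      · rw [n₂, nz, hs2, inv_mul_cancel₀ hν.ne', ← hs2, pow_two, mul_assoc,
          mul_inv_cancel₀ hspos.ne', mul_one]
        exact hs1
    · obtain ⟨z, w, c₁, c₂, hz, hw, nz, nw, n₁, n₂, rz, rw', r₁, r₂⟩ :=
        D.exists_roots_tensorRep B (D.trace_a 0) (pow_pos hrpos 2)
          (him r⁻¹ (inv_ne_zero hrpos.ne')) haxis hplane (by rw [hB0]; exact hax)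
          (by rw [hB0]; exact hpl)
      rw [hnorm _ (inv_pos.2 hrpos)] at nz nw
      refine ⟨D.a 0, D.pow_ne_one (D.trace_a 0),
        hasConjPairAt_six_two hz hw ?_ ?_ rz rw' r₁ r₂ ?_⟩
      · rw [nz, nw]
        exact hinv _ (by positivity)
      · rw [n₁, n₂]
        exact hinv _ (by positivity)
      · rw [n₂, nz, hr]
        have e1 : D.ν * (D.ν ^ 2)⁻¹ = D.ν⁻¹ := by
          field_simp
        have e2 : D.ν⁻¹ * (D.ν ^ 2) ^ 2 = D.ν ^ 3 := by
          field_simp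
        rw [e1, e2]
        exact D.inv_ν_lt_one.trans (one_lt_pow₀ hν1 (by norm_num))
  · rw [hB0] at h₁
    rw [hB1] at h₂
    exact eq_bot_or_eq_top_of_spiral_invariant hrpos.ne' hspos.ne' hn hm U h₁ h₂

end FuchsianSystem

end TensorProduct

/-! ### The hyperbolic plane as a space of matrices -/

section HyperbolicPlane

/-- Real matrices of size two. -/
abbrev Mat2 : Type := Matrix (Fin 2) (Fin 2) ℝ

/-- The symmetric bilinear form `tr (Y Z) / 2`; it has signature `(2, 1)` on traceless matrices. -/
noncomputable def traceForm (Y Z : Mat2) : ℝ := (Y * Z).trace / 2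

theorem traceForm_comm (Y Z : Mat2) : traceForm Y Z = traceForm Z Y := by
  rw [traceForm, Matrix.trace_mul_comm, traceForm]

theorem traceForm_add_right (X Y Z : Mat2) :
    traceForm X (Y + Z) = traceForm X Y + traceForm X Z := by
  simp only [traceForm, mul_add, Matrix.trace_add]
  ring

theorem traceForm_smul_right (c : ℝ) (Y Z : Mat2) :
    traceForm Y (c • Z) = c * traceForm Y Z := by
  simp only [traceForm, mul_smul_comm, Matrix.trace_smul, smul_eq_mul]
  ring

theorem traceForm_neg_right (Y Z : Mat2) : traceForm Y (-Z) = -traceForm Y Z := by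
  simp only [traceForm, mul_neg, Matrix.trace_neg]
  ring

theorem traceForm_eq {Y Z : Mat2} (hY : Y.trace = 0) (hZ : Z.trace = 0) :
    traceForm Y Z = Y 0 0 * Z 0 0 + (Y 0 1 * Z 1 0 + Y 1 0 * Z 0 1) / 2 := by
  rw [Matrix.trace_fin_two] at hY hZ
  rw [traceForm, Matrix.trace_fin_two, Matrix.mul_apply, Matrix.mul_apply, Fin.sum_univ_two,
    Fin.sum_univ_two, eq_neg_of_add_eq_zero_right hY, eq_neg_of_add_eq_zero_right hZ]
  ring

theorem continuous_traceForm : Continuous fun p : Mat2 × Mat2 => traceForm p.1 p.2 := by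
  unfold traceForm
  fun_prop

/-- The Gram determinant of three traceless matrices is nonpositive. -/
theorem gram_nonpos {X Y Z : Mat2} (hX : X.trace = 0) (hY : Y.trace = 0) (hZ : Z.trace = 0) :
    traceForm X X * traceForm Y Y * traceForm Z Z +
      2 * (traceForm X Y * traceForm Y Z * traceForm X Z) -
      traceForm X X * traceForm Y Z ^ 2 - traceForm Y Y * traceForm X Z ^ 2 -
      traceForm Z Z * traceForm X Y ^ 2 ≤ 0 := by
  -- The form has signature (2, 1), so a Gram determinant is a negative constant times the square of
  -- the determinant of the coordinates.
  have key : traceForm X X * traceForm Y Y * traceForm Z Z +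
      2 * (traceForm X Y * traceForm Y Z * traceForm X Z) -
      traceForm X X * traceForm Y Z ^ 2 - traceForm Y Y * traceForm X Z ^ 2 -
      traceForm Z Z * traceForm X Y ^ 2 = -(1 / 4) *
      (X 0 0 * (Y 0 1 * Z 1 0 - Y 1 0 * Z 0 1) - X 0 1 * (Y 0 0 * Z 1 0 - Y 1 0 * Z 0 0) +
        X 1 0 * (Y 0 0 * Z 0 1 - Y 0 1 * Z 0 0)) ^ 2 := by
    rw [traceForm_eq hX hX, traceForm_eq hY hY, traceForm_eq hZ hZ, traceForm_eq hX hY,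
      traceForm_eq hY hZ, traceForm_eq hX hZ]
    ring
  rw [key]
  have := sq_nonneg (X 0 0 * (Y 0 1 * Z 1 0 - Y 1 0 * Z 0 1) -
    X 0 1 * (Y 0 0 * Z 1 0 - Y 1 0 * Z 0 0) + X 1 0 * (Y 0 0 * Z 0 1 - Y 0 1 * Z 0 0))
  linarith

/-- The hyperbolic plane: a sheet of the hyperboloid of matrices of trace `0` and determinant `1`. -/
def HypPlane : Type := {Y : Mat2 // Y.trace = 0 ∧ Y.det = 1 ∧ 0 < Y 1 0}

namespace HypPlane

instance : TopologicalSpace HypPlane := inferInstanceAs (TopologicalSpace (Subtype _))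

theorem continuous_val : Continuous (fun x : HypPlane => x.1) := continuous_subtype_val

theorem trace_eq (x : HypPlane) : x.1.trace = 0 := x.2.1

theorem pos (x : HypPlane) : 0 < x.1 1 0 := x.2.2.2

theorem apply_one_one (x : HypPlane) : x.1 1 1 = -x.1 0 0 :=
  eq_neg_of_add_eq_zero_right ((Matrix.trace_fin_two _).symm.trans x.2.1)

theorem apply_zero_one (x : HypPlane) : x.1 0 1 = -((1 + x.1 0 0 ^ 2) / x.1 1 0) := by
  have h := x.2.2.1
  rw [Matrix.det_fin_two, x.apply_one_one] at h
  have := x.pos.ne'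
  field_simp
  linarith

theorem ext_iff' {x y : HypPlane} (h : x.1 0 0 = y.1 0 0) (h' : x.1 1 0 = y.1 1 0) : x = y := by
  apply Subtype.ext
  ext i j
  fin_cases i <;> fin_cases j
  · exact h
  · change x.1 0 1 = y.1 0 1
    rw [apply_zero_one, apply_zero_one, h, h']
  · exact h'
  · change x.1 1 1 = y.1 1 1
    rw [apply_one_one, apply_one_one, h]

theorem traceForm_self (x : HypPlane) : traceForm x.1 x.1 = -1 := by
  have := x.pos.ne'
  rw [traceForm_eq x.trace_eq x.trace_eq, apply_zero_one]
  field_simp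
  ring

/-- The hyperbolic cosine of the distance. -/
noncomputable def coshDist (x y : HypPlane) : ℝ := -traceForm x.1 y.1

theorem coshDist_comm (x y : HypPlane) : coshDist x y = coshDist y x := by
  rw [coshDist, traceForm_comm, coshDist]

theorem one_le_coshDist (x y : HypPlane) : 1 ≤ coshDist x y := by
  have hx := x.pos
  have hy := y.pos
  have e : coshDist x y - 1 = ((x.1 1 0 - y.1 1 0) ^ 2 +
      (x.1 0 0 * y.1 1 0 - y.1 0 0 * x.1 1 0) ^ 2) / (2 * x.1 1 0 * y.1 1 0) := by
    rw [coshDist, traceForm_eq x.trace_eq y.trace_eq, apply_zero_one, apply_zero_one]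
    field_simp
    ring
  have : 0 ≤ coshDist x y - 1 := by
    rw [e]
    positivity
  linarith

theorem coshDist_self (x : HypPlane) : coshDist x x = 1 := by
  rw [coshDist, traceForm_self, neg_neg]

theorem continuous_coshDist : Continuous fun p : HypPlane × HypPlane => coshDist p.1 p.2 :=
  (continuous_traceForm.comp ((continuous_val.comp continuous_fst).prodMk
    (continuous_val.comp continuous_snd))).neg

/-- A substitute for the triangle inequality, corresponding to cosh (a + b) ≤ 2 cosh a cosh b. It
follows from the Gram determinant of the three points. -/
theorem coshDist_le (x y z : HypPlane) :
    coshDist x z ≤ 2 * (coshDist x y * coshDist y z) := by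
  have h := gram_nonpos x.trace_eq y.trace_eq z.trace_eq
  rw [traceForm_self, traceForm_self, traceForm_self] at h
  have h1 := one_le_coshDist x y
  have h2 := one_le_coshDist y z
  have h3 := one_le_coshDist x z
  unfold coshDist at h1 h2 h3 ⊢
  by_contra! hlt
  nlinarith

/-- Two points on different sides of a line are at least as far from each other as the first one
is from the line. -/
theorem one_add_sq_le (x y : HypPlane) {A : Mat2} (hA : A.trace = 0) (hAA : traceForm A A = 1)
    (hx : 0 ≤ traceForm x.1 A) (hy : traceForm y.1 A ≤ 0) :
    1 + traceForm x.1 A ^ 2 ≤ coshDist x y ^ 2 := by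
  have h := gram_nonpos x.trace_eq y.trace_eq hA
  rw [traceForm_self, traceForm_self, hAA] at h
  have h1 := one_le_coshDist x y
  unfold coshDist at h1 ⊢
  -- Being on opposite sides of the line makes the mixed term of the Gram determinant nonnegative,
  -- so it can be dropped.
  have h2 : 0 ≤ traceForm x.1 y.1 * traceForm y.1 A * traceForm x.1 A :=
    mul_nonneg (mul_nonneg_of_nonpos_of_nonpos (by linarith) hy) hx
  nlinarith [sq_nonneg (traceForm y.1 A)]

/-- Horospherical coordinates. -/
noncomputable def homeomorph : HypPlane ≃ₜ ℝ × ℝ where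
  toFun x := (x.1 0 0, Real.log (x.1 1 0))
  invFun p := ⟨!![p.1, -((1 + p.1 ^ 2) / Real.exp p.2); Real.exp p.2, -p.1], by
    rw [Matrix.trace_fin_two_of, Matrix.det_fin_two_of]
    refine ⟨by ring, ?_, Real.exp_pos _⟩
    have := (Real.exp_pos p.2).ne'
    field_simp
    ring⟩
  left_inv x := ext_iff' rfl (Real.exp_log x.pos)
  right_inv p := Prod.ext rfl (Real.log_exp p.2)
  continuous_toFun := by
    have h : Continuous fun x : HypPlane => x.1 := continuous_val
    exact (h.matrix_elem 0 0).prodMk ((h.matrix_elem 1 0).log fun x => x.pos.ne')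
  continuous_invFun := by
    refine Continuous.subtype_mk (continuous_matrix fun i j => ?_) _
    fin_cases i <;> fin_cases j
    · exact continuous_fst
    · exact ((continuous_const.add (continuous_fst.pow 2)).div (Real.continuous_exp.comp
        continuous_snd) fun p => (Real.exp_pos _).ne').neg
    · exact Real.continuous_exp.comp continuous_snd
    · exact continuous_fst.neg

instance : T2Space HypPlane := homeomorph.symm.t2Space

instance : LocallyCompactSpace HypPlane := homeomorph.isClosedEmbedding.locallyCompactSpace

instance : ContractibleSpace HypPlane := homeomorph.contractibleSpace

instance : SimplyConnectedSpace HypPlane := inferInstance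

/-- The base point. -/
def base : HypPlane := ⟨!![0, -1; 1, 0], by
  rw [Matrix.trace_fin_two_of, Matrix.det_fin_two_of]
  refine ⟨by norm_num, by norm_num, one_pos⟩⟩

/-- The hyperbolic cosine of the distance to the base point. -/
noncomputable def height (x : HypPlane) : ℝ := coshDist x base

theorem height_eq (x : HypPlane) : height x = (x.1 1 0 - x.1 0 1) / 2 := by
  rw [height, coshDist, traceForm_eq x.trace_eq base.trace_eq]
  simp [base]
  ring

/-- Closed balls are compact: a bound on the height bounds the diagonal entry and bounds the lower
left entry above and away from 0. -/
theorem isCompact_height_le (C : ℝ) : IsCompact {x : HypPlane | height x ≤ C} := by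
  rw [← homeomorph.isCompact_image]
  have hK : IsCompact (Set.Icc (-(2 * C)) (2 * C) ×ˢ
      Set.Icc (-Real.log (2 * C)) (Real.log (2 * C))) := isCompact_Icc.prod isCompact_Icc
  refine hK.of_isClosed_subset (homeomorph.isClosed_image.2 (isClosed_le
    (continuous_coshDist.comp (continuous_id.prodMk continuous_const)) continuous_const)) ?_
  rintro _ ⟨x, hx, rfl⟩
  have hy := x.pos
  have hx' : (x.1 1 0 + (1 + x.1 0 0 ^ 2) / x.1 1 0) / 2 ≤ C := by
    have := hx.out
    rwa [height_eq, apply_zero_one, sub_neg_eq_add] at this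
  have h0 : 0 ≤ (1 + x.1 0 0 ^ 2) / x.1 1 0 := by positivity
  have h1 : x.1 1 0 ≤ 2 * C := by linarith
  have h2 : (1 + x.1 0 0 ^ 2) ≤ 2 * C * x.1 1 0 := by
    rw [← div_le_iff₀ hy]
    linarith
  have hC : 0 < 2 * C := hy.trans_le h1
  have h3 : x.1 0 0 ^ 2 ≤ (2 * C) ^ 2 := by nlinarith
  have h4 : (2 * C)⁻¹ ≤ x.1 1 0 := by
    rw [inv_le_iff_one_le_mul₀ hC]
    nlinarith [sq_nonneg (x.1 0 0)]
  refine ⟨⟨(abs_le.1 (abs_le_of_sq_le_sq h3 hC.le)).1, (abs_le.1 (abs_le_of_sq_le_sq h3 hC.le)).2⟩,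
    ?_, Real.log_le_log hy h1⟩
  change -Real.log (2 * C) ≤ Real.log (x.1 1 0)
  rw [← Real.log_inv]
  exact Real.log_le_log (inv_pos.2 hC) h4

theorem isCompact_coshDist_le (x : HypPlane) (C : ℝ) : IsCompact {y | coshDist y x ≤ C} := by
  refine (isCompact_height_le (2 * (C * height x))).of_isClosed_subset (isClosed_le
    (continuous_coshDist.comp (continuous_id.prodMk continuous_const)) continuous_const) ?_
  intro y hy
  refine (coshDist_le y x base).trans ?_
  have h1 := one_le_coshDist x base
  have : coshDist y x * coshDist x base ≤ C * coshDist x base :=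
    mul_le_mul_of_nonneg_right hy.out (by linarith)
  change 2 * (coshDist y x * coshDist x base) ≤ 2 * (C * coshDist x base)
  linarith

/-- A point on the segment from the base point to `x`, at prescribed height. -/
theorem exists_between (x : HypPlane) {c : ℝ} (hc : 1 < c) (hcx : c ≤ height x) :
    ∃ y : HypPlane, height y = c ∧ c * coshDist x y ≤ height x := by
  set p := height x with hp
  set q := (x.1 1 0 + x.1 0 1) / 2 with hq
  set r := x.1 0 0 with hr
  have hp1 : 1 < p := hc.trans_le hcx
  have h10 : x.1 1 0 = p + q := by rw [hp, hq, height_eq]; ring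
  have h01 : x.1 0 1 = q - p := by rw [hp, hq, height_eq]; ring
  have hqr : q ^ 2 + r ^ 2 = p ^ 2 - 1 := by
    have := x.traceForm_self
    rw [traceForm_eq x.trace_eq x.trace_eq, h10, h01, ← hr] at this
    linarith
  have hp2 : 0 < p ^ 2 - 1 := by nlinarith
  have hc2 : 0 < c ^ 2 - 1 := by nlinarith
  set a := √(c ^ 2 - 1) with ha
  set b := √(p ^ 2 - 1) with hb
  have ha0 : 0 < a := Real.sqrt_pos.2 hc2
  have hb0 : 0 < b := Real.sqrt_pos.2 hp2
  have ha2 : a ^ 2 = c ^ 2 - 1 := Real.sq_sqrt hc2.le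
  have hb2 : b ^ 2 = p ^ 2 - 1 := Real.sq_sqrt hp2.le
  -- The spatial part (q, r) of x has length b, the hyperbolic sine of its distance to the base
  -- point; that of y is the same vector rescaled to length a.
  set s := a / b with hs
  have hsb : s * b = a := div_mul_cancel₀ a hb0.ne'
  have hs2 : s ^ 2 * (q ^ 2 + r ^ 2) = c ^ 2 - 1 := by
    rw [hqr, ← hb2, ← mul_pow, hsb, ha2]
  have hpos : 0 < c + s * q := by
    nlinarith [sq_nonneg (s * r), sq_nonneg (c + s * q)]
  obtain ⟨y, hy⟩ : ∃ y : HypPlane, y.1 = !![s * r, s * q - c; c + s * q, -(s * r)] := by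
    refine ⟨⟨!![s * r, s * q - c; c + s * q, -(s * r)], ?_, ?_, hpos⟩, rfl⟩
    · rw [Matrix.trace_fin_two_of]
      ring
    · rw [Matrix.det_fin_two_of]
      linear_combination -hs2
  refine ⟨y, ?_, ?_⟩
  · rw [height_eq, hy]
    simp
    ring
  · have e : coshDist x y = p * c - a * b := by
      rw [coshDist, traceForm_eq x.trace_eq y.trace_eq, hy, h10, h01, ← hr]
      simp
      have : s * (q ^ 2 + r ^ 2) = a * b := by
        rw [hqr, ← hb2, pow_two, ← mul_assoc, hsb]
      linear_combination -this
    rw [e]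
    -- Monotonicity of the hyperbolic tangent: a / c ≤ b / p.
    have h1 : a * p ≤ c * b := by
      refine abs_le_of_sq_le_sq' ?_ (by positivity) |>.2
      rw [mul_pow, mul_pow, ha2, hb2]
      nlinarith
    have h2 := mul_le_mul_of_nonneg_left h1 ha0.le
    have h3 : a * (a * p) = (c ^ 2 - 1) * p := by rw [← ha2]; ring
    linarith

end HypPlane

end HyperbolicPlane

/-! ### A hyperbolic triangle group -/

section Reflections

/-- The reflection of the hyperbolic plane with mirror given by `A`, extended linearly. -/
def reflection (A : Mat2) : Module.End ℝ Mat2 where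
  toFun Y := -(A * Y * A)
  map_add' Y Z := by rw [mul_add, add_mul, neg_add]
  map_smul' c Y := by simp

theorem reflection_apply (A Y : Mat2) : reflection A Y = -(A * Y * A) := rfl

/-- For traceless matrices AY + YA = 2⟨Y, A⟩, the polarized Cayley–Hamilton identity. With A² = 1
this turns -AYA into the usual formula Y - 2⟨Y, A⟩A of a reflection. -/
theorem reflection_eq {A Y : Mat2} (hA : A.trace = 0) (hAA : A * A = 1) (hY : Y.trace = 0) :
    reflection A Y = Y + (-(2 * traceForm Y A)) • A := by
  have h1 : A * Y + Y * A = (2 * traceForm Y A) • 1 := by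
    rw [traceForm_eq hY hA]
    rw [Matrix.trace_fin_two] at hA hY
    have hA' := eq_neg_of_add_eq_zero_right hA
    have hY' := eq_neg_of_add_eq_zero_right hY
    ext i j
    fin_cases i <;> fin_cases j <;> simp [Matrix.mul_apply, Fin.sum_univ_two, hA', hY'] <;> ring
  rw [reflection_apply, eq_sub_of_add_eq h1, sub_mul, smul_mul_assoc, one_mul, mul_assoc, hAA,
    mul_one]
  module

theorem traceForm_reflection {A : Mat2} (hAA : A * A = 1) (Y Z : Mat2) :
    traceForm (reflection A Y) (reflection A Z) = traceForm Y Z := by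
  have : reflection A Y * reflection A Z = A * (Y * Z) * A := by
    rw [reflection_apply, reflection_apply, neg_mul_neg]
    calc A * Y * A * (A * Z * A) = A * Y * (A * A) * Z * A := by simp only [mul_assoc]
      _ = _ := by rw [hAA, mul_one]; simp only [mul_assoc]
  rw [traceForm, this, Matrix.trace_mul_comm, ← mul_assoc, hAA, one_mul, traceForm]

theorem reflection_mul_pow (A C : Mat2) (n : ℕ) (Y : Mat2) :
    ((reflection A * reflection C) ^ n) Y = (A * C) ^ n * Y * (C * A) ^ n := by
  induction n with
  | zero => simp
  | succ n ih =>
    rw [pow_succ', Module.End.mul_apply, ih, Module.End.mul_apply, reflection_apply,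
      reflection_apply, pow_succ' (A * C), pow_succ (C * A)]
    simp only [mul_neg, neg_mul, neg_neg, mul_assoc]

/-- Reflections do not exchange the two sheets of the hyperboloid: the entry is a sum of two squares
divided by a positive number, and both squares vanish only if A² ≠ 1. -/
theorem reflection_pos {A : Mat2} (hA : A.trace = 0) (hAA : A * A = 1) (x : HypPlane) :
    0 < reflection A x.1 1 0 := by
  rw [Matrix.trace_fin_two] at hA
  have hA' := eq_neg_of_add_eq_zero_right hA
  have hx := x.pos
  have e : reflection A x.1 1 0 =
      ((x.1 1 0 * A 0 0 - x.1 0 0 * A 1 0) ^ 2 + A 1 0 ^ 2) / x.1 1 0 := by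
    rw [reflection_apply]
    simp only [Matrix.neg_apply, Matrix.mul_apply, Fin.sum_univ_two, hA', x.apply_one_one,
      x.apply_zero_one]
    field_simp
    ring
  have h1 := congrFun (congrFun hAA 0) 0
  simp only [Matrix.mul_apply, Fin.sum_univ_two, Matrix.one_apply_eq] at h1
  rw [e]
  apply div_pos _ hx
  by_cases hc : A 1 0 = 0
  · rw [hc] at h1 ⊢
    have h2 : A 0 0 ≠ 0 := fun h => by rw [h] at h1; simp at h1
    have h3 : x.1 1 0 * A 0 0 - x.1 0 0 * 0 ≠ 0 := by
      rw [mul_zero, sub_zero]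
      exact mul_ne_zero hx.ne' h2
    positivity
  · positivity

/-- The matrix -R has determinant 1 and trace 2 cos φ with φ = π / m, like the rotation by φ, whose
m-th power is -1; the sign disappears as m is even. The computation uses the Chebyshev recursion for
sin (kφ). -/
theorem pow_eq_neg_one_of_trace {R : Mat2} (hdet : R.det = 1) {m : ℕ} (hm : 2 ≤ m) (he : Even m)
    (htr : R.trace = -(2 * Real.cos (Real.pi / m))) : R ^ m = -1 := by
  set φ := Real.pi / m with hφ
  have hm0 : (0 : ℝ) < m := by exact_mod_cast (by omega : 0 < m)
  have hmφ : m * φ = Real.pi := mul_div_cancel₀ _ hm0.ne'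
  have hφ0 : 0 < φ := div_pos Real.pi_pos hm0
  have hφ1 : φ < Real.pi := by
    rw [hφ, div_lt_iff₀ hm0]
    have : (2 : ℝ) ≤ m := by exact_mod_cast hm
    nlinarith [Real.pi_pos]
  have hsin : 0 < Real.sin φ := Real.sin_pos_of_pos_of_lt_pi hφ0 hφ1
  have hsq : (-R) * (-R) = (2 * Real.cos φ) • (-R) - 1 := by
    have h1 : 2 * Real.cos φ = -R.trace := by rw [htr]; ring
    rw [h1]
    rw [Matrix.det_fin_two] at hdet
    ext i j
    fin_cases i <;> fin_cases j <;>
      simp [Matrix.mul_apply, Fin.sum_univ_two, Matrix.trace_fin_two] <;> linarith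
  have key : ∀ k : ℕ, Real.sin φ • (-R) ^ (k + 1) =
      Real.sin ((k + 1) * φ) • (-R) - Real.sin (k * φ) • 1 := by
    intro k
    induction k with
    | zero => simp
    | succ k ih =>
      rw [pow_succ, ← smul_mul_assoc, ih, sub_mul, smul_mul_assoc, hsq, smul_mul_assoc, one_mul]
      have h2 : Real.sin ((k + 1 + 1) * φ) =
          2 * Real.cos φ * Real.sin ((k + 1) * φ) - Real.sin (k * φ) := by
        have e1 : ((k : ℝ) + 1 + 1) * φ = (k + 1) * φ + φ := by ring
        have e2 : (k : ℝ) * φ = (k + 1) * φ - φ := by ring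
        rw [e1, e2, Real.sin_add, Real.sin_sub]
        ring
      push_cast
      rw [h2]
      module
  obtain ⟨k, rfl⟩ : ∃ k, m = k + 1 := ⟨m - 1, by omega⟩
  have h1 := key k
  have h2 : ((k : ℝ) + 1) * φ = Real.pi := by exact_mod_cast hmφ
  have h3 : (k : ℝ) * φ = Real.pi - φ := by linarith
  rw [h2, h3, Real.sin_pi, Real.sin_pi_sub, zero_smul, zero_sub, ← smul_neg] at h1
  have h4 := smul_right_injective _ hsin.ne' h1
  rwa [he.neg_pow] at h4

end Reflections

/-! ### The triangle group and its action by isometries. -/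

section TriangleGroup

/-- The Coxeter matrix of the triangle group with angles `π / 4g`, `π / 4g` and `π / 2`. -/
def triangleMatrix (g : ℕ) : CoxeterMatrix (Fin 3) where
  M := !![1, 4 * g, 2; 4 * g, 1, 4 * g; 2, 4 * g, 1]
  isSymm := by
    ext i j
    fin_cases i <;> fin_cases j <;> rfl
  diagonal i := by fin_cases i <;> rfl
  off_diagonal i j h := by
    fin_cases i <;> fin_cases j <;> simp at h ⊢

/-- The triangle group with angles `π / 4g`, `π / 4g` and `π / 2`. -/
abbrev TriangleGroup (g : ℕ) : Type := (triangleMatrix g).Group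

/-- The reflections in the sides of the triangle. -/
abbrev triangleSystem (g : ℕ) : CoxeterSystem (triangleMatrix g) (TriangleGroup g) :=
  (triangleMatrix g).toCoxeterSystem

/-- Half the angle under which the sides of the regular `4g`-gon are seen from its centre. -/
noncomputable def halfAngle (g : ℕ) : ℝ := Real.pi / (4 * g)

/-- The hyperbolic cosine of the distance from the centre of the `4g`-gon to its sides. -/
noncomputable def apothemCosh (g : ℕ) : ℝ := Real.cos (halfAngle g) / Real.sin (halfAngle g)

/-- The hyperbolic sine of the distance from the centre of the `4g`-gon to its sides. -/
noncomputable def apothemSinh (g : ℕ) : ℝ := √(apothemCosh g ^ 2 - 1)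

/-- The matrices defining the three mirrors. -/
noncomputable def mirror (g : ℕ) : Fin 3 → Mat2 :=
  -- In this order: the line from the centre of the polygon, which is the base point, to the
  -- midpoint of a side; the line from the centre to an end of that side; the side itself.
  ![!![1, 0; 0, -1],
    !![-Real.cos (halfAngle g), Real.sin (halfAngle g);
      Real.sin (halfAngle g), Real.cos (halfAngle g)],
    !![0, apothemSinh g - apothemCosh g; -(apothemSinh g + apothemCosh g), 0]]

theorem mirror_trace (g : ℕ) (i : Fin 3) : (mirror g i).trace = 0 := by
  fin_cases i <;> simp [mirror, Matrix.trace_fin_two]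

variable (g : ℕ) [hg : Fact (4 ≤ g)]

theorem four_le_cast : (4 : ℝ) ≤ g := by exact_mod_cast hg.out

theorem halfAngle_pos : 0 < halfAngle g := by
  have := four_le_cast g
  unfold halfAngle
  positivity

theorem mul_halfAngle : 4 * g * halfAngle g = Real.pi := by
  have := four_le_cast g
  unfold halfAngle
  field_simp

theorem halfAngle_le : halfAngle g ≤ Real.pi / 16 := by
  have h1 := four_le_cast g
  have h2 := mul_halfAngle g
  have := halfAngle_pos g
  nlinarith

theorem sin_halfAngle_pos : 0 < Real.sin (halfAngle g) :=
  Real.sin_pos_of_pos_of_lt_pi (halfAngle_pos g)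
    (by have := halfAngle_le g; linarith [Real.pi_pos])

theorem cos_halfAngle_pos : 0 < Real.cos (halfAngle g) :=
  Real.cos_pos_of_mem_Ioo ⟨by linarith [halfAngle_pos g, Real.pi_pos],
    by have := halfAngle_le g; linarith [Real.pi_pos]⟩

theorem sin_halfAngle_lt_cos : Real.sin (halfAngle g) < Real.cos (halfAngle g) := by
  rw [← Real.cos_pi_div_two_sub]
  have := halfAngle_le g
  exact Real.cos_lt_cos_of_nonneg_of_le_pi_div_two (halfAngle_pos g).le
    (by linarith [halfAngle_pos g]) (by linarith [Real.pi_pos])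

theorem one_lt_apothemCosh : 1 < apothemCosh g := by
  rw [apothemCosh, one_lt_div (sin_halfAngle_pos g)]
  exact sin_halfAngle_lt_cos g

theorem apothemSinh_sq : apothemSinh g ^ 2 = apothemCosh g ^ 2 - 1 :=
  Real.sq_sqrt (by nlinarith [one_lt_apothemCosh g])

theorem apothemSinh_pos : 0 < apothemSinh g :=
  Real.sqrt_pos.2 (by nlinarith [one_lt_apothemCosh g])

theorem mirror_mul_self (i : Fin 3) : mirror g i * mirror g i = 1 := by
  have h1 := Real.sin_sq_add_cos_sq (halfAngle g)
  have h2 := apothemSinh_sq g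
  ext j k
  fin_cases i <;> fin_cases j <;> fin_cases k <;>
    simp [mirror, Matrix.mul_apply, Fin.sum_univ_two] <;> linarith

theorem mirror_det (i : Fin 3) : (mirror g i).det = -1 := by
  have h := congrFun (congrFun (mirror_mul_self g i) 0) 0
  have h1 := mirror_trace g i
  rw [Matrix.trace_fin_two] at h1
  simp only [Matrix.mul_apply, Fin.sum_univ_two, Matrix.one_apply_eq] at h
  rw [Matrix.det_fin_two, eq_neg_of_add_eq_zero_right h1]
  linarith

theorem traceForm_mirror_self (i : Fin 3) : traceForm (mirror g i) (mirror g i) = 1 := by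
  rw [traceForm, mirror_mul_self]
  simp

theorem traceForm_mirror {i j : Fin 3} (h : i ≠ j) :
    traceForm (mirror g i) (mirror g j) = -Real.cos (Real.pi / triangleMatrix g i j) := by
  have h1 := (sin_halfAngle_pos g).ne'
  have e1 : Real.pi / (4 * g) = halfAngle g := rfl
  have e2 : apothemCosh g * Real.sin (halfAngle g) = Real.cos (halfAngle g) := by
    rw [apothemCosh, div_mul_cancel₀ _ h1]
  rw [traceForm_eq (mirror_trace g i) (mirror_trace g j)]
  fin_cases i <;> fin_cases j <;> first
    | exact absurd rfl h
    | (simp [mirror, triangleMatrix, e1]; try linarith)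

theorem triangleMatrix_even {i j : Fin 3} (h : i ≠ j) :
    2 ≤ triangleMatrix g i j ∧ Even (triangleMatrix g i j) := by
  have := hg.out
  have he : Even (4 * g) := ⟨2 * g, by ring⟩
  fin_cases i <;> fin_cases j <;> first
    | exact absurd rfl h
    | exact ⟨by change 2 ≤ 4 * g; omega, he⟩
    | exact ⟨le_refl 2, even_two⟩

theorem mirror_mul_pow {i j : Fin 3} (h : i ≠ j) :
    (mirror g i * mirror g j) ^ triangleMatrix g i j = -1 := by
  obtain ⟨h1, h2⟩ := triangleMatrix_even g h
  refine pow_eq_neg_one_of_trace ?_ h1 h2 ?_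
  · rw [Matrix.det_mul, mirror_det, mirror_det]
    norm_num
  · have := traceForm_mirror g h
    rw [traceForm] at this
    linarith

/-- Products of two mirror matrices have power -1 rather than 1, but the action is by multiplication
on both sides and the two signs cancel. -/
theorem isLiftable_reflection :
    (triangleMatrix g).IsLiftable fun i => reflection (mirror g i) := by
  intro i j
  ext1 Y
  rw [reflection_mul_pow, Module.End.one_apply]
  rcases eq_or_ne i j with rfl | h
  · rw [(triangleMatrix g).diagonal, pow_one, mirror_mul_self, one_mul, mul_one]
  · rw [mirror_mul_pow g h, (triangleMatrix g).symmetric i j, mirror_mul_pow g h.symm]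
    simp

/-- The linear action of the triangle group. -/
noncomputable def triangleRep : TriangleGroup g →* Module.End ℝ Mat2 :=
  (triangleSystem g).lift ⟨_, isLiftable_reflection g⟩

theorem triangleRep_simple (i : Fin 3) :
    triangleRep g ((triangleSystem g).simple i) = reflection (mirror g i) :=
  (triangleSystem g).lift_apply_simple (isLiftable_reflection g) i

theorem traceForm_triangleRep (w : TriangleGroup g) (Y Z : Mat2) :
    traceForm (triangleRep g w Y) (triangleRep g w Z) = traceForm Y Z := by
  induction w using (triangleSystem g).simple_induction_left with
  | one => rw [map_one]; rfl
  | mul_simple_left w i ih =>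
    rw [map_mul, Module.End.mul_apply, Module.End.mul_apply, triangleRep_simple,
      traceForm_reflection (mirror_mul_self g i), ih]

theorem triangleRep_mem (w : TriangleGroup g) (x : HypPlane) :
    (triangleRep g w x.1).trace = 0 ∧ (triangleRep g w x.1).det = 1 ∧
      0 < triangleRep g w x.1 1 0 := by
  induction w using (triangleSystem g).simple_induction_left with
  | one => rw [map_one]; exact x.2
  | mul_simple_left w i ih =>
    rw [map_mul, Module.End.mul_apply, triangleRep_simple]
    refine ⟨?_, ?_, reflection_pos (mirror_trace g i) (mirror_mul_self g i) ⟨_, ih⟩⟩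
    · rw [reflection_apply, Matrix.trace_neg, Matrix.trace_mul_comm, ← mul_assoc, mirror_mul_self,
        one_mul, ih.1, neg_zero]
    · rw [reflection_apply, Matrix.det_neg, Matrix.det_mul, Matrix.det_mul, mirror_det, ih.2.1]
      norm_num

noncomputable instance : MulAction (TriangleGroup g) HypPlane where
  smul w x := ⟨triangleRep g w x.1, triangleRep_mem g w x⟩
  one_smul x := Subtype.ext (by
    change triangleRep g 1 x.1 = x.1
    rw [map_one, Module.End.one_apply])
  mul_smul v w x := Subtype.ext (by
    change triangleRep g (v * w) x.1 = triangleRep g v (triangleRep g w x.1)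
    rw [map_mul, Module.End.mul_apply])

theorem smul_val (w : TriangleGroup g) (x : HypPlane) : (w • x).1 = triangleRep g w x.1 := rfl

theorem coshDist_smul (w : TriangleGroup g) (x y : HypPlane) :
    (w • x).coshDist (w • y) = x.coshDist y := by
  rw [HypPlane.coshDist, smul_val, smul_val, traceForm_triangleRep, HypPlane.coshDist]

theorem simple_smul_val (i : Fin 3) (x : HypPlane) :
    ((triangleSystem g).simple i • x).1 =
      x.1 + (-(2 * traceForm x.1 (mirror g i))) • mirror g i := by
  rw [smul_val, triangleRep_simple, reflection_eq (mirror_trace g i) (mirror_mul_self g i)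
    x.trace_eq]

theorem simple_smul_eq_self_iff (i : Fin 3) (x : HypPlane) :
    (triangleSystem g).simple i • x = x ↔ traceForm x.1 (mirror g i) = 0 := by
  constructor
  · intro h
    have h1 := simple_smul_val g i x
    rw [h, left_eq_add] at h1
    have h2 : traceForm x.1 ((-(2 * traceForm x.1 (mirror g i))) • mirror g i) = 0 := by
      rw [h1, ← zero_smul ℝ (0 : Mat2), traceForm_smul_right, zero_mul]
    rw [traceForm_smul_right] at h2
    nlinarith
  · intro h
    apply Subtype.ext
    rw [simple_smul_val, h, mul_zero, neg_zero, zero_smul, add_zero]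

instance : ContinuousConstSMul (TriangleGroup g) HypPlane where
  continuous_const_smul w := by
    refine Continuous.subtype_mk ?_ _
    exact (LinearMap.continuous_of_finiteDimensional (triangleRep g w)).comp
      HypPlane.continuous_val

end TriangleGroup

/-! ### The fundamental chamber -/

section Chamber

theorem traceForm_mirror_zero (g : ℕ) (x : HypPlane) : traceForm x.1 (mirror g 0) = x.1 0 0 := by
  rw [traceForm_eq x.trace_eq (mirror_trace g 0)]
  simp [mirror]

theorem traceForm_mirror_one (g : ℕ) (x : HypPlane) : traceForm x.1 (mirror g 1) =
    (x.1 0 1 + x.1 1 0) / 2 * Real.sin (halfAngle g) - x.1 0 0 * Real.cos (halfAngle g) := by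
  rw [traceForm_eq x.trace_eq (mirror_trace g 1)]
  simp [mirror]
  ring

theorem traceForm_mirror_two (g : ℕ) (x : HypPlane) : traceForm x.1 (mirror g 2) =
    x.height * apothemSinh g - (x.1 0 1 + x.1 1 0) / 2 * apothemCosh g := by
  rw [traceForm_eq x.trace_eq (mirror_trace g 2), HypPlane.height_eq]
  simp [mirror]
  ring

theorem height_sq (x : HypPlane) :
    x.height ^ 2 = 1 + ((x.1 0 1 + x.1 1 0) / 2) ^ 2 + x.1 0 0 ^ 2 := by
  have h := x.traceForm_self
  rw [traceForm_eq x.trace_eq x.trace_eq] at h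
  rw [HypPlane.height_eq]
  linear_combination -h

variable (g : ℕ) [hg : Fact (4 ≤ g)]

/-- The fundamental triangle. -/
def chamber : Set HypPlane := {x | ∀ i, 0 ≤ traceForm x.1 (mirror g i)}

theorem triangleRep_mirror_self (w : TriangleGroup g) (i : Fin 3) :
    triangleRep g (w * (triangleSystem g).simple i) (mirror g i) =
      -triangleRep g w (mirror g i) := by
  rw [map_mul, Module.End.mul_apply, triangleRep_simple, reflection_apply, mirror_mul_self, one_mul,
    map_neg]

theorem triangleRep_mirror {i j : Fin 3} (h : i ≠ j) (w : TriangleGroup g) :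
    triangleRep g (w * (triangleSystem g).simple i) (mirror g j) = triangleRep g w (mirror g j) +
      (2 * Real.cos (Real.pi / triangleMatrix g i j)) • triangleRep g w (mirror g i) := by
  rw [map_mul, Module.End.mul_apply, triangleRep_simple, reflection_eq (mirror_trace g i)
    (mirror_mul_self g i) (mirror_trace g j), traceForm_comm, traceForm_mirror g h, map_add,
    map_smul]
  congr 2
  ring

theorem length_mul_pow_le {B W : Type*} [Group W] {M : CoxeterMatrix B} (cs : CoxeterSystem M W)
    (i j : B) (n : ℕ) : cs.length ((cs.simple i * cs.simple j) ^ n) ≤ 2 * n := by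
  induction n with
  | zero => simp
  | succ n ih =>
    rw [pow_succ]
    have h1 := cs.length_mul_le ((cs.simple i * cs.simple j) ^ n) (cs.simple i * cs.simple j)
    have h2 := cs.length_mul_le (cs.simple i) (cs.simple j)
    rw [cs.length_simple, cs.length_simple] at h2
    omega

/-- The key property of the geometric representation: if `ℓ (w) < ℓ (w s_i)`, then the chamber and
its image under `w s_i` lie on different sides of the mirror of `w s_i w⁻¹`. -/
theorem traceForm_nonneg_of_length_lt (w : TriangleGroup g) (i : Fin 3)
    (h : (triangleSystem g).length w < (triangleSystem g).length (w * (triangleSystem g).simple i))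
    {x : HypPlane} (hx : x ∈ chamber g) : 0 ≤ traceForm x.1 (triangleRep g w (mirror g i)) := by
  induction hn : (triangleSystem g).length w using Nat.strong_induction_on generalizing w i with
  | _ n ih =>
  set cs := triangleSystem g with hcs
  rcases eq_or_ne w 1 with rfl | hw
  · rw [map_one]
    exact hx i
  obtain ⟨j, hj⟩ := cs.exists_rightDescent_of_ne_one hw
  have hj' : cs.length (w * cs.simple j) < cs.length w := hj
  have hij : i ≠ j := by
    rintro rfl
    omega
  set m := triangleMatrix g i j with hm
  obtain ⟨hm2, m', hm'⟩ := triangleMatrix_even g hij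
  -- the letters that are removed from the right end of `w`
  let l : ℕ → Fin 3 := fun k => if Even k then j else i
  have hl2 : ∀ k, l (k + 2) = l k := fun k => by
    have : Even (k + 2) ↔ Even k := by simp [Nat.even_add]
    simp only [l, this]
  have hl1 : ∀ k, l k ≠ l (k + 1) := fun k => by
    by_cases hk : Even k <;> simp [l, hk, Nat.even_add_one, hij, hij.symm]
  have hlm : ∀ k, triangleMatrix g (l k) (l (k + 1)) = m := fun k => by
    by_cases hk : Even k <;> simp [l, hk, Nat.even_add_one, hm]
    exact (triangleMatrix g).symmetric j i
  obtain ⟨v, hv0, hv1⟩ : ∃ v : ℕ → TriangleGroup g, v 0 = w ∧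
      ∀ k, v (k + 1) = v k * cs.simple (l k) :=
    ⟨fun k => Nat.rec w (fun k u => u * cs.simple (l k)) k, rfl, fun k => rfl⟩
  have hex : ∃ k, cs.length (v k) + k ≠ cs.length w := ⟨cs.length w + 1, by omega⟩
  -- N is the number of letters, alternately j and i, that can be stripped from the right end of w
  -- with each one shortening it.
  obtain ⟨N, hN, hlt⟩ : ∃ N, cs.length (v (N + 1)) + (N + 1) ≠ cs.length w ∧
      ∀ k ≤ N, cs.length (v k) + k = cs.length w := by
    classical
    obtain ⟨N, hN⟩ : ∃ N, Nat.find hex = N + 1 := by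
      refine ⟨Nat.find hex - 1, ?_⟩
      have : Nat.find hex ≠ 0 := fun h0 => by
        have := Nat.find_spec hex
        rw [h0, hv0] at this
        exact this rfl
      omega
    refine ⟨N, hN ▸ Nat.find_spec hex, fun k hk => ?_⟩
    have := Nat.find_min hex (m := k) (by omega)
    push Not at this
    exact this
  have hN1 : 1 ≤ N := by
    by_contra! h0
    obtain rfl : N = 0 := by omega
    apply hN
    have h1 : v (0 + 1) = w * cs.simple j := by simp [hv1, hv0, l]
    have h2 := cs.length_mul_simple w j
    rw [h1]
    omega
  have hvpow : ∀ k, v (2 * k) = w * (cs.simple j * cs.simple i) ^ k := by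
    intro k
    induction k with
    | zero => simp [hv0]
    | succ k ihk =>
      have e1 : l (2 * k) = j := by simp [l]
      have e2 : l (2 * k + 1) = i := by simp [l]
      rw [show 2 * (k + 1) = 2 * k + 1 + 1 by ring, hv1, hv1, ihk, e1, e2, pow_succ]
      simp only [mul_assoc]
  -- If m letters could be stripped, the braid relation would rewrite that end of w so that it ends
  -- in i, and multiplication by the reflection i would shorten w.
  have hNm : N < m := by
    by_contra! hle
    have h1 := hlt m hle
    have h2 : m = 2 * m' := by omega
    have h3 : (cs.simple j * cs.simple i) ^ m' = (cs.simple i * cs.simple j) ^ m' := by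
      have h4 : (cs.simple i * cs.simple j) ^ m' * (cs.simple i * cs.simple j) ^ m' = 1 := by
        rw [← pow_add, ← hm']
        exact cs.simple_mul_simple_pow i j
      have h5 : cs.simple j * cs.simple i = (cs.simple i * cs.simple j)⁻¹ := by
        rw [mul_inv_rev, cs.inv_simple, cs.inv_simple]
      rw [h5, inv_pow]
      exact inv_eq_of_mul_eq_one_left h4
    obtain ⟨k, rfl⟩ : ∃ k, m' = k + 1 := ⟨m' - 1, by omega⟩
    have h6 : w * cs.simple i = v m * ((cs.simple i * cs.simple j) ^ k)⁻¹ * cs.simple j := by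
      rw [h2, hvpow, h3, pow_succ']
      have : w * (cs.simple i * cs.simple j * (cs.simple i * cs.simple j) ^ k) *
          ((cs.simple i * cs.simple j) ^ k)⁻¹ * cs.simple j =
          w * cs.simple i * (cs.simple j * cs.simple j) := by group
      rw [this, cs.simple_mul_simple_self, mul_one]
    have h7 := cs.length_mul_le (v m * ((cs.simple i * cs.simple j) ^ k)⁻¹) (cs.simple j)
    have h8 := cs.length_mul_le (v m) ((cs.simple i * cs.simple j) ^ k)⁻¹
    have h9 := length_mul_pow_le cs i j k
    rw [cs.length_inv] at h8
    rw [← h6, cs.length_simple] at h7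
    omega
  -- the two simple roots are not inverted by `v N`
  have hpos : ∀ k, k = N ∨ k = N + 1 → 0 ≤ traceForm x.1 (triangleRep g (v N) (mirror g (l k))) := by
    intro k hk
    have hlN := hlt N le_rfl
    refine ih _ (by omega) (v N) (l k) ?_ rfl
    -- The letter `l N` does not shorten `v N`, by the choice of N; the letter `l (N + 1) = l (N -
    -- 1)` is the one removed last, so putting it back lengthens `v N`.
    rcases hk with rfl | rfl
    · have h1 := cs.length_mul_simple (v k) (l k)
      rw [hv1] at hN
      omega
    · obtain ⟨M, rfl⟩ : ∃ M, N = M + 1 := ⟨N - 1, by omega⟩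
      have h1 := hlt M (by omega)
      rw [hl2 M, hv1, mul_assoc, cs.simple_mul_simple_self, mul_one, ← hv1]
      omega
  set φ := Real.pi / m with hφ
  have hm0 : (0 : ℝ) < m := by exact_mod_cast (by omega : 0 < m)
  have hmφ : m * φ = Real.pi := mul_div_cancel₀ _ hm0.ne'
  have hφ0 : 0 < φ := div_pos Real.pi_pos hm0
  have hsin : ∀ k : ℕ, k ≤ m → 0 ≤ Real.sin (k * φ) := fun k hk => by
    refine Real.sin_nonneg_of_nonneg_of_le_pi (by positivity) ?_
    rw [← hmφ]
    gcongr
  have hsin1 : 0 < Real.sin φ := by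
    refine Real.sin_pos_of_pos_of_lt_pi hφ0 ?_
    rw [hφ, div_lt_iff₀ hm0]
    have : (2 : ℝ) ≤ m := by exact_mod_cast hm2
    nlinarith [Real.pi_pos]
  -- Roots in the dihedral subgroup of order 2m: the coefficients are sines of multiples of π / m,
  -- nonnegative up to k = N because N < m.
  have hroot : ∀ k : ℕ, Real.sin φ • triangleRep g w (mirror g i) =
      Real.sin ((k + 1) * φ) • triangleRep g (v k) (mirror g (l (k + 1))) +
        Real.sin (k * φ) • triangleRep g (v k) (mirror g (l k)) := by
    intro k
    induction k with
    | zero =>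
      have e1 : l (0 + 1) = i := by simp [l]
      rw [e1, hv0]
      simp
    | succ k ihk =>
      have e1 : v k = v (k + 1) * cs.simple (l k) := by
        rw [hv1, mul_assoc, cs.simple_mul_simple_self, mul_one]
      have h2 : Real.sin ((k + 1 + 1) * φ) =
          2 * Real.cos φ * Real.sin ((k + 1) * φ) - Real.sin (k * φ) := by
        have e1 : ((k : ℝ) + 1 + 1) * φ = (k + 1) * φ + φ := by ring
        have e2 : (k : ℝ) * φ = (k + 1) * φ - φ := by ring
        rw [e1, e2, Real.sin_add, Real.sin_sub]
        ring
      rw [ihk, e1, triangleRep_mirror_self, triangleRep_mirror g (hl1 k), hlm, ← hφ, hl2]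
      push_cast
      rw [h2]
      module
  have h1 := congrArg (traceForm x.1) (hroot N)
  rw [traceForm_add_right, traceForm_smul_right, traceForm_smul_right, traceForm_smul_right] at h1
  have h2 := mul_nonneg (hsin (N + 1) hNm) (hpos (N + 1) (Or.inr rfl))
  have h3 := mul_nonneg (hsin N hNm.le) (hpos N (Or.inl rfl))
  push_cast at h2
  exact nonneg_of_mul_nonneg_right (a := Real.sin φ) (by linarith) hsin1

/-- Every nontrivial element of the triangle group moves the chamber to the other side of a
mirror of the chamber. -/
theorem exists_descent {w : TriangleGroup g} (hw : w ≠ 1) : ∃ i,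
    (triangleSystem g).length (w * (triangleSystem g).simple i) < (triangleSystem g).length w ∧
    ∀ x ∈ chamber g, traceForm x.1 (triangleRep g w (mirror g i)) ≤ 0 := by
  obtain ⟨i, hi⟩ := (triangleSystem g).exists_rightDescent_of_ne_one hw
  refine ⟨i, hi, fun x hx => ?_⟩
  have h1 := traceForm_nonneg_of_length_lt g (w * (triangleSystem g).simple i) i (by
    rw [mul_assoc, CoxeterSystem.simple_mul_simple_self, mul_one]
    exact hi) hx
  rw [triangleRep_mirror_self, traceForm_neg_right] at h1
  linarith

/-- Equivalent points of the chamber are equal, and the stabilizers of the points of the chamber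
are generated by the reflections that they contain. -/
theorem smul_eq_of_mem_chamber (w : TriangleGroup g) {x : HypPlane} (hx : x ∈ chamber g)
    (hwx : w • x ∈ chamber g) : w • x = x ∧ w ∈ Subgroup.closure
      {s | ∃ i, s = (triangleSystem g).simple i ∧ traceForm x.1 (mirror g i) = 0} := by
  induction hn : (triangleSystem g).length w using Nat.strong_induction_on generalizing w with
  | _ n ih =>
  rcases eq_or_ne w 1 with rfl | hw
  · exact ⟨one_smul _ x, Subgroup.one_mem _⟩
  obtain ⟨i, hi, hle⟩ := exists_descent g hw
  have h1 := hle _ hwx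
  rw [smul_val, traceForm_triangleRep] at h1
  have h2 : traceForm x.1 (mirror g i) = 0 := le_antisymm h1 (hx i)
  have h3 : (triangleSystem g).simple i • x = x := (simple_smul_eq_self_iff g i x).2 h2
  have h4 : (w * (triangleSystem g).simple i) • x = w • x := by rw [mul_smul, h3]
  obtain ⟨h5, h6⟩ := ih _ (by omega) (w * (triangleSystem g).simple i) (by rwa [h4]) rfl
  refine ⟨by rwa [h4] at h5, ?_⟩
  have h7 := Subgroup.mul_mem _ h6 (Subgroup.subset_closure ⟨i, rfl, h2⟩)
  rwa [mul_assoc, CoxeterSystem.simple_mul_simple_self, mul_one] at h7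

/-- The three mirrors have no common point, so the stabilizer of a point of the chamber lies in the
subgroup generated by two of the reflections. -/
theorem exists_traceForm_ne_zero (x : HypPlane) : ∃ i, traceForm x.1 (mirror g i) ≠ 0 := by
  by_contra! h
  have h0 := h 0
  have h1 := h 1
  have h2 := h 2
  rw [traceForm_mirror_zero] at h0
  rw [traceForm_mirror_one, h0, zero_mul, sub_zero] at h1
  have h3 := (mul_eq_zero.1 h1).resolve_right (sin_halfAngle_pos g).ne'
  rw [traceForm_mirror_two, h3, zero_mul, sub_zero] at h2
  have := HypPlane.one_le_coshDist x HypPlane.base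
  exact absurd h2 (mul_pos (by unfold HypPlane.height; linarith) (apothemSinh_pos g)).ne'

/-- The chamber is bounded. The farthest point is the vertex of the polygon; the right triangle has
two equal angles, hence two equal legs, and the hyperbolic Pythagorean theorem gives the square. -/
theorem height_le_of_mem_chamber {x : HypPlane} (hx : x ∈ chamber g) :
    x.height ≤ apothemCosh g ^ 2 := by
  have h0 := hx 0
  have h1 := hx 1
  have h2 := hx 2
  rw [traceForm_mirror_zero] at h0
  rw [traceForm_mirror_one] at h1
  rw [traceForm_mirror_two] at h2
  have hsq := height_sq x
  have hs := sin_halfAngle_pos g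
  have hc := one_lt_apothemCosh g
  have hsh := apothemSinh_sq g
  have hsh0 := apothemSinh_pos g
  have hcs : Real.cos (halfAngle g) = apothemCosh g * Real.sin (halfAngle g) := by
    rw [apothemCosh, div_mul_cancel₀ _ hs.ne']
  set p := x.height
  set q := (x.1 0 1 + x.1 1 0) / 2
  set r := x.1 0 0
  set c := apothemCosh g
  set s := apothemSinh g
  have hp : 0 < p := zero_lt_one.trans_le (HypPlane.one_le_coshDist x HypPlane.base)
  rw [hcs] at h1
  have h3 : r * c ≤ q := by
    have : 0 ≤ (q - r * c) * Real.sin (halfAngle g) := by linarith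
    have := nonneg_of_mul_nonneg_left this hs
    linarith
  have hq : 0 ≤ q := (mul_nonneg h0 (by linarith)).trans h3
  have h4 : (r * c) ^ 2 ≤ q ^ 2 := pow_le_pow_left₀ (mul_nonneg h0 (by linarith)) h3 2
  have h5 : (q * c) ^ 2 ≤ (p * s) ^ 2 :=
    pow_le_pow_left₀ (mul_nonneg hq (by linarith)) (by linarith) 2
  have h6 : p ^ 2 ≤ (c ^ 2) ^ 2 := by
    have h7 : c ^ 4 * p ^ 2 = c ^ 4 + c ^ 2 * (q * c) ^ 2 + c ^ 2 * (r * c) ^ 2 := by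
      rw [hsq]; ring
    have h8 : c ^ 2 * (q * c) ^ 2 ≤ c ^ 2 * (p * s) ^ 2 := by gcongr
    have h9 : c ^ 2 * (r * c) ^ 2 ≤ c ^ 2 * q ^ 2 := by gcongr
    have h10 : c ^ 2 * (p * s) ^ 2 = c ^ 2 * p ^ 2 * (c ^ 2 - 1) := by rw [← hsh]; ring
    have h11 : (p * s) ^ 2 = p ^ 2 * (c ^ 2 - 1) := by rw [← hsh]; ring
    rw [h11] at h5
    nlinarith
  exact le_of_sq_le_sq h6 (by positivity)

/-- A point in the interior of the chamber. -/
theorem exists_interior_point : ∃ x : HypPlane, ∀ i, 0 < traceForm x.1 (mirror g i) := by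
  have hs := sin_halfAngle_pos g
  have hc := one_lt_apothemCosh g
  have hsh0 := apothemSinh_pos g
  have hcs : Real.cos (halfAngle g) = apothemCosh g * Real.sin (halfAngle g) := by
    rw [apothemCosh, div_mul_cancel₀ _ hs.ne']
  set c := apothemCosh g with hcdef
  set s := apothemSinh g with hsdef
  set r := s / (4 * c ^ 2) with hr
  have hr0 : 0 < r := by positivity
  set q := 2 * c * r with hq
  have hq0 : 0 < q := by positivity
  have hqc : q * c = s / 2 := by
    rw [hq, hr]
    field_simp
    ring
  set p := √(1 + q ^ 2 + r ^ 2) with hp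
  have hp2 : p ^ 2 = 1 + q ^ 2 + r ^ 2 := Real.sq_sqrt (by positivity)
  have hp1 : 1 ≤ p := Real.one_le_sqrt.2 (by nlinarith)
  obtain ⟨x, hx⟩ : ∃ x : HypPlane, x.1 = !![r, q - p; q + p, -r] := by
    refine ⟨⟨!![r, q - p; q + p, -r], ?_, ?_, by change 0 < q + p; linarith⟩, rfl⟩
    · rw [Matrix.trace_fin_two_of]
      ring
    · rw [Matrix.det_fin_two_of]
      linear_combination hp2
  have hq' : (x.1 0 1 + x.1 1 0) / 2 = q := by rw [hx]; simp
  have hr' : x.1 0 0 = r := by rw [hx]; simp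
  have hp' : x.height = p := by rw [HypPlane.height_eq, hx]; simp
  refine ⟨x, fun i => ?_⟩
  fin_cases i
  · change 0 < traceForm x.1 (mirror g 0)
    rw [traceForm_mirror_zero, hr']
    exact hr0
  · change 0 < traceForm x.1 (mirror g 1)
    rw [traceForm_mirror_one, hq', hr', hcs]
    have : q * Real.sin (halfAngle g) - r * (c * Real.sin (halfAngle g)) =
      c * r * Real.sin (halfAngle g) := by rw [hq]; ring
    rw [this]
    positivity
  · change 0 < traceForm x.1 (mirror g 2)
    rw [traceForm_mirror_two, hq', hp', ← hcdef, ← hsdef, hqc]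
    nlinarith

/-- Every nontrivial element moves x behind some mirror, so the orbit of an interior point is
uniformly separated. A compact ball is covered by finitely many sets too small to contain two orbit
points. -/
theorem finite_setOf_coshDist_le (x : HypPlane) (hx : ∀ i, 0 < traceForm x.1 (mirror g i)) (C : ℝ) :
    {w : TriangleGroup g | (w • x).coshDist x ≤ C}.Finite := by
  have hxc : x ∈ chamber g := fun i => (hx i).le
  obtain ⟨δ, hδ, hδx⟩ : ∃ δ, 0 < δ ∧ ∀ i, δ ≤ traceForm x.1 (mirror g i) := by
    obtain ⟨i, hi⟩ := Finite.exists_min fun i => traceForm x.1 (mirror g i)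
    exact ⟨_, hx i, hi⟩
  have hsep : ∀ w : TriangleGroup g, w ≠ 1 → 1 + δ ^ 2 ≤ (x.coshDist (w • x)) ^ 2 := by
    intro w hw
    obtain ⟨i, -, hi⟩ := exists_descent g (inv_ne_one.2 hw)
    have h1 := hi x hxc
    rw [← traceForm_triangleRep g w, ← Module.End.mul_apply, ← map_mul, mul_inv_cancel, map_one,
      Module.End.one_apply, ← smul_val] at h1
    refine le_trans ?_ (HypPlane.one_add_sq_le x (w • x) (mirror_trace g i)
      (traceForm_mirror_self g i) (hx i).le h1)
    have := pow_le_pow_left₀ hδ.le (hδx i) 2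
    linarith
  have hloc : ∀ y : HypPlane, ∃ U ∈ 𝓝 y, ∀ a ∈ U, ∀ b ∈ U, (a.coshDist b) ^ 2 < 1 + δ ^ 2 := by
    intro y
    have hc : Continuous fun p : HypPlane × HypPlane => (p.1.coshDist p.2) ^ 2 :=
      HypPlane.continuous_coshDist.pow 2
    have h1 : (fun p : HypPlane × HypPlane => (p.1.coshDist p.2) ^ 2) ⁻¹' Set.Iio (1 + δ ^ 2) ∈
        𝓝 (y, y) := by
      refine hc.continuousAt.preimage_mem_nhds (Iio_mem_nhds ?_)
      rw [HypPlane.coshDist_self]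
      nlinarith
    obtain ⟨U, hU, V, hV, h2⟩ := mem_nhds_prod_iff.1 h1
    refine ⟨U ∩ V, Filter.inter_mem hU hV, fun a ha b hb => ?_⟩
    have h3 := h2 (Set.mk_mem_prod ha.1 hb.2)
    rw [Set.mem_preimage, Set.mem_Iio] at h3
    exact h3
  choose U hU hU' using hloc
  obtain ⟨t, -, ht⟩ := (HypPlane.isCompact_coshDist_le x C).elim_nhds_subcover U fun y _ => hU y
  have hfin : (⋃ y ∈ t, {w : TriangleGroup g | w • x ∈ U y}).Finite := by
    refine t.finite_toSet.biUnion fun y _ => Set.Subsingleton.finite fun v hv w hw => ?_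
    by_contra hne
    have h1 := hsep (v⁻¹ * w) (fun h => hne (inv_mul_eq_one.1 h))
    rw [← coshDist_smul g v, mul_smul, smul_inv_smul] at h1
    exact absurd (hU' y _ hv _ hw) (not_lt.2 h1)
  refine hfin.subset fun w hw => ?_
  have := ht hw
  simpa using this

instance : ProperlyDiscontinuousSMul (TriangleGroup g) HypPlane where
  finite_disjoint_inter_image {K L} hK hL := by
    obtain ⟨x, hx⟩ := exists_interior_point g
    have hc : Continuous fun y : HypPlane => x.coshDist y :=
      HypPlane.continuous_coshDist.comp (continuous_const.prodMk continuous_id)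
    obtain ⟨a, ha⟩ := (hK.image hc).bddAbove
    obtain ⟨b, hb⟩ := (hL.image hc).bddAbove
    refine (finite_setOf_coshDist_le g x hx (2 * (a * b))).subset ?_
    rintro w ⟨_, ⟨k, hk, rfl⟩, hl⟩
    have h1 := HypPlane.coshDist_le (w • x) (w • k) x
    rw [coshDist_smul, HypPlane.coshDist_comm (w • k)] at h1
    have h2 : x.coshDist k ≤ a := ha ⟨k, hk, rfl⟩
    have h3 : x.coshDist (w • k) ≤ b := hb ⟨_, hl, rfl⟩
    have h4 := x.one_le_coshDist k
    have h5 := x.one_le_coshDist (w • k)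
    refine h1.trans ?_
    have : x.coshDist k * x.coshDist (w • k) ≤ a * b :=
      mul_le_mul h2 h3 (by linarith) (by linarith)
    linarith

/-- The chamber meets every orbit. -/
theorem exists_smul_mem_chamber (x : HypPlane) : ∃ w : TriangleGroup g, w • x ∈ chamber g := by
  obtain ⟨z, hz⟩ := exists_interior_point g
  have hfin : {w : TriangleGroup g | (w • x).coshDist z ≤ x.coshDist z}.Finite := by
    have := ProperlyDiscontinuousSMul.finite_disjoint_inter_image (Γ := TriangleGroup g)
      (isCompact_singleton (x := x)) (HypPlane.isCompact_coshDist_le z (x.coshDist z))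
    refine this.subset fun w hw => ⟨w • x, ⟨x, rfl, rfl⟩, hw⟩
  -- A point of the orbit nearest to the interior point z. If a mirror separated it from z,
  -- reflecting in that mirror would bring it nearer.
  obtain ⟨w, hw, hmin⟩ := Set.exists_min_image _ (fun w : TriangleGroup g => (w • x).coshDist z)
    hfin ⟨1, by simp⟩
  refine ⟨w, fun i => ?_⟩
  have h1 : (w • x).coshDist z ≤ ((triangleSystem g).simple i • w • x).coshDist z := by
    by_cases h : ((triangleSystem g).simple i * w) ∈
        {w : TriangleGroup g | (w • x).coshDist z ≤ x.coshDist z}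
    · have := hmin _ h
      simpa only [mul_smul] using this
    · have h2 : (w • x).coshDist z ≤ x.coshDist z := hw
      simp only [Set.mem_ofPred_eq, not_le, mul_smul] at h
      exact h2.trans h.le
  rw [HypPlane.coshDist_comm _ z, HypPlane.coshDist_comm _ z, HypPlane.coshDist, HypPlane.coshDist,
    simple_smul_val, traceForm_add_right, traceForm_smul_right] at h1
  have h2 := hz i
  by_contra! hneg
  nlinarith

end Chamber

/-! ### Flags of the surface and voltages -/

section Flags

/-- The flags of the surface: the handle, the side of the `4g`-gon within the handle, and the half
of that side. -/
abbrev PolygonFlag (g : ℕ) : Type := ZMod g × Fin 4 × Bool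

/-- The flag on the other side of the `i`-th side of a triangle. -/
def flagStep (g : ℕ) : Fin 3 → PolygonFlag g → PolygonFlag g
  | 0, (k, r, b) => (k, r, !b)
  | 1, (k, r, true) => if r = 3 then (k + 1, 0, false) else (k, r + 1, false)
  | 1, (k, r, false) => if r = 0 then (k - 1, 3, true) else (k, r - 1, true)
  | 2, (k, r, b) => (k, r + 2, !b)

/-- Data for a representation of the surface group: images `R` of the reflections, whose products
have the correct orders up to a central involution `z`, and elements `c` attached to the sides. -/
structure VoltageData (g : ℕ) (H : Type*) [Group H] where
  /-- the images of the reflections -/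
  R : Fin 3 → H
  /-- a central involution -/
  z : H
  /-- the elements attached to the sides -/
  c : ZMod g → Fin 4 → H
  z_central : ∀ h, Commute z h
  z_mul_z : z * z = 1
  R_mul_R : ∀ i, R i * R i = 1
  R_pow : ∀ i j, i ≠ j → (R i * R j) ^ triangleMatrix g i j = z
  c_comm : ∀ k r i, Commute (c k r) (R i)
  c_inv : ∀ k r, c k r * c k (r + 2) = 1
  c_handle : ∀ k, c k 3 * c k 0 * c k 1 * c k 2 = 1

namespace VoltageData

variable {g : ℕ} {H : Type*} [Group H] (V : VoltageData g H)

/-- The voltage of the `i`-th side of a flag. -/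
def volt : Fin 3 → PolygonFlag g → H
  | 0, _ => V.R 0
  -- The factors z compensate the relations that hold in H only up to z. A full turn around the
  -- centre or around the vertex meets the marked edge before handle 0 once, and among the crossings
  -- of sides the signs are even in number around the vertex and odd around the midpoint of a side.
  | 1, (k, r, b) => (if (k = 0 ∧ r = 0 ∧ b = false) ∨ (k + 1 = 0 ∧ r = 3 ∧ b = true) then V.z else 1) *
      V.R 1
  | 2, (k, r, b) => V.c k r * (if (r < 2 ↔ b = false) then V.z else 1) * V.R 2

/-- The permutation of the flags with values in `H` that crosses the `i`-th side. -/
def step (i : Fin 3) (p : PolygonFlag g × H) : PolygonFlag g × H := (flagStep g i p.1, p.2 * V.volt i p.1)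

theorem z_mul_z_mul (h : H) : V.z * (V.z * h) = h := by rw [← mul_assoc, V.z_mul_z, one_mul]

theorem mul_z (h : H) : h * V.z = V.z * h := (V.z_central h).eq.symm

theorem mul_z_mul (h k : H) : h * (V.z * k) = V.z * (h * k) := by
  rw [← mul_assoc, V.mul_z, mul_assoc]

theorem R_mul_c (k : ZMod g) (r : Fin 4) (i : Fin 3) : V.R i * V.c k r = V.c k r * V.R i :=
  (V.c_comm k r i).eq.symm

theorem R_mul_c_mul (k : ZMod g) (r : Fin 4) (i : Fin 3) (h : H) :
    V.R i * (V.c k r * h) = V.c k r * (V.R i * h) := by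
  rw [← mul_assoc, V.R_mul_c, mul_assoc]

theorem step_involutive (i : Fin 3) : Function.Involutive (V.step i) := by
  rintro ⟨⟨k, r, b⟩, h⟩
  have hc0 : ∀ k, V.c k 2 * V.c k 0 = 1 := fun k => V.c_inv k 2
  have hc1 : ∀ k, V.c k 3 * V.c k 1 = 1 := fun k => V.c_inv k 3
  have hc2 : ∀ k, V.c k 0 * V.c k 2 = 1 := fun k => V.c_inv k 0
  have hc3 : ∀ k, V.c k 1 * V.c k 3 = 1 := fun k => V.c_inv k 1
  fin_cases i
  · simp [step, flagStep, volt, mul_assoc, V.R_mul_R]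
  · cases b <;> fin_cases r <;> simp [step, flagStep, volt, mul_assoc, V.R_mul_R]
    all_goals split_ifs <;> simp_all [V.R_mul_R, V.mul_z, V.mul_z_mul, V.z_mul_z_mul]
  · cases b <;> fin_cases r <;>
      simp [step, flagStep, volt, mul_assoc, V.R_mul_R, V.R_mul_c_mul, V.mul_z, V.mul_z_mul,
        V.z_mul_z_mul, hc0, hc1, hc2, hc3]

/-- The permutation of the flags with values in `H` that crosses the `i`-th side. -/
def stepPerm (i : Fin 3) : Equiv.Perm (PolygonFlag g × H) := (V.step_involutive i).toPerm

theorem stepPerm_apply (i : Fin 3) (p : PolygonFlag g × H) : V.stepPerm i p = V.step i p := rfl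

theorem stepPerm_mul_self (i : Fin 3) : V.stepPerm i * V.stepPerm i = 1 :=
  Equiv.ext (V.step_involutive i)

theorem step_bool (i : Fin 3) (p : PolygonFlag g × H) : (V.step i p).1.2.2 = !p.1.2.2 := by
  obtain ⟨⟨k, r, b⟩, h⟩ := p
  fin_cases i
  · rfl
  · cases b <;> simp only [step, flagStep] <;> split_ifs <;> rfl
  · rfl

theorem stepPerm_inv (i j : Fin 3) :
    (V.stepPerm i * V.stepPerm j)⁻¹ = V.stepPerm j * V.stepPerm i := by
  rw [inv_eq_iff_mul_eq_one]
  calc V.stepPerm i * V.stepPerm j * (V.stepPerm j * V.stepPerm i)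
      = V.stepPerm i * (V.stepPerm j * V.stepPerm j) * V.stepPerm i := by simp only [mul_assoc]
    _ = 1 := by rw [V.stepPerm_mul_self, mul_one, V.stepPerm_mul_self]

/-- A power of a rotation is trivial if it is trivial on the flags of one orientation. -/
theorem pow_eq_one_of_forall_true {i j : Fin 3} {n : ℕ}
    (h : ∀ k r x, ((V.stepPerm i * V.stepPerm j) ^ n) ((k, r, true), x) = ((k, r, true), x)) :
    (V.stepPerm i * V.stepPerm j) ^ n = 1 := by
  ext1 p
  rw [Equiv.Perm.one_apply]
  obtain ⟨⟨k, r, b⟩, x⟩ := p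
  cases b with
  | true => exact h k r x
  | false =>
    obtain ⟨k', r', x', hp⟩ : ∃ k' r' x', V.stepPerm j ((k, r, false), x) = ((k', r', true), x') := by
      have := V.step_bool j ((k, r, false), x)
      obtain ⟨⟨⟨k', r', b'⟩, x'⟩, hq⟩ : ∃ q, V.step j ((k, r, false), x) = q := ⟨_, rfl⟩
      rw [hq] at this
      obtain rfl : b' = true := this
      exact ⟨k', r', x', hq⟩
    -- Crossing side j changes the orientation of the flag and inverts the rotation.
    have h1 : V.stepPerm j * (V.stepPerm i * V.stepPerm j) ^ n * V.stepPerm j =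
        ((V.stepPerm i * V.stepPerm j) ^ n)⁻¹ := by
      have hj : V.stepPerm j = (V.stepPerm j)⁻¹ := eq_inv_of_mul_eq_one_left (V.stepPerm_mul_self j)
      have h2 : V.stepPerm j * (V.stepPerm i * V.stepPerm j) * (V.stepPerm j)⁻¹ =
          (V.stepPerm i * V.stepPerm j)⁻¹ := by
        rw [V.stepPerm_inv]
        group
      calc V.stepPerm j * (V.stepPerm i * V.stepPerm j) ^ n * V.stepPerm j
          = V.stepPerm j * (V.stepPerm i * V.stepPerm j) ^ n * (V.stepPerm j)⁻¹ := by rw [← hj]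
        _ = _ := by rw [← conj_pow, h2, inv_pow]
    have h3 : V.stepPerm j (((V.stepPerm i * V.stepPerm j) ^ n) (V.stepPerm j ((k, r, false), x))) =
        ((V.stepPerm i * V.stepPerm j) ^ n)⁻¹ ((k, r, false), x) := by
      rw [← h1]
      rfl
    rw [hp, h k' r' x', ← hp] at h3
    have h4 : V.stepPerm j (V.stepPerm j ((k, r, false), x)) = ((k, r, false), x) :=
      V.step_involutive j _
    rw [h4] at h3
    exact (Equiv.Perm.eq_inv_iff_eq.1 h3)

/-- Once around a vertex or around the centre, starting from the last side of a handle. -/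
theorem iterate_eq_of_four [NeZero g] {Q : Equiv.Perm (PolygonFlag g × H)} {u : H}
    (hQ : ∀ k x, (Q ^ 4) ((k, 3, true), x) =
      ((k - 1, 3, true), x * ((if k = 0 then V.z else 1) * u))) (hu : u ^ g = V.z) (k : ZMod g)
    (x : H) : (Q ^ (4 * g)) ((k, 3, true), x) = ((k, 3, true), x) := by
  have key : ∀ n : ℕ, ((Q ^ 4) ^ n) ((k, 3, true), x) = ((k - n, 3, true),
      x * (V.z ^ (∑ i ∈ Finset.range n, if k = (i : ZMod g) then 1 else 0) * u ^ n)) := by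
    intro n
    induction n with
    | zero => simp
    | succ n ih =>
      rw [pow_succ', Equiv.Perm.mul_apply, ih, hQ, Finset.sum_range_succ, pow_succ u,
        pow_add]
      have h1 : (if k - (n : ZMod g) = 0 then V.z else 1) =
          V.z ^ (if k = (n : ZMod g) then 1 else 0) := by
        simp only [sub_eq_zero]
        split_ifs <;> simp
      rw [h1]
      refine Prod.ext (Prod.ext ?_ rfl) ?_
      · change k - n - 1 = k - ((n + 1 : ℕ) : ZMod g)
        push_cast
        ring
      · have h2 := (V.z_central (u ^ n)).pow_left (if k = (n : ZMod g) then 1 else 0)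
        simp only [mul_assoc]
        rw [← mul_assoc (u ^ n), ← h2.eq]
        simp only [mul_assoc]
  -- A full turn passes handle 0 exactly once, so it collects one z, which cancels u ^ g = z.
  have hsum : (∑ i ∈ Finset.range g, if k = (i : ZMod g) then 1 else 0) = 1 := by
    rw [Finset.sum_eq_single k.val]
    · simp
    · intro i hi hne
      rw [if_neg]
      rintro rfl
      exact hne (ZMod.val_cast_of_lt (Finset.mem_range.1 hi)).symm
    · intro h
      exact absurd (Finset.mem_range.2 (ZMod.val_lt k)) h
  rw [pow_mul, key, hsum, hu, pow_one, V.z_mul_z, mul_one]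
  simp

theorem stepPerm_one_zero (k : ZMod g) (r : Fin 4) (x : H) :
    (V.stepPerm 1 * V.stepPerm 0) ((k, r, true), x) =
      ((if r = 0 then k - 1 else k, r - 1, true),
        x * ((if k = 0 ∧ r = 0 then V.z else 1) * (V.R 0 * V.R 1))) := by
  rw [Equiv.Perm.mul_apply, stepPerm_apply, stepPerm_apply]
  fin_cases r <;> simp [step, flagStep, volt, mul_assoc, V.mul_z_mul]
  rfl

theorem stepPerm_one_two (k : ZMod g) (r : Fin 4) (x : H) :
    (V.stepPerm 1 * V.stepPerm 2) ((k, r, true), x) =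
      ((if r = 2 then k - 1 else k, r + 1, true),
        x * (V.c k r * ((if r < 2 then 1 else V.z) * ((if k = 0 ∧ r = 2 then V.z else 1) *
          (V.R 2 * V.R 1))))) := by
  rw [Equiv.Perm.mul_apply, stepPerm_apply, stepPerm_apply]
  fin_cases r <;> simp [step, flagStep, volt, mul_assoc, V.mul_z_mul]

theorem R_pow_four_mul {i j : Fin 3} (hij : i ≠ j) (h : triangleMatrix g i j = 4 * g) :
    ((V.R i * V.R j) ^ 4) ^ g = V.z := by
  rw [← pow_mul, ← h, V.R_pow i j hij]

/-- Q commutes with its powers, so triviality of the power passes from f to the next flag of the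
rotation. -/
theorem pow_apply_of_forall {α : Type*} {Q : Equiv.Perm (α × H)} {n : ℕ} {f f' : α} {v : H}
    (hQ : ∀ x, Q (f, x) = (f', x * v)) (hf : ∀ x, (Q ^ n) (f, x) = (f, x)) (x : H) :
    (Q ^ n) (f', x) = (f', x) := by
  have h1 : Q (f, x * v⁻¹) = (f', x) := by rw [hQ, inv_mul_cancel_right]
  rw [← h1, ← Equiv.Perm.mul_apply, ← pow_succ, pow_succ', Equiv.Perm.mul_apply, hf]

theorem stepPerm_one_zero_pow [NeZero g] :
    (V.stepPerm 1 * V.stepPerm 0) ^ (4 * g) = 1 := by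
  have h3 := V.iterate_eq_of_four (Q := V.stepPerm 1 * V.stepPerm 0) (u := (V.R 0 * V.R 1) ^ 4)
    (fun k x => by
      simp only [pow_succ, pow_zero, one_mul, Equiv.Perm.mul_apply (V.stepPerm 1 * V.stepPerm 0),
        Equiv.Perm.mul_apply (_ * _) (V.stepPerm 1 * V.stepPerm 0), V.stepPerm_one_zero]
      simp [mul_assoc, V.mul_z_mul]
      rfl) (V.R_pow_four_mul (by decide) rfl)
  have h2 := fun k => pow_apply_of_forall (fun x => V.stepPerm_one_zero k 3 x) (h3 k)
  have h1 := fun k => pow_apply_of_forall (fun x => V.stepPerm_one_zero k 2 x) (h2 k)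
  have h0 := fun k => pow_apply_of_forall (fun x => V.stepPerm_one_zero k 1 x) (h1 k)
  refine V.pow_eq_one_of_forall_true fun k r x => ?_
  fin_cases r
  exacts [h0 k x, h1 k x, h2 k x, h3 k x]

theorem stepPerm_one_two_pow [NeZero g] :
    (V.stepPerm 1 * V.stepPerm 2) ^ (4 * g) = 1 := by
  have h3 := V.iterate_eq_of_four (Q := V.stepPerm 1 * V.stepPerm 2) (u := (V.R 2 * V.R 1) ^ 4)
    (fun k x => by
      have hc : ∀ h, V.c k 3 * (V.c k 0 * (V.c k 1 * (V.c k 2 * h))) = h := fun h => by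
        simp only [← mul_assoc, V.c_handle, one_mul]
      simp only [pow_succ, pow_zero, one_mul, Equiv.Perm.mul_apply (V.stepPerm 1 * V.stepPerm 2),
        Equiv.Perm.mul_apply (_ * _) (V.stepPerm 1 * V.stepPerm 2), V.stepPerm_one_two]
      simp [mul_assoc, V.mul_z_mul, V.R_mul_c_mul, V.z_mul_z_mul, hc])
    (V.R_pow_four_mul (by decide) rfl)
  have h0 := fun k => pow_apply_of_forall (fun x => V.stepPerm_one_two k 3 x) (h3 k)
  have h1 := fun k => pow_apply_of_forall (fun x => V.stepPerm_one_two k 0 x) (h0 k)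
  have h2 := fun k => pow_apply_of_forall (fun x => V.stepPerm_one_two k 1 x) (h1 k)
  refine V.pow_eq_one_of_forall_true fun k r x => ?_
  fin_cases r
  exacts [h0 k x, h1 k x, h2 k x, h3 k x]

theorem stepPerm_two_zero_pow : (V.stepPerm 2 * V.stepPerm 0) ^ 2 = 1 := by
  have hR : ∀ h, V.R 0 * (V.R 2 * (V.R 0 * (V.R 2 * h))) = V.z * h := fun h => by
    have : (V.R 0 * V.R 2) ^ 2 = V.z := V.R_pow 0 2 (by decide)
    rw [← this, pow_two]
    simp only [mul_assoc]
  have hR' := hR 1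
  rw [mul_one, mul_one] at hR'
  have hc0 : ∀ k, V.c k 2 * V.c k 0 = 1 := fun k => V.c_inv k 2
  have hc1 : ∀ k, V.c k 3 * V.c k 1 = 1 := fun k => V.c_inv k 3
  have hc2 : ∀ k, V.c k 0 * V.c k 2 = 1 := fun k => V.c_inv k 0
  have hc3 : ∀ k, V.c k 1 * V.c k 3 = 1 := fun k => V.c_inv k 1
  ext1 ⟨⟨k, r, b⟩, x⟩
  rw [pow_two, Equiv.Perm.mul_apply, Equiv.Perm.mul_apply, Equiv.Perm.mul_apply,
    Equiv.Perm.one_apply]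
  simp only [stepPerm_apply]
  cases b <;> fin_cases r <;>
    simp [step, flagStep, volt, mul_assoc, V.mul_z_mul, V.R_mul_c_mul, hR', hc0, hc1, hc2, hc3,
      V.mul_z, V.z_mul_z_mul]

theorem isLiftable_stepPerm [NeZero g] : (triangleMatrix g).IsLiftable V.stepPerm := by
  have hinv : ∀ i j n, (V.stepPerm i * V.stepPerm j) ^ n = 1 →
      (V.stepPerm j * V.stepPerm i) ^ n = 1 := fun i j n h => by
    rw [← V.stepPerm_inv, inv_pow, h, inv_one]
  have hself : ∀ i, (V.stepPerm i * V.stepPerm i) ^ 1 = 1 := fun i => by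
    rw [pow_one, V.stepPerm_mul_self]
  intro i j
  fin_cases i <;> fin_cases j
  exacts [hself 0, hinv _ _ _ V.stepPerm_one_zero_pow, hinv _ _ _ V.stepPerm_two_zero_pow,
    V.stepPerm_one_zero_pow, hself 1, V.stepPerm_one_two_pow, V.stepPerm_two_zero_pow,
    hinv _ _ _ V.stepPerm_one_two_pow, hself 2]

/-- The action of the triangle group on flags with values in `H`. -/
noncomputable def perm [NeZero g] : TriangleGroup g →* Equiv.Perm (PolygonFlag g × H) :=
  (triangleSystem g).lift ⟨_, V.isLiftable_stepPerm⟩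

theorem perm_simple [NeZero g] (i : Fin 3) :
    V.perm ((triangleSystem g).simple i) = V.stepPerm i :=
  (triangleSystem g).lift_apply_simple V.isLiftable_stepPerm i

end VoltageData

/-- The trivial voltages. -/
def trivialVoltage (g : ℕ) : VoltageData g Unit where
  R _ := 1
  z := 1
  c _ _ := 1
  z_central _ := rfl
  z_mul_z := rfl
  R_mul_R _ := rfl
  R_pow _ _ _ := rfl
  c_comm _ _ _ := rfl
  c_inv _ _ := rfl
  c_handle _ := rfl

variable {g : ℕ} [NeZero g]

/-- The action of the triangle group on flags. -/
noncomputable instance : MulAction (TriangleGroup g) (PolygonFlag g) where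
  smul w f := ((trivialVoltage g).perm w (f, ())).1
  one_smul f := by
    change ((trivialVoltage g).perm 1 (f, ())).1 = f
    rw [map_one]
    rfl
  mul_smul v w f := by
    change ((trivialVoltage g).perm (v * w) (f, ())).1 = _
    rw [map_mul]
    rfl

theorem simple_smul_flag (i : Fin 3) (f : PolygonFlag g) :
    (triangleSystem g).simple i • f = flagStep g i f := by
  change ((trivialVoltage g).perm _ (f, ())).1 = _
  rw [VoltageData.perm_simple]
  rfl

theorem VoltageData.perm_fst {H : Type*} [Group H] (V : VoltageData g H) (w : TriangleGroup g)
    (p : PolygonFlag g × H) : (V.perm w p).1 = w • p.1 := by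
  induction w using (triangleSystem g).simple_induction_left generalizing p with
  | one => rw [map_one, one_smul]; rfl
  | mul_simple_left w i ih =>
    rw [map_mul, Equiv.Perm.mul_apply, mul_smul, simple_smul_flag, ← ih, perm_simple]
    rfl

/-- The base flag. -/
def baseFlag (g : ℕ) : PolygonFlag g := (0, 0, true)

/-- The surface group, as a subgroup of the triangle group. -/
noncomputable def surfaceSubgroup (g : ℕ) [NeZero g] : Subgroup (TriangleGroup g) :=
  MulAction.stabilizer (TriangleGroup g) (baseFlag g)

theorem mem_surfaceSubgroup {w : TriangleGroup g} :
    w ∈ surfaceSubgroup g ↔ w • baseFlag g = baseFlag g := MulAction.mem_stabilizer_iff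

/-- The flag that is reached on the way from the fundamental triangle to its image under `w`. -/
noncomputable def flagOf (w : TriangleGroup g) : PolygonFlag g := w⁻¹ • baseFlag g

theorem flagOf_one : flagOf (1 : TriangleGroup g) = baseFlag g := by
  rw [flagOf, inv_one, one_smul]

theorem flagOf_mul_simple (w : TriangleGroup g) (i : Fin 3) :
    flagOf (w * (triangleSystem g).simple i) = flagStep g i (flagOf w) := by
  rw [flagOf, mul_inv_rev, mul_smul, CoxeterSystem.inv_simple, simple_smul_flag, flagOf]

theorem flagOf_mul (v w : TriangleGroup g) : flagOf (v * w) = w⁻¹ • flagOf v := by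
  rw [flagOf, mul_inv_rev, mul_smul, flagOf]

theorem mem_surfaceSubgroup_iff {w : TriangleGroup g} :
    w ∈ surfaceSubgroup g ↔ flagOf w = baseFlag g := by
  rw [mem_surfaceSubgroup, flagOf, inv_smul_eq_iff, eq_comm]

theorem mul_inv_mem_of_flagOf_eq {v w : TriangleGroup g} (h : flagOf v = flagOf w) :
    v * w⁻¹ ∈ surfaceSubgroup g := by
  rw [mem_surfaceSubgroup_iff, flagOf_mul, h, flagOf, inv_inv, smul_inv_smul]

theorem flagOf_mul_of_mem {v : TriangleGroup g} (hv : v ∈ surfaceSubgroup g) (w : TriangleGroup g) :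
    flagOf (v * w) = flagOf w := by
  rw [flagOf_mul, mem_surfaceSubgroup_iff.1 hv, flagOf]

namespace VoltageData

variable {H : Type*} [Group H] (V : VoltageData g H)

/-- The product of the voltages on the way from the fundamental triangle to its image. -/
noncomputable def path (w : TriangleGroup g) : H := (V.perm w⁻¹ (baseFlag g, 1)).2

theorem path_one : V.path 1 = 1 := by
  rw [path, inv_one, map_one]
  rfl

theorem path_mul_simple (w : TriangleGroup g) (i : Fin 3) :
    V.path (w * (triangleSystem g).simple i) = V.path w * V.volt i (flagOf w) := by
  rw [path, mul_inv_rev, map_mul, Equiv.Perm.mul_apply, CoxeterSystem.inv_simple, perm_simple]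
  change _ * V.volt i (V.perm w⁻¹ (baseFlag g, 1)).1 = _
  rw [V.perm_fst]
  rfl

/-- An element of the surface group preserves the base flag, so the path from v to vw passes through
the same flags, and collects the same voltages, as the path from 1 to w. -/
theorem path_mul_of_mem {v : TriangleGroup g} (hv : v ∈ surfaceSubgroup g) (w : TriangleGroup g) :
    V.path (v * w) = V.path v * V.path w := by
  induction w using (triangleSystem g).simple_induction_right with
  | one => rw [mul_one, path_one, mul_one]
  | mul_simple_right w i ih =>
    rw [← mul_assoc, path_mul_simple, path_mul_simple, ih, flagOf_mul_of_mem hv, mul_assoc]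

/-- The representation of the surface group given by the voltages. -/
noncomputable def hom : surfaceSubgroup g →* H where
  toFun γ := V.path γ.1
  map_one' := V.path_one
  map_mul' γ δ := V.path_mul_of_mem γ.2 δ.1

theorem hom_apply (γ : surfaceSubgroup g) : V.hom γ = V.path γ.1 := rfl

end VoltageData
end Flags

/-! ### The action of the triangle group on flags -/

section FlagAction

variable {g : ℕ} [NeZero g]

theorem simple_smul_flag_bool (i : Fin 3) (f : PolygonFlag g) :
    ((triangleSystem g).simple i • f).2.2 = !f.2.2 := by
  rw [simple_smul_flag]
  exact (trivialVoltage g).step_bool i (f, ())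

theorem simple_mul_simple_smul_flag (i j : Fin 3) (f : PolygonFlag g) :
    ((triangleSystem g).simple i * (triangleSystem g).simple j) • f =
      (((trivialVoltage g).stepPerm i * (trivialVoltage g).stepPerm j) (f, ())).1 := by
  rw [mul_smul, simple_smul_flag, simple_smul_flag]
  rfl

/-- Each application of Q adds e to the side modulo 4, which forces 4 ∣ n; then Q ^ 4 lowers the
handle by one modulo g. -/
theorem dvd_of_pow_smul_true {Q : TriangleGroup g} {κ : ZMod g → Fin 4 → ZMod g}
    {ρ : Fin 4 → Fin 4} {e : ℕ} (he : ∀ n : ℕ, 4 ∣ e * n → 4 ∣ n)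
    (hρ : ∀ r, (ρ r : ℕ) = (r + e) % 4)
    (hQ : ∀ k r, Q • ((k, r, true) : PolygonFlag g) = (κ k r, ρ r, true))
    (hκ : ∀ k r, Q ^ 4 • ((k, r, true) : PolygonFlag g) = (k - 1, r, true)) {n : ℕ} {k : ZMod g}
    {r : Fin 4} (h : Q ^ n • ((k, r, true) : PolygonFlag g) = (k, r, true)) : 4 * g ∣ n := by
  have h1 : ∀ n : ℕ, ∃ (k' : ZMod g) (r' : Fin 4),
      Q ^ n • ((k, r, true) : PolygonFlag g) = (k', r', true) ∧ (r' : ℕ) = (r + e * n) % 4 := by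
    intro n
    induction n with
    | zero => exact ⟨k, r, by simp, by simp [Nat.mod_eq_of_lt r.2]⟩
    | succ n ih =>
      obtain ⟨k', r', h1, h2⟩ := ih
      refine ⟨κ k' r', ρ r', by rw [pow_succ', mul_smul, h1, hQ], ?_⟩
      rw [hρ, h2, mul_add, mul_one]
      omega
  obtain ⟨k', r', hk', hr'⟩ := h1 n
  rw [h] at hk'
  have h2 : r = r' := congrArg (fun f : PolygonFlag g => f.2.1) hk'
  obtain ⟨m, rfl⟩ := he n (by rw [← h2] at hr'; omega)
  have h3 : ∀ m : ℕ, (Q ^ 4) ^ m • ((k, r, true) : PolygonFlag g) = (k - m, r, true) := by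
    intro m
    induction m with
    | zero => simp
    | succ m ih =>
      rw [pow_succ', mul_smul, ih, hκ]
      push_cast
      rw [sub_sub]
  rw [pow_mul, h3] at h
  have h4 : k - m = k := congrArg (fun f : PolygonFlag g => f.1) h
  rw [sub_eq_self, ZMod.natCast_eq_zero_iff] at h4
  exact Nat.mul_dvd_mul_left 4 h4

theorem dvd_of_pow_smul_of_true {i j : Fin 3} {m n : ℕ}
    (h : ∀ k r, ((triangleSystem g).simple i * (triangleSystem g).simple j) ^ n •
      ((k, r, true) : PolygonFlag g) = (k, r, true) → m ∣ n) {f : PolygonFlag g}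
    (hf : ((triangleSystem g).simple i * (triangleSystem g).simple j) ^ n • f = f) : m ∣ n := by
  obtain ⟨k, r, b⟩ := f
  cases b with
  | true => exact h k r hf
  | false =>
    set s := (triangleSystem g).simple i
    set t := (triangleSystem g).simple j with ht
    have ht1 : t * t = 1 := (triangleSystem g).simple_mul_simple_self j
    have hs1 : s * s = 1 := (triangleSystem g).simple_mul_simple_self i
    have hti : t⁻¹ = t := inv_eq_of_mul_eq_one_left ht1
    have h1 : t * (s * t) * t⁻¹ = (s * t)⁻¹ := by
      rw [mul_inv_rev, inv_eq_of_mul_eq_one_left hs1, hti, mul_assoc, mul_assoc, ht1, mul_one]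
    have h2 : t * (s * t) ^ n * t⁻¹ = ((s * t) ^ n)⁻¹ := by
      rw [← conj_pow, h1, inv_pow]
    obtain ⟨⟨k', r', b'⟩, hp⟩ : ∃ p, t • ((k, r, false) : PolygonFlag g) = p := ⟨_, rfl⟩
    have hb := simple_smul_flag_bool j ((k, r, false) : PolygonFlag g)
    rw [← ht, hp] at hb
    obtain rfl : b' = true := hb
    refine h k' r' ?_
    rw [← hp, eq_comm, ← inv_smul_eq_iff, ← h2, mul_smul, mul_smul, inv_smul_smul, hf]

/-- The rotations act on every flag with their full Coxeter order. This is what excludes rotations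
from the surface group and makes its action free. -/
theorem dvd_of_pow_smul {i j : Fin 3} (hij : i ≠ j) {n : ℕ} {f : PolygonFlag g}
    (h : ((triangleSystem g).simple i * (triangleSystem g).simple j) ^ n • f = f) :
    triangleMatrix g i j ∣ n := by
  have hsymm : ∀ i j : Fin 3, (∀ f : PolygonFlag g,
      ((triangleSystem g).simple i * (triangleSystem g).simple j) ^ n • f = f →
        triangleMatrix g i j ∣ n) → ∀ f : PolygonFlag g,
      ((triangleSystem g).simple j * (triangleSystem g).simple i) ^ n • f = f →
        triangleMatrix g j i ∣ n := by
    intro i j hij f hf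
    rw [(triangleMatrix g).symmetric j i]
    refine hij f ?_
    have : (triangleSystem g).simple i * (triangleSystem g).simple j =
        ((triangleSystem g).simple j * (triangleSystem g).simple i)⁻¹ := by
      rw [mul_inv_rev, CoxeterSystem.inv_simple, CoxeterSystem.inv_simple]
    rw [this, inv_pow, inv_smul_eq_iff, hf]
  have h10 : ∀ f : PolygonFlag g, ((triangleSystem g).simple 1 * (triangleSystem g).simple 0) ^ n •
      f = f → triangleMatrix g 1 0 ∣ n := by
    have hQ : ∀ k r, ((triangleSystem g).simple 1 * (triangleSystem g).simple 0) •
        ((k, r, true) : PolygonFlag g) = (if r = 0 then k - 1 else k, r - 1, true) := fun k r => by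
      rw [simple_mul_simple_smul_flag, VoltageData.stepPerm_one_zero]
    intro f hf
    refine dvd_of_pow_smul_of_true (m := 4 * g) (fun k r => dvd_of_pow_smul_true (e := 3)
      (fun n hn => by omega) (fun r => by fin_cases r <;> rfl) hQ ?_) hf
    intro k r
    simp only [pow_succ, pow_zero, one_mul, mul_smul _ ((triangleSystem g).simple 1 *
      (triangleSystem g).simple 0), hQ]
    fin_cases r <;> simp [show (-1 : Fin 4) = 3 from rfl]
  have h12 : ∀ f : PolygonFlag g, ((triangleSystem g).simple 1 * (triangleSystem g).simple 2) ^ n •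
      f = f → triangleMatrix g 1 2 ∣ n := by
    have hQ : ∀ k r, ((triangleSystem g).simple 1 * (triangleSystem g).simple 2) •
        ((k, r, true) : PolygonFlag g) = (if r = 2 then k - 1 else k, r + 1, true) := fun k r => by
      rw [simple_mul_simple_smul_flag, VoltageData.stepPerm_one_two]
    intro f hf
    refine dvd_of_pow_smul_of_true (m := 4 * g) (fun k r => dvd_of_pow_smul_true (e := 1)
      (fun n hn => by omega) (fun r => by fin_cases r <;> rfl) hQ ?_) hf
    intro k r
    simp only [pow_succ, pow_zero, one_mul, mul_smul _ ((triangleSystem g).simple 1 *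
      (triangleSystem g).simple 2), hQ]
    fin_cases r <;> simp
  have h20 : ∀ f : PolygonFlag g, ((triangleSystem g).simple 2 * (triangleSystem g).simple 0) ^ n •
      f = f → triangleMatrix g 2 0 ∣ n := by
    intro f hf
    have h1 : ∀ n : ℕ, ((((triangleSystem g).simple 2 * (triangleSystem g).simple 0) ^ n •
        f).2.1 : ℕ) = (f.2.1 + 2 * n) % 4 := by
      intro n
      induction n with
      | zero => simp [Nat.mod_eq_of_lt f.2.1.2]
      | succ n ih =>
        rw [pow_succ', mul_smul, mul_smul, simple_smul_flag, simple_smul_flag]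
        change ((_ + 2 : Fin 4) : ℕ) = _
        rw [Fin.val_add]
        change (((((triangleSystem g).simple 2 * (triangleSystem g).simple 0) ^ n •
          f).2.1 : ℕ) + 2) % 4 = _
        omega
    have h2 := h1 n
    rw [hf] at h2
    change 2 ∣ n
    omega
  fin_cases i <;> fin_cases j <;> first
    | exact absurd rfl hij
    | exact h10 f h
    | exact h12 f h
    | exact h20 f h
    | exact hsymm _ _ h10 f h
    | exact hsymm _ _ h12 f h
    | exact hsymm _ _ h20 f h

/-- Normal form in a dihedral group: conjugation by s inverts st. -/
theorem mem_closure_pair {W : Type*} [Group W] {s t u : W} (hs : s * s = 1) (ht : t * t = 1)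
    (hu : u ∈ Subgroup.closure {s, t}) :
    ∃ n : ℤ, u = (s * t) ^ n ∨ u = (s * t) ^ n * s := by
  have hsi : s⁻¹ = s := inv_eq_of_mul_eq_one_left hs
  have hti : t⁻¹ = t := inv_eq_of_mul_eq_one_left ht
  have hconj : ∀ n : ℤ, s * (s * t) ^ n = (s * t) ^ (-n) * s := by
    intro n
    have h1 : s * (s * t) * s⁻¹ = (s * t)⁻¹ := by
      rw [mul_inv_rev, hti, hsi, ← mul_assoc, hs, one_mul]
    have h2 : s * (s * t) ^ n * s⁻¹ = (s * t) ^ (-n) := by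
      rw [← conj_zpow, h1, inv_zpow']
    rw [← h2, inv_mul_cancel_right]
  induction hu using Subgroup.closure_induction with
  | mem x hx =>
    rcases hx with rfl | hx
    · exact ⟨0, Or.inr (by simp)⟩
    · rw [Set.mem_singleton_iff] at hx
      refine ⟨-1, Or.inr ?_⟩
      rw [hx, zpow_neg_one, mul_inv_rev, hsi, hti, mul_assoc, hs, mul_one]
  | one => exact ⟨0, Or.inl (by simp)⟩
  | mul x y _ _ hx hy =>
    obtain ⟨n, rfl | rfl⟩ := hx <;> obtain ⟨m, rfl | rfl⟩ := hy
    · exact ⟨n + m, Or.inl (zpow_add _ _ _).symm⟩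
    · exact ⟨n + m, Or.inr (by rw [zpow_add, mul_assoc])⟩
    · exact ⟨n + -m, Or.inr (by rw [mul_assoc, hconj, zpow_add, mul_assoc])⟩
    · refine ⟨n + -m, Or.inl ?_⟩
      rw [mul_assoc, ← mul_assoc s, hconj, mul_assoc, hs, mul_one, zpow_add]
  | inv x _ hx =>
    obtain ⟨n, rfl | rfl⟩ := hx
    · exact ⟨-n, Or.inl (by rw [zpow_neg])⟩
    · refine ⟨n, Or.inr ?_⟩
      rw [mul_inv_rev, hsi, ← zpow_neg, hconj, neg_neg]

/-- The Boolean of a flag records its orientation, so elements of odd length fix no flag. -/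
theorem lengthParity_flag (w : TriangleGroup g) (f : PolygonFlag g) :
    (if (w • f).2.2 then (1 : ZMod 2) else 0) =
      (if f.2.2 then 1 else 0) + ((triangleSystem g).lengthParity w).toAdd := by
  induction w using (triangleSystem g).simple_induction_left with
  | one => simp
  | mul_simple_left w i ih =>
    rw [mul_smul, simple_smul_flag_bool, map_mul, toAdd_mul, CoxeterSystem.lengthParity_simple,
      toAdd_ofAdd, add_comm (1 : ZMod 2), ← add_assoc, ← ih]
    have h2 : (1 : ZMod 2) + 1 = 0 := rfl
    cases (w • f).2.2 <;> simp [h2]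

/-- The stabilizers of flags meet the dihedral subgroups trivially. -/
theorem eq_one_of_mem_closure_pair {i j : Fin 3} (hij : i ≠ j) {u : TriangleGroup g}
    (hu : u ∈ Subgroup.closure {(triangleSystem g).simple i, (triangleSystem g).simple j})
    {f : PolygonFlag g} (hf : u • f = f) : u = 1 := by
  obtain ⟨n, hn⟩ := mem_closure_pair (CoxeterSystem.simple_mul_simple_self _ i)
    (CoxeterSystem.simple_mul_simple_self _ j) hu
  have hpar := lengthParity_flag u f
  rw [hf, left_eq_add] at hpar
  have h2 : (1 : ZMod 2) + 1 = 0 := rfl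
  rcases hn with rfl | rfl
  · have h1 : ((triangleSystem g).simple i * (triangleSystem g).simple j) ^ n.natAbs • f = f := by
      obtain h | h := n.natAbs_eq
      · rw [h, zpow_natCast] at hf
        exact hf
      · rw [h, zpow_neg, zpow_natCast, inv_smul_eq_iff] at hf
        exact hf.symm
    obtain ⟨m, hm⟩ := dvd_of_pow_smul hij h1
    have h3 : ((triangleSystem g).simple i * (triangleSystem g).simple j) ^ n.natAbs = 1 := by
      rw [hm, pow_mul, CoxeterSystem.simple_mul_simple_pow, one_pow]
    obtain h | h := n.natAbs_eq
    · rw [h, zpow_natCast, h3]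
    · rw [h, zpow_neg, zpow_natCast, h3, inv_one]
  · have h3 : (triangleSystem g).lengthParity (((triangleSystem g).simple i *
        (triangleSystem g).simple j) ^ n * (triangleSystem g).simple i) = Multiplicative.ofAdd 1 := by
      rw [map_mul, map_zpow, map_mul, CoxeterSystem.lengthParity_simple,
        CoxeterSystem.lengthParity_simple, ← ofAdd_add, h2, ofAdd_zero, one_zpow, one_mul]
    rw [h3, toAdd_ofAdd] at hpar
    exact absurd hpar (by decide)

end FlagAction

/-! ### Side pairings -/

section SidePairings

instance neZero_of_four_le {g : ℕ} [hg : Fact (4 ≤ g)] : NeZero g :=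
  ⟨by have := hg.out; omega⟩

namespace VoltageData

variable {g : ℕ} {H : Type*} [Group H] (V : VoltageData g H)

theorem volt_eq_of_ne_two {i : Fin 3} (hi : i ≠ 2) (f : PolygonFlag g) :
    ∃ ζ, (ζ = 1 ∨ ζ = V.z) ∧ V.volt i f = ζ * V.R i := by
  obtain ⟨k, r, b⟩ := f
  fin_cases i
  · exact ⟨1, Or.inl rfl, (one_mul _).symm⟩
  · refine ⟨_, ?_, rfl⟩
    split_ifs
    exacts [Or.inr rfl, Or.inl rfl]
  · exact absurd rfl hi

theorem volt_two_eq (f : PolygonFlag g) :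
    ∃ ζ, (ζ = 1 ∨ ζ = V.z) ∧ V.volt 2 f = ζ * (V.c f.1 f.2.1 * V.R 2) := by
  obtain ⟨k, r, b⟩ := f
  change ∃ ζ, _ ∧ V.c k r * (if (r < 2 ↔ b = false) then V.z else 1) * V.R 2 = _
  split_ifs
  · exact ⟨V.z, Or.inr rfl, by rw [V.mul_z, mul_assoc]⟩
  · exact ⟨1, Or.inl rfl, by rw [mul_one, one_mul]⟩

theorem mul_eq_one_or_z {ζ ξ : H} (hζ : ζ = 1 ∨ ζ = V.z) (hξ : ξ = 1 ∨ ξ = V.z) :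
    ζ * ξ = 1 ∨ ζ * ξ = V.z := by
  rcases hζ with rfl | rfl <;> rcases hξ with rfl | rfl <;> simp [V.z_mul_z]

theorem commute_of_eq_one_or_z {ζ : H} (hζ : ζ = 1 ∨ ζ = V.z) (h : H) : ζ * h = h * ζ := by
  rcases hζ with rfl | rfl
  · simp
  · exact (V.z_central h).eq

end VoltageData

section Pairings

variable (g : ℕ) [NeZero g]

/-- The rotation of the `4g`-gon to the next side. -/
noncomputable def polygonRotation : TriangleGroup g :=
  (triangleSystem g).simple 1 * (triangleSystem g).simple 0

/-- The element that crosses the side number `n` of the `4g`-gon. -/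
noncomputable def crossing (n : ℕ) : TriangleGroup g :=
  polygonRotation g ^ n * (triangleSystem g).simple 2 * (triangleSystem g).simple 0

variable {g}

theorem flagOf_mul_polygonRotation {w : TriangleGroup g} {k : ZMod g} {r : Fin 4}
    (h : flagOf w = (k, r, true)) :
    flagOf (w * polygonRotation g) = if r = 3 then (k + 1, 0, true) else (k, r + 1, true) := by
  rw [polygonRotation, ← mul_assoc, flagOf_mul_simple, flagOf_mul_simple, h]
  fin_cases r <;> simp [flagStep]

theorem flagOf_polygonRotation_pow (k : ℕ) (r : Fin 4) :
    flagOf (polygonRotation g ^ (4 * k + r)) = ((k : ZMod g), r, true) := by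
  have h0 : ∀ k : ℕ, flagOf (polygonRotation g ^ (4 * k)) = ((k : ZMod g), 0, true) →
      ∀ r : Fin 4, flagOf (polygonRotation g ^ (4 * k + r)) = ((k : ZMod g), r, true) := by
    intro k hk r
    have h1 := flagOf_mul_polygonRotation hk
    have h2 := flagOf_mul_polygonRotation h1
    have h3 := flagOf_mul_polygonRotation h2
    rw [← pow_succ] at h1 h2 h3
    rw [← pow_succ] at h2 h3
    rw [← pow_succ] at h3
    fin_cases r
    exacts [hk, h1, h2, h3]
  refine h0 k ?_ r
  induction k with
  | zero => simp [flagOf_one, baseFlag]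
  | succ k ih =>
    have h1 := flagOf_mul_polygonRotation (h0 k ih 3)
    rw [← pow_succ] at h1
    have h2 : 4 * k + ((3 : Fin 4) : ℕ) + 1 = 4 * (k + 1) := rfl
    rw [h2] at h1
    rw [h1]
    simp

theorem flagOf_crossing (k : ℕ) (r : Fin 4) :
    flagOf (crossing g (4 * k + r)) = ((k : ZMod g), r + 2, true) := by
  rw [crossing, flagOf_mul_simple, flagOf_mul_simple, flagOf_polygonRotation_pow]
  rfl

/-- Crossing side 4k + r leads to the flag of side 4k + r + 2, to which it is glued; returning by
the rotation to that side closes the path of flags. -/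
theorem crossing_mul_inv_mem (k : ℕ) {r : ℕ} (hr : r < 2) :
    crossing g (4 * k + r) * (polygonRotation g ^ (4 * k + r + 2))⁻¹ ∈ surfaceSubgroup g := by
  apply mul_inv_mem_of_flagOf_eq
  have h1 := flagOf_crossing (g := g) k ⟨r, by omega⟩
  have h2 := flagOf_polygonRotation_pow (g := g) k ⟨r + 2, by omega⟩
  refine h1.trans (Eq.trans ?_ h2.symm)
  congr 2
  apply Fin.ext
  change (r + 2) % 4 = r + 2
  omega

/-- The side pairing transformations. -/
noncomputable def sidePairing (k : ℕ) {r : ℕ} (hr : r < 2) : surfaceSubgroup g :=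
  ⟨_, crossing_mul_inv_mem k hr⟩

namespace VoltageData

variable {H : Type*} [Group H] (V : VoltageData g H)

theorem path_polygonRotation_pow (n : ℕ) :
    ∃ ζ, (ζ = 1 ∨ ζ = V.z) ∧ V.path (polygonRotation g ^ n) = ζ * (V.R 1 * V.R 0) ^ n := by
  induction n with
  | zero => exact ⟨1, Or.inl rfl, by simp [V.path_one]⟩
  | succ n ih =>
    obtain ⟨ζ, hζ, h⟩ := ih
    obtain ⟨ξ, hξ, h1⟩ := V.volt_eq_of_ne_two (i := 1) (by decide) (flagOf (polygonRotation g ^ n))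
    refine ⟨ζ * ξ, V.mul_eq_one_or_z hζ hξ, ?_⟩
    rw [pow_succ]
    nth_rewrite 2 [polygonRotation]
    rw [← mul_assoc, path_mul_simple, path_mul_simple, h, h1, pow_succ]
    change ζ * (V.R 1 * V.R 0) ^ n * (ξ * V.R 1) * V.R 0 = _
    calc ζ * (V.R 1 * V.R 0) ^ n * (ξ * V.R 1) * V.R 0
        = ζ * ((V.R 1 * V.R 0) ^ n * ξ) * V.R 1 * V.R 0 := by simp only [mul_assoc]
      _ = _ := by rw [← V.commute_of_eq_one_or_z hξ]; simp only [mul_assoc]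

/-- The value splits into the free parameter c and a product of reflections. Trivial R isolates c,
while trivial c gives the matrices of the Fuchsian representation. -/
theorem hom_sidePairing (k : ℕ) {r : ℕ} (hr : r < 2) :
    ∃ ζ, (ζ = 1 ∨ ζ = V.z) ∧ V.hom (sidePairing k hr) = ζ * (V.c k ⟨r, by omega⟩ *
      ((V.R 1 * V.R 0) ^ (4 * k + r) * (V.R 2 * V.R 0) *
        ((V.R 1 * V.R 0) ^ (4 * k + r + 2))⁻¹)) := by
  obtain ⟨ζ, hζ, h1⟩ := V.path_polygonRotation_pow (4 * k + r)
  obtain ⟨ξ, hξ, h2⟩ := V.path_polygonRotation_pow (4 * k + r + 2)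
  obtain ⟨χ, hχ, h3⟩ := V.volt_two_eq (flagOf (polygonRotation g ^ (4 * k + r)))
  have hf := flagOf_polygonRotation_pow (g := g) k ⟨r, by omega⟩
  have h4 : V.path (crossing g (4 * k + r)) =
      ζ * (V.R 1 * V.R 0) ^ (4 * k + r) * (χ * (V.c k ⟨r, by omega⟩ * V.R 2)) * V.R 0 := by
    rw [crossing, path_mul_simple, path_mul_simple, h1, h3]
    change flagOf (polygonRotation g ^ (4 * k + r)) = _ at hf
    rw [hf]
    rfl
  have h5 : V.hom (sidePairing k hr) * V.path (polygonRotation g ^ (4 * k + r + 2)) =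
      V.path (crossing g (4 * k + r)) := by
    rw [hom_apply, ← V.path_mul_of_mem (sidePairing k hr).2]
    congr 1
    exact inv_mul_cancel_right _ _
  have hξi : ξ⁻¹ = ξ := by
    rcases hξ with rfl | rfl
    · exact inv_one
    · exact inv_eq_of_mul_eq_one_left V.z_mul_z
  have hcomm : Commute (V.c k ⟨r, by omega⟩) ((V.R 1 * V.R 0) ^ (4 * k + r)) :=
    ((V.c_comm _ _ 1).mul_right (V.c_comm _ _ 0)).pow_right _
  refine ⟨ζ * χ * ξ, V.mul_eq_one_or_z (V.mul_eq_one_or_z hζ hχ) hξ, ?_⟩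
  rw [eq_mul_inv_of_mul_eq h5, h4, h2, mul_inv_rev, hξi]
  generalize (V.R 1 * V.R 0) ^ (4 * k + r) = P at *
  generalize ((V.R 1 * V.R 0) ^ (4 * k + r + 2))⁻¹ = P' at *
  generalize V.c k ⟨r, _⟩ = c at *
  calc ζ * P * (χ * (c * V.R 2)) * V.R 0 * (P' * ξ)
      = ζ * (P * χ) * c * V.R 2 * V.R 0 * P' * ξ := by simp only [mul_assoc]
    _ = ζ * χ * (P * c) * V.R 2 * V.R 0 * P' * ξ := by
        rw [← V.commute_of_eq_one_or_z hχ]; simp only [mul_assoc]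
    _ = ζ * χ * ((c * P * V.R 2 * V.R 0 * P') * ξ) := by rw [← hcomm.eq]; simp only [mul_assoc]
    _ = _ := by rw [← V.commute_of_eq_one_or_z hξ]; simp only [mul_assoc]

end VoltageData

end Pairings

/-- Voltages with trivial reflections and with x, y, x⁻¹, y⁻¹ on the four sides of a handle. The
only nontrivial condition is that a commutator vanishes on each handle; handles other than the three
prescribed ones are sent to 1. -/
theorem exists_hom_surfaceSubgroup {g : ℕ} [hg : Fact (4 ≤ g)] (H : Type*) [Group H]
    (x y : Fin 3 → H) (hxy : ∀ k, Commute (x k) (y k)) :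
    ∃ θ : surfaceSubgroup g →* H, ∀ k : Fin 3,
      θ (sidePairing k (zero_lt_two : 0 < 2)) = x k ∧ θ (sidePairing k one_lt_two) = y k := by
  let X : ZMod g → H := fun k => if h : k.val < 3 then x ⟨k.val, h⟩ else 1
  let Y : ZMod g → H := fun k => if h : k.val < 3 then y ⟨k.val, h⟩ else 1
  have hXY : ∀ k, Commute (X k) (Y k) := fun k => by
    by_cases h : k.val < 3
    · simpa only [X, Y, h, dif_pos] using hxy _
    · simp only [X, Y, h, dif_neg, not_false_eq_true]
      exact Commute.one_left _
  let V : VoltageData g H :=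
    { R := fun _ => 1
      z := 1
      c := fun k => ![X k, Y k, (X k)⁻¹, (Y k)⁻¹]
      z_central := fun h => Commute.one_left h
      z_mul_z := mul_one 1
      R_mul_R := fun _ => mul_one 1
      R_pow := fun i j _ => by rw [mul_one, one_pow]
      c_comm := fun _ _ _ => Commute.one_right _
      c_inv := fun k r => by fin_cases r <;> simp
      c_handle := fun k => by
        change (Y k)⁻¹ * X k * Y k * (X k)⁻¹ = 1
        rw [mul_assoc _ (X k), (hXY k).eq, inv_mul_cancel_left, mul_inv_cancel] }
  have hval : ∀ k : Fin 3, ((k : ℕ) : ZMod g).val = k := fun k =>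
    ZMod.val_cast_of_lt (by have := hg.out; omega)
  have hV : ∀ (k : ℕ) {r : ℕ} (hr : r < 2),
      V.hom (sidePairing k hr) = V.c k ⟨r, by omega⟩ := fun k r hr => by
    obtain ⟨ζ, hζ, h⟩ := V.hom_sidePairing k hr
    obtain rfl : ζ = 1 := hζ.elim id id
    rw [h]
    simp [V]
  refine ⟨V.hom, fun k => ⟨?_, ?_⟩⟩
  · rw [hV]
    change X _ = _
    simp [X, hval]
  · rw [hV]
    change Y _ = _
    simp [Y, hval]

end SidePairings

/-! ### The Fuchsian representation of the surface group -/

section FuchsianRepresentation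

section

variable (g : ℕ)

/-- The rotation matrices. -/
noncomputable def rotMat (t : ℝ) : Mat2 := !![Real.cos t, Real.sin t; -Real.sin t, Real.cos t]

theorem rotMat_mul (s t : ℝ) : rotMat s * rotMat t = rotMat (s + t) := by
  ext i j
  fin_cases i <;> fin_cases j <;>
    simp [rotMat, Matrix.mul_apply, Fin.sum_univ_two, Real.sin_add, Real.cos_add] <;> ring

theorem rotMat_pow (t : ℝ) (n : ℕ) : rotMat t ^ n = rotMat (n * t) := by
  induction n with
  | zero =>
    ext i j
    fin_cases i <;> fin_cases j <;> simp [rotMat]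
  | succ n ih =>
    rw [pow_succ, ih, rotMat_mul]
    congr 1
    push_cast
    ring

theorem mirror_one_mul_zero : mirror g 1 * mirror g 0 = -rotMat (halfAngle g) := by
  ext i j
  fin_cases i <;> fin_cases j <;> simp [mirror, rotMat, Matrix.mul_apply, Fin.sum_univ_two]

theorem mirror_zero_mul_one : mirror g 0 * mirror g 1 = -rotMat (-halfAngle g) := by
  ext i j
  fin_cases i <;> fin_cases j <;> simp [mirror, rotMat, Matrix.mul_apply, Fin.sum_univ_two]

/-- The matrix of a side pairing, up to sign. -/
noncomputable def pairingMat (n : ℕ) : Mat2 :=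
  rotMat (n * halfAngle g) * (mirror g 2 * mirror g 0) * rotMat ((n + 2) * -halfAngle g)

/-- Decomposition into scalar, symmetric traceless and skew parts. Only the symmetric part depends
on n, through the angle (2n + 2)θ. -/
theorem pairingMat_eq (n : ℕ) : pairingMat g n =
    (apothemCosh g * Real.sin (2 * halfAngle g)) • 1 +
    (-apothemSinh g) • !![Real.sin ((2 * n + 2) * halfAngle g), Real.cos ((2 * n + 2) * halfAngle g);
      Real.cos ((2 * n + 2) * halfAngle g), -Real.sin ((2 * n + 2) * halfAngle g)] +
    (-(apothemCosh g * Real.cos (2 * halfAngle g))) • !![0, -1; 1, 0] := by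
  have e1 : (2 * n + 2) * halfAngle g = n * halfAngle g + (n + 2) * halfAngle g := by ring
  have e2 : 2 * halfAngle g = (n + 2) * halfAngle g - n * halfAngle g := by ring
  rw [e1, e2, pairingMat, Real.sin_add, Real.cos_add, Real.sin_sub, Real.cos_sub, mul_neg]
  generalize n * halfAngle g = t
  generalize (n + 2) * halfAngle g = t'
  ext i j
  fin_cases i <;> fin_cases j <;>
    simp [rotMat, mirror, Matrix.mul_apply, Fin.sum_univ_two, Matrix.add_apply] <;> ring

end

variable (g : ℕ) [hg : Fact (4 ≤ g)]

/-- The reflections as invertible matrices. -/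
noncomputable def mirrorUnit (i : Fin 3) : Mat2ˣ :=
  ⟨mirror g i, mirror g i, mirror_mul_self g i, mirror_mul_self g i⟩

theorem val_mirrorUnit (i : Fin 3) : (mirrorUnit g i : Mat2) = mirror g i := rfl

/-- The voltages of the Fuchsian representation. -/
noncomputable def fuchsianVoltage : VoltageData g Mat2ˣ where
  R := mirrorUnit g
  z := -1
  c _ _ := 1
  z_central h := Commute.neg_one_left h
  z_mul_z := by simp
  R_mul_R i := Units.ext (mirror_mul_self g i)
  R_pow i j h := Units.ext (by
    push_cast
    exact mirror_mul_pow g h)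
  c_comm _ _ _ := Commute.one_left _
  c_inv _ _ := mul_one _
  c_handle _ := by simp

theorem fuchsianVoltage_volt (i : Fin 3) (f : PolygonFlag g) :
    ((fuchsianVoltage g).volt i f : Mat2) = mirror g i ∨
      ((fuchsianVoltage g).volt i f : Mat2) = -mirror g i := by
  have key : ∃ ζ, (ζ = 1 ∨ ζ = (fuchsianVoltage g).z) ∧
      (fuchsianVoltage g).volt i f = ζ * mirrorUnit g i := by
    rcases eq_or_ne i 2 with rfl | hi
    · obtain ⟨ζ, hζ, h⟩ := (fuchsianVoltage g).volt_two_eq f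
      refine ⟨ζ, hζ, h.trans ?_⟩
      change ζ * (1 * _) = _
      rw [one_mul]
      rfl
    · exact (fuchsianVoltage g).volt_eq_of_ne_two hi f
  obtain ⟨ζ, rfl | rfl, h⟩ := key
  · left
    rw [h, one_mul, val_mirrorUnit]
  · right
    rw [h]
    change ((-1 * mirrorUnit g i : Mat2ˣ) : Mat2) = _
    rw [neg_one_mul, Units.val_neg, val_mirrorUnit]

theorem det_fuchsianVoltage_path (w : TriangleGroup g) :
    ((fuchsianVoltage g).path w : Mat2).det = if (flagOf w).2.2 then 1 else -1 := by
  induction w using (triangleSystem g).simple_induction_right with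
  | one => simp [VoltageData.path_one, flagOf_one, baseFlag]
  | mul_simple_right w i ih =>
    have h1 : ((fuchsianVoltage g).volt i (flagOf w) : Mat2).det = -1 := by
      rcases fuchsianVoltage_volt g i (flagOf w) with h | h
      · rw [h, mirror_det]
      · rw [h, Matrix.det_neg, mirror_det]
        norm_num
    have h2 : (flagStep g i (flagOf w)).2.2 = !(flagOf w).2.2 :=
      (trivialVoltage g).step_bool i (flagOf w, ())
    rw [VoltageData.path_mul_simple, Units.val_mul, Matrix.det_mul, ih, h1, flagOf_mul_simple, h2]
    cases (flagOf w).2.2 <;> simp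

/-- The link between the action on the hyperboloid and the voltages: the sign ambiguity of the path
matrix cancels in a conjugation, and the sign in front counts the reflections Y ↦ -AYA modulo 2. -/
theorem triangleRep_eq (w : TriangleGroup g) (Y : Mat2) :
    triangleRep g w Y = (if (flagOf w).2.2 then (1 : ℝ) else -1) •
      (((fuchsianVoltage g).path w : Mat2) * Y * (((fuchsianVoltage g).path w)⁻¹ : Mat2ˣ)) := by
  induction w using (triangleSystem g).simple_induction_right generalizing Y with
  | one => simp [VoltageData.path_one, flagOf_one, baseFlag]
  | mul_simple_right w i ih =>
    have h2 : (flagStep g i (flagOf w)).2.2 = !(flagOf w).2.2 :=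
      (trivialVoltage g).step_bool i (flagOf w, ())
    have h1 : ((fuchsianVoltage g).volt i (flagOf w) : Mat2) * Y *
        (((fuchsianVoltage g).volt i (flagOf w))⁻¹ : Mat2ˣ) = mirror g i * Y * mirror g i := by
      rcases fuchsianVoltage_volt g i (flagOf w) with h | h
      · have h3 : (fuchsianVoltage g).volt i (flagOf w) = mirrorUnit g i := Units.ext h
        rw [h3]
        rfl
      · have h3 : (fuchsianVoltage g).volt i (flagOf w) = -mirrorUnit g i := Units.ext h
        rw [h3, inv_neg, Units.val_neg, Units.val_neg, neg_mul, neg_mul, mul_neg, neg_neg]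
        rfl
    rw [map_mul, Module.End.mul_apply, triangleRep_simple, reflection_apply, ih, ← h1,
      VoltageData.path_mul_simple, flagOf_mul_simple, h2, mul_inv_rev, Units.val_mul, Units.val_mul]
    cases (flagOf w).2.2 <;> simp [mul_assoc]

/-- The Fuchsian representation of the surface group. -/
noncomputable def fuchsianRep : surfaceSubgroup g →* Matrix.SpecialLinearGroup (Fin 2) ℝ where
  toFun γ := ⟨(fuchsianVoltage g).hom γ, by
    rw [VoltageData.hom_apply, det_fuchsianVoltage_path, mem_surfaceSubgroup_iff.1 γ.2]
    rfl⟩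
  map_one' := Subtype.ext (by
    change (((fuchsianVoltage g).hom 1 : Mat2ˣ) : Mat2) = 1
    rw [map_one, Units.val_one])
  map_mul' γ δ := Subtype.ext (by
    change (((fuchsianVoltage g).hom (γ * δ) : Mat2ˣ) : Mat2) = _
    rw [map_mul, Units.val_mul]
    rfl)

theorem fuchsianRep_val (γ : surfaceSubgroup g) :
    (fuchsianRep g γ).1 = ((fuchsianVoltage g).hom γ : Mat2) := rfl

/-- For J the matrix of the base point and det A = 1 one has A J A⁻¹ = A Aᵀ J, so the height of the
moved base point is half the trace of A Aᵀ. -/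
theorem frobSq_fuchsianRep (γ : surfaceSubgroup g) :
    frobSq (fuchsianRep g γ).1 = 2 * (γ.1 • HypPlane.base).height := by
  have h1 : (fuchsianRep g γ⁻¹).1 = (((fuchsianVoltage g).path γ.1)⁻¹ : Mat2ˣ) := by
    rw [fuchsianRep_val, map_inv, VoltageData.hom_apply]
  have h2 : (γ.1 • HypPlane.base).1 =
      (fuchsianRep g γ).1 * HypPlane.base.1 * (fuchsianRep g γ⁻¹).1 := by
    rw [smul_val, triangleRep_eq, mem_surfaceSubgroup_iff.1 γ.2, h1]
    exact one_smul _ _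
  rw [HypPlane.height_eq, h2, map_inv, Matrix.SpecialLinearGroup.coe_inv,
    Matrix.adjugate_fin_two]
  simp [frobSq, HypPlane.base, Matrix.mul_apply, Fin.sum_univ_two]
  ring

theorem fuchsianRep_sidePairing (k : ℕ) {r : ℕ} (hr : r < 2) :
    (fuchsianRep g (sidePairing k hr)).1 = pairingMat g (4 * k + r) ∨
      (fuchsianRep g (sidePairing k hr)).1 = -pairingMat g (4 * k + r) := by
  obtain ⟨ζ, hζ, h⟩ := (fuchsianVoltage g).hom_sidePairing k hr
  have h1 : (((mirrorUnit g 1 * mirrorUnit g 0) ^ (4 * k + r) * (mirrorUnit g 2 * mirrorUnit g 0) *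
      ((mirrorUnit g 1 * mirrorUnit g 0) ^ (4 * k + r + 2))⁻¹ : Mat2ˣ) : Mat2) =
      pairingMat g (4 * k + r) := by
    have h2 : (mirrorUnit g 1 * mirrorUnit g 0)⁻¹ = mirrorUnit g 0 * mirrorUnit g 1 := by
      rw [mul_inv_rev]
      rfl
    rw [← inv_pow, h2]
    push_cast
    simp only [val_mirrorUnit]
    rw [mirror_one_mul_zero, mirror_zero_mul_one, neg_pow, neg_pow (rotMat (-halfAngle g)),
      rotMat_pow, rotMat_pow, pairingMat]
    have h3 : (-1 : Mat2) ^ (4 * k + r + 2) = (-1) ^ (4 * k + r) := by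
      rw [pow_add, neg_one_sq, mul_one]
    rw [h3]
    push_cast
    rcases neg_one_pow_eq_or Mat2 (4 * k + r) with h4 | h4 <;> rw [h4] <;> simp [mul_assoc]
  have h5 : (fuchsianVoltage g).hom (sidePairing k hr) = ζ * (1 *
      ((mirrorUnit g 1 * mirrorUnit g 0) ^ (4 * k + r) * (mirrorUnit g 2 * mirrorUnit g 0) *
        ((mirrorUnit g 1 * mirrorUnit g 0) ^ (4 * k + r + 2))⁻¹)) := h
  rw [fuchsianRep_val, h5, one_mul]
  rcases hζ with rfl | rfl
  · left
    rw [one_mul, h1]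
  · right
    change ((-1 * _ : Mat2ˣ) : Mat2) = _
    rw [neg_one_mul, Units.val_neg, h1]

/-- Only the scalar part contributes, so the trace does not depend on n: all the side pairings have
the same spectral radius. -/
theorem trace_pairingMat (n : ℕ) : (pairingMat g n).trace = 4 * Real.cos (halfAngle g) ^ 2 := by
  have hs := (sin_halfAngle_pos g).ne'
  rw [pairingMat_eq, Matrix.trace_fin_two]
  simp [Real.sin_two_mul, apothemCosh]
  field_simp
  ring

theorem two_lt_four_mul_cos_sq : 2 < 4 * Real.cos (halfAngle g) ^ 2 := by
  have h1 := sin_halfAngle_lt_cos g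
  have h2 := sin_halfAngle_pos g
  have h3 := Real.sin_sq_add_cos_sq (halfAngle g)
  nlinarith

theorem abs_trace_sidePairing (k : ℕ) {r : ℕ} (hr : r < 2) :
    |(fuchsianRep g (sidePairing k hr)).1.trace| = 4 * Real.cos (halfAngle g) ^ 2 := by
  have h0 : 0 ≤ 4 * Real.cos (halfAngle g) ^ 2 := by positivity
  rcases fuchsianRep_sidePairing g k hr with h | h
  · rw [h, trace_pairingMat, abs_of_nonneg h0]
  · rw [h, Matrix.trace_neg, trace_pairingMat, abs_neg, abs_of_nonneg h0]

/-- Differences of consecutive matrices cancel the scalar and skew parts and leave symmetric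
traceless matrices at the angles 8θ and 16θ. These are independent because sin 8θ ≠ 0 and span all
such matrices; the skew direction is then obtained from a single pairing matrix. -/
theorem eq_top_of_pairingMat_mem (V : Submodule ℝ Mat2) (h1 : 1 ∈ V)
    (h : ∀ k : Fin 3, pairingMat g (4 * k + 1) ∈ V) : V = ⊤ := by
  set θ := halfAngle g with hθ
  have hθ0 := halfAngle_pos g
  have hθ1 := halfAngle_le g
  have hs := apothemSinh_pos g
  have hc := one_lt_apothemCosh g
  have hpi := Real.pi_pos
  let M : ℝ → ℝ → Mat2 := fun a b => !![a, b; b, -a]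
  have h4 : Real.sin (4 * θ) ≠ 0 :=
    (Real.sin_pos_of_pos_of_lt_pi (by positivity) (by linarith)).ne'
  have h8 : Real.sin (8 * θ) ≠ 0 :=
    (Real.sin_pos_of_pos_of_lt_pi (by positivity) (by linarith)).ne'
  have hc2 : Real.cos (2 * θ) ≠ 0 :=
    (Real.cos_pos_of_mem_Ioo ⟨by linarith, by linarith⟩).ne'
  have hdiff : ∀ φ : ℝ, ∀ m n : ℕ, (2 * (m : ℝ) + 2) * θ = φ - 4 * θ → (2 * (n : ℝ) + 2) * θ = φ + 4 * θ →
      pairingMat g m ∈ V → pairingMat g n ∈ V → M (Real.cos φ) (-Real.sin φ) ∈ V := by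
    intro φ m n hm hn hmV hnV
    have e : pairingMat g n - pairingMat g m =
        (-(2 * apothemSinh g * Real.sin (4 * θ))) • M (Real.cos φ) (-Real.sin φ) := by
      rw [pairingMat_eq, pairingMat_eq, ← hθ, hm, hn, Real.sin_add, Real.cos_add, Real.sin_sub,
        Real.cos_sub]
      ext i j
      fin_cases i <;> fin_cases j <;> simp [M] <;> ring
    have := V.smul_mem (-(2 * apothemSinh g * Real.sin (4 * θ)))⁻¹ (V.sub_mem hnV hmV)
    rwa [e, smul_smul, inv_mul_cancel₀, one_smul] at this
    exact neg_ne_zero.2 (mul_ne_zero (by positivity) h4)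
  -- For n = 4k + 1 the angles (2n + 2)θ are 4θ, 12θ, 20θ, with midpoints 8θ and 16θ.
  have hA := hdiff (8 * θ) (4 * 0 + 1) (4 * 1 + 1) (by push_cast; ring) (by push_cast; ring)
    (h 0) (h 1)
  have hB := hdiff (16 * θ) (4 * 1 + 1) (4 * 2 + 1) (by push_cast; ring) (by push_cast; ring)
    (h 1) (h 2)
  have h16 : Real.cos (16 * θ) * Real.sin (8 * θ) - Real.sin (16 * θ) * Real.cos (8 * θ) =
      -Real.sin (8 * θ) := by
    have : Real.sin (8 * θ) = Real.sin (16 * θ - 8 * θ) := by congr 1; ring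
    rw [Real.sin_sub] at this
    linarith
  have hM : ∀ a b, M a b ∈ V := by
    intro a b
    have e : M a b = ((a * Real.sin (16 * θ) + b * Real.cos (16 * θ)) / Real.sin (8 * θ)) •
        M (Real.cos (8 * θ)) (-Real.sin (8 * θ)) +
        (-(a * Real.sin (8 * θ) + b * Real.cos (8 * θ)) / Real.sin (8 * θ)) •
        M (Real.cos (16 * θ)) (-Real.sin (16 * θ)) := by
      generalize Real.sin (8 * θ) = s₁ at h8 h16
      generalize Real.cos (8 * θ) = c₁ at h16
      generalize Real.sin (16 * θ) = s₂ at h16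
      generalize Real.cos (16 * θ) = c₂ at h16
      have e1 : a = (a * s₂ + b * c₂) / s₁ * c₁ + -(a * s₁ + b * c₁) / s₁ * c₂ := by
        field_simp
        linear_combination a * h16
      have e2 : b = (a * s₂ + b * c₂) / s₁ * -s₁ + -(a * s₁ + b * c₁) / s₁ * -s₂ := by
        field_simp
        linear_combination b * h16
      have e3 : ∀ x y z p q : ℝ, ∀ w : ℝ, M (x * y + p * q) (x * z + p * w) =
          x • M y z + p • M q w := fun x y z p q w => by
        ext i j
        fin_cases i <;> fin_cases j <;> simp [M]
        ring
      rw [← e3, ← e1, ← e2]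
    rw [e]
    exact V.add_mem (V.smul_mem _ hA) (V.smul_mem _ hB)
  have hK : !![0, -1; 1, 0] ∈ V := by
    have h5 := h 0
    have e := pairingMat_eq g (4 * (0 : Fin 3) + 1)
    set N := pairingMat g (4 * (0 : Fin 3) + 1)
    have h6 := V.sub_mem (V.sub_mem h5 (V.smul_mem (apothemCosh g * Real.sin (2 * θ)) h1))
      (V.smul_mem (-apothemSinh g) (hM (Real.sin ((2 * (4 * (0 : Fin 3) + 1 : ℕ) + 2) * θ))
        (Real.cos ((2 * (4 * (0 : Fin 3) + 1 : ℕ) + 2) * θ))))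
    have h7 := V.smul_mem (-(apothemCosh g * Real.cos (2 * θ)))⁻¹ h6
    rw [e] at h7
    convert h7 using 1
    rw [← hθ]
    have h8 : -(apothemCosh g * Real.cos (2 * θ)) ≠ 0 :=
      neg_ne_zero.2 (mul_ne_zero (by positivity) hc2)
    rw [eq_inv_smul_iff₀ h8]
    simp only [M]
    abel
  rw [eq_top_iff]
  intro Y _
  have e : Y = ((Y 0 0 + Y 1 1) / 2) • 1 + M ((Y 0 0 - Y 1 1) / 2) ((Y 0 1 + Y 1 0) / 2) +
      ((Y 1 0 - Y 0 1) / 2) • !![0, -1; 1, 0] := by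
    ext i j
    fin_cases i <;> fin_cases j <;> simp [M] <;> ring
  rw [e]
  exact V.add_mem (V.add_mem (V.smul_mem _ h1) (hM _ _)) (V.smul_mem _ hK)

end FuchsianRepresentation

/-! ### The surface group is quasi-isometrically embedded -/

section QuasiIsometry

variable (g : ℕ) [hg : Fact (4 ≤ g)]

/-- Cocompactness: a point is first moved into the chamber by the triangle group, then by one of
finitely many elements, one for each flag, so that the product lies in the surface group. -/
theorem exists_height_smul_le : ∃ c : ℝ, 1 < c ∧
    ∀ x : HypPlane, ∃ γ : surfaceSubgroup g, (γ • x).height ≤ c := by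
  let u : PolygonFlag g → TriangleGroup g := Function.invFun flagOf
  have hu : ∀ w, flagOf (u (flagOf w)) = flagOf w := fun w => Function.invFun_eq ⟨w, rfl⟩
  obtain ⟨M, hM⟩ := (Set.finite_range fun f => (u f • HypPlane.base).height).bddAbove
  refine ⟨max 2 (2 * (apothemCosh g ^ 2 * M)), lt_max_of_lt_left one_lt_two, fun x => ?_⟩
  obtain ⟨w, hw⟩ := exists_smul_mem_chamber g x
  set f := flagOf w⁻¹ with hf
  refine ⟨⟨u f * w, ?_⟩, le_max_of_le_right ?_⟩
  · simpa using mul_inv_mem_of_flagOf_eq (hu w⁻¹)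
  · change ((u f * w) • x).height ≤ _
    rw [mul_smul]
    refine (HypPlane.coshDist_le _ (u f • HypPlane.base) _).trans ?_
    rw [coshDist_smul]
    have h1 := height_le_of_mem_chamber g hw
    have h2 : (u f • HypPlane.base).height ≤ M := hM ⟨f, rfl⟩
    have h3 := HypPlane.one_le_coshDist (u f • HypPlane.base) HypPlane.base
    exact mul_le_mul_of_nonneg_left (mul_le_mul h1 h2 (by linarith) (sq_nonneg _)) zero_le_two

instance : ProperlyDiscontinuousSMul (surfaceSubgroup g) HypPlane where
  finite_disjoint_inter_image hK hL :=
    Set.Finite.preimage (f := Subtype.val) Subtype.val_injective.injOn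
      (ProperlyDiscontinuousSMul.finite_disjoint_inter_image (Γ := TriangleGroup g) hK hL)

theorem finite_setOf_height_le (C : ℝ) :
    {γ : surfaceSubgroup g | ∃ y : HypPlane, y.height ≤ C ∧ (γ • y).height ≤ C}.Finite := by
  refine (ProperlyDiscontinuousSMul.finite_disjoint_inter_image (Γ := surfaceSubgroup g)
    (HypPlane.isCompact_height_le C) (HypPlane.isCompact_height_le C)).subset ?_
  rintro γ ⟨y, h1, h2⟩
  exact ⟨γ • y, ⟨y, h1, rfl⟩, h2⟩

/-- The Milnor–Švarc argument in multiplicative form: each generator at least halves the height of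
the orbit point, so the word length is at most logarithmic in the height. -/
theorem exists_list_of_height_le {c : ℝ} (hc : 1 < c)
    (h : ∀ x : HypPlane, ∃ γ : surfaceSubgroup g, (γ • x).height ≤ c) (n : ℕ)
    (γ : surfaceSubgroup g) (hγ : (γ • HypPlane.base).height ≤ 2 ^ n * (4 * c)) :
    ∃ l : List (surfaceSubgroup g), (∀ δ ∈ l,
      δ ∈ {γ : surfaceSubgroup g | ∃ y : HypPlane, y.height ≤ 4 * c ∧ (γ • y).height ≤ 4 * c} ∨
      δ⁻¹ ∈ {γ : surfaceSubgroup g | ∃ y : HypPlane, y.height ≤ 4 * c ∧ (γ • y).height ≤ 4 * c}) ∧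
      l.prod = γ ∧ l.length ≤ n + 1 := by
  have hbase : HypPlane.base.height ≤ 4 * c := by
    rw [HypPlane.height, HypPlane.coshDist_self]
    linarith
  have hone : ∀ γ : surfaceSubgroup g, (γ • HypPlane.base).height ≤ 4 * c → ∀ n : ℕ,
      ∃ l : List (surfaceSubgroup g), (∀ δ ∈ l,
      δ ∈ {γ : surfaceSubgroup g | ∃ y : HypPlane, y.height ≤ 4 * c ∧ (γ • y).height ≤ 4 * c} ∨
      δ⁻¹ ∈ {γ : surfaceSubgroup g | ∃ y : HypPlane, y.height ≤ 4 * c ∧ (γ • y).height ≤ 4 * c}) ∧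
      l.prod = γ ∧ l.length ≤ n + 1 := fun γ hγ n => by
    refine ⟨[γ], fun δ hδ => ?_, by simp, by simp⟩
    rw [List.mem_singleton.1 hδ]
    exact Or.inl ⟨HypPlane.base, hbase, hγ⟩
  induction n generalizing γ with
  | zero => exact hone γ (by linarith) 0
  | succ n ih =>
    rcases le_total (γ • HypPlane.base).height (4 * c) with h1 | h1
    · exact hone γ h1 _
    -- y has height 4c on the way to the orbit point of height h, and their `coshDist` is at most h
    -- / 4c. Since δ brings y to height at most c, the moved orbit point has height at most 2 · (h /
    -- 4c) · c = h / 2.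
    obtain ⟨y, hy, hxy⟩ := HypPlane.exists_between (γ • HypPlane.base)
      (c := 4 * c) (by linarith) h1
    obtain ⟨δ, hδ⟩ := h y
    have h2 : ((δ * γ) • HypPlane.base).height ≤ 2 ^ n * (4 * c) := by
      have h3 := HypPlane.coshDist_le (δ • γ • HypPlane.base) (δ • y) HypPlane.base
      have h4 : (δ • γ • HypPlane.base).coshDist (δ • y) = (γ • HypPlane.base).coshDist y :=
        coshDist_smul g δ.1 _ _
      have h5 := HypPlane.one_le_coshDist (γ • HypPlane.base) y
      have h6 : (γ • HypPlane.base).coshDist y * (δ • y).height ≤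
          (γ • HypPlane.base).coshDist y * c := mul_le_mul_of_nonneg_left hδ (by linarith)
      rw [h4] at h3
      rw [mul_smul]
      rw [pow_succ] at hγ
      rw [HypPlane.height] at h6 ⊢
      linarith
    obtain ⟨l, hl, hprod, hlen⟩ := ih (δ * γ) h2
    refine ⟨δ⁻¹ :: l, fun ε hε => ?_, by simp [hprod], by simpa using hlen⟩
    rcases List.mem_cons.1 hε with rfl | hε
    · rw [inv_inv]
      exact Or.inr ⟨y, hy.le, hδ.trans (by linarith)⟩
    · exact hl ε hε

theorem exists_exp_wordLength_le : ∃ T : Set (surfaceSubgroup g), T.Finite ∧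
    Subgroup.closure T = ⊤ ∧ ∃ J K : ℝ, 0 < J ∧ 0 < K ∧
    ∀ γ, 1 / K * Real.exp (1 / J * wordLength T γ) ≤ frobSq (fuchsianRep g γ).1 := by
  obtain ⟨c, hc, h⟩ := exists_height_smul_le g
  have hlist := exists_list_of_height_le g hc h
  set T := {γ : surfaceSubgroup g | ∃ y : HypPlane, y.height ≤ 4 * c ∧ (γ • y).height ≤ 4 * c}
  have hlog : 0 < Real.log 2 := Real.log_pos one_lt_two
  have hexists : ∀ γ : surfaceSubgroup g, ∃ n : ℕ,
      (2 : ℝ) ^ n ≤ 2 * (γ • HypPlane.base).height ∧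
        (γ • HypPlane.base).height ≤ 2 ^ n * (4 * c) := fun γ => by
    obtain ⟨n, h1, h2⟩ := exists_nat_pow_near (HypPlane.one_le_coshDist (γ • HypPlane.base)
      HypPlane.base) one_lt_two
    have h3 : (0 : ℝ) < 2 ^ n := by positivity
    rw [pow_succ] at h2
    refine ⟨n, ?_, ?_⟩
    · rw [HypPlane.height]
      linarith
    · rw [HypPlane.height]
      nlinarith
  -- J = 1 / log 2 turns the exponential into 2 ^ ℓ, and 2 ^ ℓ ≤ 2 ^ (n + 1) is at most four times
  -- the height, which is twice `frobSq`.
  refine ⟨T, finite_setOf_height_le g _, ?_, 1 / Real.log 2, 2, by positivity, two_pos,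
    fun γ => ?_⟩
  · rw [eq_top_iff]
    intro γ _
    obtain ⟨n, -, hn⟩ := hexists γ
    obtain ⟨l, hl, rfl, -⟩ := hlist n γ hn
    refine Subgroup.list_prod_mem _ fun δ hδ => ?_
    rcases hl δ hδ with h1 | h1
    · exact Subgroup.subset_closure h1
    · exact (Subgroup.inv_mem_iff _).1 (Subgroup.subset_closure h1)
  · obtain ⟨n, hn1, hn2⟩ := hexists γ
    obtain ⟨l, hl, hprod, hlen⟩ := hlist n γ hn2
    have h1 : wordLength T γ ≤ n + 1 := (wordLength_le l hl hprod).trans hlen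
    have h2 : Real.exp (1 / (1 / Real.log 2) * wordLength T γ) = 2 ^ wordLength T γ := by
      rw [one_div_one_div, mul_comm, Real.exp_nat_mul, Real.exp_log two_pos]
    have h3 : (2 : ℝ) ^ wordLength T γ ≤ 2 ^ (n + 1) := pow_le_pow_right₀ one_le_two h1
    rw [pow_succ] at h3
    rw [h2, frobSq_fuchsianRep]
    change _ ≤ 2 * (γ • HypPlane.base).height
    linarith

/-- The Fuchsian system of the surface group. -/
noncomputable def surfaceFuchsianSystem : FuchsianSystem (surfaceSubgroup g) :=
  -- ν is the larger root of ν + ν⁻¹ = t, where t is the common absolute trace of the side pairings.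
  let t : ℝ := 4 * Real.cos (halfAngle g) ^ 2
  have ht : 2 < t := two_lt_four_mul_cos_sq g
  have hs : √(t ^ 2 - 4) ^ 2 = t ^ 2 - 4 := Real.sq_sqrt (by nlinarith)
  have hν : (t + √(t ^ 2 - 4)) / 2 + ((t + √(t ^ 2 - 4)) / 2)⁻¹ = t := by
    have h0 := Real.sqrt_nonneg (t ^ 2 - 4)
    have h1 : t + √(t ^ 2 - 4) ≠ 0 := by positivity
    field_simp
    linear_combination hs
  { A := fuchsianRep g
    a := fun k => sidePairing k zero_lt_two
    b := fun k => sidePairing k one_lt_two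
    ν := (t + √(t ^ 2 - 4)) / 2
    one_lt_ν := by
      have h0 := Real.sqrt_nonneg (t ^ 2 - 4)
      linarith
    trace_a := fun k => (abs_trace_sidePairing g k zero_lt_two).trans hν.symm
    trace_b := fun k => (abs_trace_sidePairing g k one_lt_two).trans hν.symm
    span_b := fun V h1 h => eq_top_of_pairingMat_mem g V h1 fun k => by
      rcases fuchsianRep_sidePairing g k one_lt_two with h2 | h2
      · rw [← h2]
        exact h k
      · rw [← neg_neg (pairingMat _ _), ← h2]
        exact V.neg_mem (h k)
    exists_hom := fun H _ x y hxy => exists_hom_surfaceSubgroup H x y hxy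
    exists_le := exists_exp_wordLength_le g }

end QuasiIsometry

/-! ### Free action and the fundamental triangle -/

section FundamentalTriangle

/-- The point of the hyperbolic plane with prescribed spatial coordinates. -/
noncomputable def HypPlane.ofVec (q r : ℝ) : HypPlane :=
  ⟨!![r, q - √(1 + q ^ 2 + r ^ 2); q + √(1 + q ^ 2 + r ^ 2), -r], by
    have h0 : 0 ≤ 1 + q ^ 2 + r ^ 2 := by positivity
    have h := Real.sq_sqrt h0
    rw [Matrix.trace_fin_two_of, Matrix.det_fin_two_of]
    refine ⟨by ring, by linear_combination h, ?_⟩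
    change 0 < q + √(1 + q ^ 2 + r ^ 2)
    have : -q < √(1 + q ^ 2 + r ^ 2) := Real.lt_sqrt_of_sq_lt (by nlinarith [sq_nonneg r])
    linarith⟩

namespace HypPlane

theorem ofVec_apply_zero_zero (q r : ℝ) : (ofVec q r).1 0 0 = r := rfl

theorem ofVec_add (q r : ℝ) : ((ofVec q r).1 0 1 + (ofVec q r).1 1 0) / 2 = q := by
  simp [ofVec]

theorem height_ofVec (q r : ℝ) : (ofVec q r).height = √(1 + q ^ 2 + r ^ 2) := by
  rw [height_eq]
  simp [ofVec]

theorem ext_vec {x y : HypPlane} (h : (x.1 0 1 + x.1 1 0) / 2 = (y.1 0 1 + y.1 1 0) / 2)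
    (h' : x.1 0 0 = y.1 0 0) : x = y := by
  have h1 : x.height = y.height := by
    have hx := one_le_coshDist x base
    have hy := one_le_coshDist y base
    have e : x.height ^ 2 = y.height ^ 2 := by rw [height_sq, height_sq, h, h']
    exact (pow_left_inj₀ (zero_le_one.trans hx) (zero_le_one.trans hy) two_ne_zero).1 e
  rw [height_eq, height_eq] at h1
  exact ext_iff' h' (by linarith)

theorem ofVec_eq (x : HypPlane) : ofVec ((x.1 0 1 + x.1 1 0) / 2) (x.1 0 0) = x :=
  ext_vec (ofVec_add _ _) rfl

theorem continuous_ofVec : Continuous fun p : ℝ × ℝ => ofVec p.1 p.2 := by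
  refine Continuous.subtype_mk (continuous_matrix fun i j => ?_) _
  fin_cases i <;> fin_cases j <;> simp <;> fun_prop

end HypPlane

section

variable (g : ℕ)

/-- The first coordinate of the point of the side at position `t`. -/
noncomputable def sideCoord (t : ℝ) : ℝ :=
  -- On the side, height · sinh = q · cosh for the apothem; with r = (2t - 1) q / cosh and height² =
  -- 1 + q² + r², this is solved for q.
  apothemSinh g / √(1 - ((2 * t - 1) * apothemSinh g / apothemCosh g) ^ 2)

/-- The point of the triangle with vertex at the centre and opposite edge a side of the polygon. The
parameter `t` is the position on the side, the parameter `R` the relative distance to the centre. -/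
noncomputable def trianglePoint (t R : ℝ) : HypPlane :=
  HypPlane.ofVec (R * sideCoord g t) ((2 * t - 1) * (R * sideCoord g t) / apothemCosh g)

theorem sideCoord_symm (t : ℝ) : sideCoord g (1 - t) = sideCoord g t := by
  rw [sideCoord, sideCoord]
  congr 3
  ring

theorem traceForm_trianglePoint_zero (t R : ℝ) :
    traceForm (trianglePoint g t R).1 (mirror g 0) =
      (2 * t - 1) * (R * sideCoord g t) / apothemCosh g := by
  rw [traceForm_mirror_zero]
  rfl

theorem traceForm_trianglePoint_two (t R : ℝ) :
    traceForm (trianglePoint g t R).1 (mirror g 2) =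
      (trianglePoint g t R).height * apothemSinh g - R * sideCoord g t * apothemCosh g := by
  rw [traceForm_mirror_two]
  congr 2
  exact HypPlane.ofVec_add _ _

theorem trianglePoint_zero (t : ℝ) : trianglePoint g t 0 = HypPlane.ofVec 0 0 := by
  simp [trianglePoint]

end

variable (g : ℕ) [hg : Fact (4 ≤ g)]

/-- A conjugate of γ fixes a point of the chamber, hence lies in a subgroup generated by two
reflections. It also fixes a flag, and these dihedral subgroups act freely on flags. -/
theorem eq_one_of_smul_eq {γ : TriangleGroup g} (hγ : γ ∈ surfaceSubgroup g) {x : HypPlane}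
    (h : γ • x = x) : γ = 1 := by
  obtain ⟨w, hw⟩ := exists_smul_mem_chamber g x
  have h1 : (w * γ * w⁻¹) • w • x = w • x := by
    rw [smul_smul, inv_mul_cancel_right, mul_smul, h]
  have h2 := (smul_eq_of_mem_chamber g (w * γ * w⁻¹) hw (h1.symm ▸ hw)).2
  have h3 : (w * γ * w⁻¹) • w • baseFlag g = w • baseFlag g := by
    rw [smul_smul, inv_mul_cancel_right, mul_smul, mem_surfaceSubgroup.1 hγ]
  obtain ⟨i, hi⟩ := exists_traceForm_ne_zero g (w • x)
  have key : ∀ j k : Fin 3, j ≠ k → (∀ l, l ≠ i → l = j ∨ l = k) → w * γ * w⁻¹ = 1 := by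
    intro j k hjk hl
    refine eq_one_of_mem_closure_pair hjk (Subgroup.closure_mono ?_ h2) h3
    rintro _ ⟨l, rfl, hlx⟩
    rcases hl l (fun e => hi (e ▸ hlx)) with rfl | rfl <;> simp
  have h4 : w * γ * w⁻¹ = 1 := by
    fin_cases i
    · exact key 1 2 (by decide) (by decide)
    · exact key 0 2 (by decide) (by decide)
    · exact key 0 1 (by decide) (by decide)
  rwa [mul_inv_eq_one, mul_eq_left] at h4

instance : IsCancelSMul (surfaceSubgroup g) HypPlane :=
  isCancelSMul_iff_eq_one_of_smul_eq.2 fun _ _ h => Subtype.ext (eq_one_of_smul_eq g (Subtype.prop _) h)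

theorem apothemSinh_lt_apothemCosh : apothemSinh g < apothemCosh g := by
  have := apothemSinh_sq g
  have := apothemSinh_pos g
  have := one_lt_apothemCosh g
  nlinarith

theorem sideCoord_radicand_pos {t : ℝ} (ht : t ∈ Set.Icc (0 : ℝ) 1) :
    0 < 1 - ((2 * t - 1) * apothemSinh g / apothemCosh g) ^ 2 := by
  have h1 := apothemSinh_lt_apothemCosh g
  have h2 := apothemSinh_pos g
  have h3 := one_lt_apothemCosh g
  have h4 : (2 * t - 1) ^ 2 ≤ 1 := by nlinarith [ht.1, ht.2]
  rw [sub_pos, div_pow, mul_pow, div_lt_one (by positivity)]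
  nlinarith

theorem sideCoord_pos {t : ℝ} (ht : t ∈ Set.Icc (0 : ℝ) 1) : 0 < sideCoord g t :=
  div_pos (apothemSinh_pos g) (Real.sqrt_pos.2 (sideCoord_radicand_pos g ht))

theorem sideCoord_sq {t : ℝ} (ht : t ∈ Set.Icc (0 : ℝ) 1) :
    sideCoord g t ^ 2 * (1 - ((2 * t - 1) * apothemSinh g / apothemCosh g) ^ 2) =
      apothemSinh g ^ 2 := by
  have h := sideCoord_radicand_pos g ht
  rw [sideCoord, div_pow, Real.sq_sqrt h.le, div_mul_cancel₀ _ h.ne']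

theorem traceForm_trianglePoint_one (t R : ℝ) :
    traceForm (trianglePoint g t R).1 (mirror g 1) =
      2 * (1 - t) * (R * sideCoord g t) * Real.sin (halfAngle g) := by
  have h1 := (sin_halfAngle_pos g).ne'
  have h2 := (cos_halfAngle_pos g).ne'
  rw [traceForm_mirror_one, trianglePoint, HypPlane.ofVec_add, HypPlane.ofVec_apply_zero_zero,
    apothemCosh]
  field_simp
  ring

/-- Shows that the point is inside the polygon, on its side or outside according to the sign of 1 -
R². -/
theorem height_trianglePoint_sq {t : ℝ} (ht : t ∈ Set.Icc (0 : ℝ) 1) (R : ℝ) :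
    ((trianglePoint g t R).height * apothemSinh g) ^ 2 =
      (R * sideCoord g t * apothemCosh g) ^ 2 + apothemSinh g ^ 2 * (1 - R ^ 2) := by
  have h1 := apothemSinh_sq g
  have h2 := sideCoord_sq g ht
  have h3 := (zero_lt_one.trans (one_lt_apothemCosh g)).ne'
  have h4 : 0 ≤ 1 + (R * sideCoord g t) ^ 2 +
    ((2 * t - 1) * (R * sideCoord g t) / apothemCosh g) ^ 2 := by positivity
  rw [trianglePoint, HypPlane.height_ofVec, mul_pow, Real.sq_sqrt h4]
  have h5 : apothemCosh g ^ 2 = apothemSinh g ^ 2 + 1 := by linarith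
  rw [mul_pow _ (apothemCosh g), h5]
  have h6 : ((2 * t - 1) * (R * sideCoord g t) / apothemCosh g) ^ 2 * apothemSinh g ^ 2 =
      R ^ 2 * sideCoord g t ^ 2 * ((2 * t - 1) * apothemSinh g / apothemCosh g) ^ 2 := by
    field_simp
  linear_combination h6 - R ^ 2 * h2

theorem trianglePoint_mem_chamber {t R : ℝ} (ht : t ∈ Set.Icc (0 : ℝ) 1) (ht' : 1 / 2 ≤ t)
    (hR : R ∈ Set.Icc (0 : ℝ) 1) : trianglePoint g t R ∈ chamber g := by
  have h1 := sideCoord_pos g ht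
  have h2 := one_lt_apothemCosh g
  have h3 := apothemSinh_pos g
  have h4 : 1 ≤ (trianglePoint g t R).height := HypPlane.one_le_coshDist _ _
  have h5 := sin_halfAngle_pos g
  have hR0 := hR.1
  have h6 : 0 ≤ 2 * t - 1 := by linarith
  have h7 : 0 ≤ 1 - t := by linarith [ht.2]
  intro i
  fin_cases i
  · exact (traceForm_trianglePoint_zero g t R).symm ▸ by positivity
  · exact (traceForm_trianglePoint_one g t R).symm ▸ by positivity
  · refine (traceForm_trianglePoint_two g t R).symm ▸ sub_nonneg.2 ?_
    refine le_of_sq_le_sq ?_ (mul_nonneg (zero_le_one.trans h4) h3.le)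
    rw [height_trianglePoint_sq g ht]
    have : 0 ≤ apothemSinh g ^ 2 * (1 - R ^ 2) :=
      mul_nonneg (sq_nonneg _) (by nlinarith [hR.2])
    linarith

theorem eq_zero_or_of_traceForm_zero {t R : ℝ} (ht : t ∈ Set.Icc (0 : ℝ) 1)
    (h : traceForm (trianglePoint g t R).1 (mirror g 0) = 0) : R = 0 ∨ t = 1 / 2 := by
  have h1 := sideCoord_pos g ht
  have h2 := one_lt_apothemCosh g
  rw [traceForm_trianglePoint_zero, div_eq_zero_iff, mul_eq_zero, mul_eq_zero] at h
  rcases h with (h | h | h) | h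
  · right; linarith
  · exact Or.inl h
  · linarith
  · linarith

theorem eq_zero_or_of_traceForm_one {t R : ℝ} (ht : t ∈ Set.Icc (0 : ℝ) 1)
    (h : traceForm (trianglePoint g t R).1 (mirror g 1) = 0) : R = 0 ∨ t = 1 := by
  have h1 := sideCoord_pos g ht
  have h2 := sin_halfAngle_pos g
  rw [traceForm_trianglePoint_one, mul_eq_zero, mul_eq_zero, mul_eq_zero, mul_eq_zero] at h
  rcases h with ((h | h) | h | h) | h
  · norm_num at h
  · right; linarith
  · exact Or.inl h
  · linarith
  · linarith

theorem traceForm_two_eq_zero_iff {t R : ℝ} (ht : t ∈ Set.Icc (0 : ℝ) 1)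
    (hR : 0 ≤ R) : traceForm (trianglePoint g t R).1 (mirror g 2) = 0 ↔ R = 1 := by
  have h1 := sideCoord_pos g ht
  have h2 := one_lt_apothemCosh g
  have h3 := apothemSinh_pos g
  have h4 : 1 ≤ (trianglePoint g t R).height := HypPlane.one_le_coshDist _ _
  have h5 := height_trianglePoint_sq g ht R
  rw [traceForm_trianglePoint_two, sub_eq_zero,
    ← pow_left_inj₀ (mul_nonneg (zero_le_one.trans h4) h3.le) (by positivity) two_ne_zero, h5,
    add_eq_left, mul_eq_zero, or_iff_right (by positivity), sub_eq_zero, eq_comm,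
    pow_eq_one_iff_of_nonneg hR two_ne_zero]

theorem simple_zero_smul_trianglePoint (t R : ℝ) :
    (triangleSystem g).simple 0 • trianglePoint g t R = trianglePoint g (1 - t) R := by
  apply HypPlane.ext_vec
  · rw [simple_smul_val, trianglePoint, trianglePoint, HypPlane.ofVec_add, sideCoord_symm]
    simp only [Matrix.add_apply, Matrix.smul_apply, smul_eq_mul]
    rw [← HypPlane.ofVec_add (R * sideCoord g t)
      ((2 * t - 1) * (R * sideCoord g t) / apothemCosh g)]
    simp [mirror, HypPlane.ofVec_add]
  · rw [simple_smul_val, traceForm_trianglePoint_zero]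
    simp only [Matrix.add_apply, Matrix.smul_apply, smul_eq_mul]
    rw [trianglePoint, trianglePoint, HypPlane.ofVec_apply_zero_zero,
      HypPlane.ofVec_apply_zero_zero, sideCoord_symm]
    simp [mirror]
    ring

theorem simple_one_smul_trianglePoint (R : ℝ) :
    (triangleSystem g).simple 1 • trianglePoint g 1 R = trianglePoint g 1 R := by
  rw [simple_smul_eq_self_iff, traceForm_trianglePoint_one]
  ring

theorem simple_two_smul_trianglePoint {t : ℝ} (ht : t ∈ Set.Icc (0 : ℝ) 1) :
    (triangleSystem g).simple 2 • trianglePoint g t 1 = trianglePoint g t 1 := by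
  rw [simple_smul_eq_self_iff, traceForm_two_eq_zero_iff g ht zero_le_one]

theorem polygonRotation_smul_trianglePoint (R : ℝ) :
    polygonRotation g • trianglePoint g 0 R = trianglePoint g 1 R := by
  rw [polygonRotation, mul_smul, simple_zero_smul_trianglePoint, sub_zero,
    simple_one_smul_trianglePoint]

theorem exists_trianglePoint_eq {x : HypPlane} (hx : x ∈ chamber g) :
    ∃ t R : ℝ, t ∈ Set.Icc (0 : ℝ) 1 ∧ 1 / 2 ≤ t ∧ R ∈ Set.Icc (0 : ℝ) 1 ∧
      trianglePoint g t R = x := by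
  have h0 := hx 0
  have h1 := hx 1
  have h2 := hx 2
  rw [traceForm_mirror_zero] at h0
  rw [traceForm_mirror_one] at h1
  rw [traceForm_mirror_two] at h2
  have hs := sin_halfAngle_pos g
  have hc := cos_halfAngle_pos g
  have hch := one_lt_apothemCosh g
  have hsh := apothemSinh_pos g
  rw [← HypPlane.ofVec_eq x]
  have hheight := height_sq x
  have hh1 := HypPlane.one_le_coshDist x HypPlane.base
  set q := (x.1 0 1 + x.1 1 0) / 2
  set r := x.1 0 0
  have hq : 0 ≤ q := by
    by_contra! hq
    nlinarith [mul_nonneg h0 hc.le, mul_pos_of_neg_of_neg hq (neg_lt_zero.2 hs)]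
  rcases hq.eq_or_lt with hq0 | hq0
  · have hr : r = 0 := by
      rw [← hq0, zero_mul, zero_sub, neg_nonneg] at h1
      nlinarith
    exact ⟨1 / 2, 0, ⟨by norm_num, by norm_num⟩, le_rfl, ⟨le_rfl, zero_le_one⟩, by
      rw [trianglePoint_zero, ← hq0, hr]⟩
  · have hrq : r * apothemCosh g ≤ q := by
      rw [apothemCosh, ← mul_div_assoc, div_le_iff₀ hs]
      linarith
    set s := r * apothemCosh g / q with hsdef
    have hs0 : 0 ≤ s := by positivity
    have hs1 : s ≤ 1 := (div_le_one hq0).2 hrq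
    have ht : (s + 1) / 2 ∈ Set.Icc (0 : ℝ) 1 := ⟨by linarith, by linarith⟩
    have hsc := sideCoord_pos g ht
    set R := q / sideCoord g ((s + 1) / 2) with hR
    have hR0 : 0 ≤ R := by positivity
    have hRq : R * sideCoord g ((s + 1) / 2) = q := div_mul_cancel₀ _ hsc.ne'
    have e : trianglePoint g ((s + 1) / 2) R = HypPlane.ofVec q r := by
      rw [trianglePoint, hRq]
      congr 1
      rw [hsdef]
      field_simp
      ring
    refine ⟨(s + 1) / 2, R, ht, by linarith, ⟨hR0, ?_⟩, e⟩
    have h3 := height_trianglePoint_sq g ht R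
    have h4 : (trianglePoint g ((s + 1) / 2) R).height = x.height := by
      rw [e]
      exact congrArg _ (HypPlane.ofVec_eq x)
    rw [h4, hRq] at h3
    have h5 : (q * apothemCosh g) ^ 2 ≤ (x.height * apothemSinh g) ^ 2 :=
      pow_le_pow_left₀ (by positivity) (by linarith) 2
    have h6 : 0 ≤ apothemSinh g ^ 2 * (1 - R ^ 2) := by linarith
    have h7 := nonneg_of_mul_nonneg_right h6 (by positivity)
    nlinarith

theorem eq_of_trianglePoint_eq {t t' R R' : ℝ} (ht : t ∈ Set.Icc (0 : ℝ) 1)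
    (ht' : t' ∈ Set.Icc (0 : ℝ) 1) (h : trianglePoint g t R = trianglePoint g t' R') :
    R = R' ∧ (R = 0 ∨ t = t') := by
  have h1 := sideCoord_pos g ht
  have h2 := sideCoord_pos g ht'
  have hch := (zero_lt_one.trans (one_lt_apothemCosh g)).ne'
  have hq : R * sideCoord g t = R' * sideCoord g t' := by
    have := congrArg (fun x : HypPlane => (x.1 0 1 + x.1 1 0) / 2) h
    simpa only [trianglePoint, HypPlane.ofVec_add] using this
  have hr : (2 * t - 1) * (R * sideCoord g t) / apothemCosh g =
    (2 * t' - 1) * (R' * sideCoord g t') / apothemCosh g :=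
      congrArg (fun x : HypPlane => x.1 0 0) h
  rw [← hq, div_left_inj' hch] at hr
  rcases eq_or_ne R 0 with h0 | h0
  · rw [h0, zero_mul, eq_comm, mul_eq_zero, or_iff_left h2.ne'] at hq
    exact ⟨h0.trans hq.symm, Or.inl h0⟩
  · have : t = t' := by
      have := mul_right_cancel₀ (mul_ne_zero h0 h1.ne') hr
      linarith
    subst this
    exact ⟨mul_right_cancel₀ h1.ne' hq, Or.inr rfl⟩

theorem continuous_trianglePoint :
    Continuous fun p : unitInterval × unitInterval => trianglePoint g p.1 p.2 := by
  have h : Continuous fun p : unitInterval × unitInterval => sideCoord g p.1 := by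
    refine continuous_const.div (by fun_prop) fun p => ?_
    exact (Real.sqrt_pos.2 (sideCoord_radicand_pos g p.1.2)).ne'
  exact HypPlane.continuous_ofVec.comp (Continuous.prodMk (by fun_prop) (by fun_prop))

end FundamentalTriangle

/-! ### The surface as a quotient of the hyperbolic plane -/

section PolarCoordinates

/-- Polar coordinates on the disc. The angle is measured by the position on the boundary. -/
noncomputable def polarPoint (g : ℕ) (R : unitInterval) (s : ℝ) : SurfaceDisc :=
  ⟨(R : ℝ) * (Circle.exp (2 * Real.pi * s / (4 * g)) : ℂ), by
    rw [mem_closedBall_zero_iff, norm_mul, Circle.norm_coe, mul_one, Complex.norm_real,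
      Real.norm_of_nonneg R.2.1]
    exact R.2.2⟩

theorem polarPoint_val (g : ℕ) (R : unitInterval) (s : ℝ) : (polarPoint g R s : ℂ) =
    (R : ℝ) * (Circle.exp (2 * Real.pi * s / (4 * g)) : ℂ) := rfl

theorem norm_polarPoint (g : ℕ) (R : unitInterval) (s : ℝ) : ‖(polarPoint g R s : ℂ)‖ = R := by
  rw [polarPoint_val, norm_mul, Circle.norm_coe, mul_one, Complex.norm_real,
    Real.norm_of_nonneg R.2.1]

theorem polarPoint_one (g : ℕ) (s : ℝ) : polarPoint g 1 s = sidePoint g s := by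
  apply Subtype.ext
  rw [polarPoint_val, Set.Icc.coe_one, Complex.ofReal_one, one_mul, sidePoint]

theorem polarPoint_zero (g : ℕ) (s s' : ℝ) : polarPoint g 0 s = polarPoint g 0 s' := by
  apply Subtype.ext
  rw [polarPoint_val, polarPoint_val, Set.Icc.coe_zero, Complex.ofReal_zero, zero_mul, zero_mul]

theorem continuous_polarPoint (g : ℕ) :
    Continuous fun p : unitInterval × ℝ => polarPoint g p.1 p.2 := by
  refine Continuous.subtype_mk ?_ _
  fun_prop

variable (g : ℕ) [hg : Fact (4 ≤ g)]

theorem exp_position_eq_iff {s s' : ℝ} :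
    Circle.exp (2 * Real.pi * s / (4 * g)) = Circle.exp (2 * Real.pi * s' / (4 * g)) ↔
      ∃ m : ℤ, s = s' + 4 * g * m := by
  have h1 := four_le_cast g
  have h2 := Real.pi_pos
  rw [Circle.exp_eq_exp]
  refine exists_congr fun m => ?_
  rw [div_eq_iff (by positivity), add_mul, div_mul_cancel₀ _ (by positivity)]
  constructor
  · intro h
    have : 2 * Real.pi * s = 2 * Real.pi * (s' + 4 * g * m) := by linear_combination h
    exact mul_left_cancel₀ (by positivity) this
  · rintro rfl
    ring

theorem polarPoint_eq_iff {R R' : unitInterval} {s s' : ℝ} :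
    polarPoint g R s = polarPoint g R' s' ↔ R = R' ∧ (R = 0 ∨ ∃ m : ℤ, s = s' + 4 * g * m) := by
  constructor
  · intro h
    have h1 : R = R' := by
      apply Subtype.ext
      rw [← norm_polarPoint g R s, h, norm_polarPoint]
    subst h1
    refine ⟨rfl, or_iff_not_imp_left.2 fun h0 => ?_⟩
    rw [← exp_position_eq_iff]
    have h2 := congrArg Subtype.val h
    rw [polarPoint_val, polarPoint_val] at h2
    refine Circle.ext (mul_left_cancel₀ ?_ h2)
    exact_mod_cast fun h3 => h0 (Subtype.ext h3)
  · rintro ⟨rfl, rfl | h⟩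
    · exact polarPoint_zero g s s'
    · apply Subtype.ext
      rw [polarPoint_val, polarPoint_val, (exp_position_eq_iff g).2 h]

theorem exists_polarPoint_eq (d : SurfaceDisc) :
    ∃ (n : Fin (4 * g)) (t R : unitInterval), polarPoint g R ((n : ℕ) + t) = d := by
  have h1 := four_le_cast g
  have h2 := Real.pi_pos
  have h3 := hg.out
  set s := Complex.arg d * (4 * g) / (2 * Real.pi) with hs
  have hd : polarPoint g ⟨‖(d : ℂ)‖, norm_nonneg _, mem_closedBall_zero_iff.1 d.2⟩ s = d := by
    apply Subtype.ext
    have e : 2 * Real.pi * s / (4 * g) = Complex.arg d := by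
      rw [hs]
      field_simp
    rw [polarPoint_val, e, Circle.coe_exp]
    exact Complex.norm_mul_exp_arg_mul_I d
  have h4 : (0 : ℤ) < ((4 * g : ℕ) : ℤ) := by omega
  have h5 := Int.emod_nonneg ⌊s⌋ h4.ne'
  have h6 := Int.emod_lt_of_pos ⌊s⌋ h4
  refine ⟨⟨(⌊s⌋ % (4 * g : ℕ)).toNat, by omega⟩, ⟨Int.fract s, unitInterval.fract_mem s⟩, _,
    (Eq.trans ?_ hd : polarPoint g ⟨‖(d : ℂ)‖, norm_nonneg _, mem_closedBall_zero_iff.1 d.2⟩ _ = d)⟩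
  rw [polarPoint_eq_iff]
  refine ⟨rfl, Or.inr ⟨-(⌊s⌋ / (4 * g : ℕ)), ?_⟩⟩
  have h7 := Int.emod_add_mul_ediv ⌊s⌋ (4 * g : ℕ)
  have h8 : (((⌊s⌋ % (4 * g : ℕ)).toNat : ℤ) : ℝ) = ((⌊s⌋ % (4 * g : ℕ) : ℤ) : ℝ) := by
    rw [Int.toNat_of_nonneg h5]
  have h9 : ((⌊s⌋ % (4 * g : ℕ) : ℤ) : ℝ) + 4 * g * ((⌊s⌋ / (4 * g : ℕ) : ℤ) : ℝ) = ⌊s⌋ := by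
    exact_mod_cast h7
  have h10 := Int.floor_add_fract s
  change (((⌊s⌋ % (4 * g : ℕ)).toNat : ℕ) : ℝ) + Int.fract s = _
  rw [Int.cast_natCast] at h8
  rw [h8, Int.cast_neg]
  linarith

end PolarCoordinates

/-! ### Comparison of the glued polygon with the quotient of the hyperbolic plane. -/

section SurfaceQuotient

section

variable (g : ℕ)

theorem polygonRotation_pow : polygonRotation g ^ (4 * g) = 1 :=
  (triangleSystem g).simple_mul_simple_pow 1 0

/-- The points of the surface. -/
noncomputable def surfacePoint (n : ℤ) (t R : unitInterval) : StandardSurface g :=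
  Quot.mk _ (polarPoint g R (n + t))

theorem surfacePoint_zero (n n' : ℤ) (t t' : unitInterval) :
    surfacePoint g n t 0 = surfacePoint g n' t' 0 :=
  congrArg _ (polarPoint_zero g _ _)

theorem surfacePoint_add_one (n : ℤ) (R : unitInterval) :
    surfacePoint g (n + 1) 0 R = surfacePoint g n 1 R := by
  refine congrArg (fun s => Quot.mk (SideIdent g) (polarPoint g R s)) ?_
  simp

theorem surfacePoint_symm {k : ℕ} (hk : k < g) {r : ℕ} (hr : r < 2) (t : unitInterval) :
    surfacePoint g (4 * k + r) t 1 = surfacePoint g (4 * k + r + 2) (unitInterval.symm t) 1 := by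
  refine Quot.sound ?_
  rw [polarPoint_one, polarPoint_one]
  interval_cases r
  · convert SideIdent.a k hk t t.2 using 2
    · push_cast; ring
    · push_cast [unitInterval.coe_symm_eq]; ring
  · convert SideIdent.b k hk t t.2 using 2
    · push_cast; ring
    · push_cast [unitInterval.coe_symm_eq]; ring

end

variable (g : ℕ) [hg : Fact (4 ≤ g)]

/-- The points of the polygon in the hyperbolic plane. -/
noncomputable def polygonPoint (n : ℤ) (t R : ℝ) : HypPlane :=
  polygonRotation g ^ n • trianglePoint g t R

theorem polygonPoint_add_mul (n m : ℤ) (t R : ℝ) :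
    polygonPoint g (n + 4 * g * m) t R = polygonPoint g n t R := by
  have : polygonRotation g ^ (4 * g * m : ℤ) = 1 := by
    rw [zpow_mul, show (4 * g : ℤ) = ((4 * g : ℕ) : ℤ) by push_cast; rfl, zpow_natCast,
      polygonRotation_pow, one_zpow]
  rw [polygonPoint, zpow_add, this, mul_one, polygonPoint]

theorem polygonPoint_add_one (n : ℤ) (R : ℝ) :
    polygonPoint g (n + 1) 0 R = polygonPoint g n 1 R := by
  rw [polygonPoint, zpow_add_one, mul_smul, polygonRotation_smul_trianglePoint, polygonPoint]

theorem polygonPoint_zero (n n' : ℤ) (t t' : ℝ) :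
    polygonPoint g n t 0 = polygonPoint g n' t' 0 := by
  have h : ∀ t, trianglePoint g t 0 = trianglePoint g 0 0 := fun t => by
    rw [trianglePoint_zero, trianglePoint_zero]
  have h1 : polygonRotation g • trianglePoint g 0 0 = trianglePoint g 0 0 := by
    rw [polygonRotation_smul_trianglePoint, h]
  have h2 : ∀ n : ℤ, polygonRotation g ^ n • trianglePoint g 0 0 = trianglePoint g 0 0 := fun n => by
    have : polygonRotation g ∈ MulAction.stabilizer (TriangleGroup g) (trianglePoint g 0 0) := h1
    exact (Subgroup.zpow_mem _ this n)
  rw [polygonPoint, polygonPoint, h t, h t', h2, h2]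

theorem polygonPoint_eq_of_polarPoint_eq {n n' : ℤ} {t t' R R' : unitInterval}
    (h : polarPoint g R (n + t) = polarPoint g R' (n' + t')) :
    polygonPoint g n t R = polygonPoint g n' t' R' := by
  obtain ⟨rfl, rfl | ⟨m, hm⟩⟩ := (polarPoint_eq_iff g).1 h
  · exact polygonPoint_zero g n n' t t'
  · have ht := t.2
    have ht' := t'.2
    have h1 : ((n : ℝ) - n' - 4 * g * m) = t' - t := by linarith
    have h2 : ((n - n' - 4 * g * m : ℤ) : ℝ) = t' - t := by
      rw [← h1]
      push_cast
      rfl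
    -- The integer n - n' - 4gm equals t' - t, so it is -1, 0 or 1; in the extreme cases the
    -- parameters are 0 and 1, where consecutive triangles share an edge.
    have h3 : n - n' - 4 * g * m ≤ 1 := by
      have : ((n - n' - 4 * g * m : ℤ) : ℝ) ≤ 1 := by rw [h2]; linarith [ht.1, ht'.2]
      exact_mod_cast this
    have h4 : -1 ≤ n - n' - 4 * g * m := by
      have : -1 ≤ ((n - n' - 4 * g * m : ℤ) : ℝ) := by rw [h2]; linarith [ht.2, ht'.1]
      exact_mod_cast this
    obtain h5 | h5 | h5 : n - n' - 4 * g * m = -1 ∨ n - n' - 4 * g * m = 0 ∨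
        n - n' - 4 * g * m = 1 := by omega
    · rw [h5] at h2
      push_cast at h2
      have e1 : (t : ℝ) = 1 := by linarith [ht.2, ht'.1]
      have e2 : (t' : ℝ) = 0 := by linarith
      have e3 : n + 1 = n' + 4 * g * m := by omega
      rw [e1, e2, ← polygonPoint_add_one, e3, polygonPoint_add_mul]
    · rw [h5] at h2
      push_cast at h2
      have e1 : (t : ℝ) = t' := by linarith
      have e3 : n = n' + 4 * g * m := by omega
      rw [e1, e3, polygonPoint_add_mul]
    · rw [h5] at h2
      push_cast at h2
      have e1 : (t' : ℝ) = 1 := by linarith [ht'.2, ht.1]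
      have e2 : (t : ℝ) = 0 := by linarith
      have e3 : n = (n' + 1) + 4 * g * m := by omega
      rw [e1, e2, e3, polygonPoint_add_mul, polygonPoint_add_one]

theorem sidePairing_smul_polygonPoint (k : ℕ) {r : ℕ} (hr : r < 2) {t : ℝ}
    (ht : t ∈ Set.Icc (0 : ℝ) 1) :
    (sidePairing k hr : surfaceSubgroup g) • polygonPoint g (4 * k + r + 2) (1 - t) 1 =
      polygonPoint g (4 * k + r) t 1 := by
  change (crossing g (4 * k + r) * (polygonRotation g ^ (4 * k + r + 2))⁻¹) •
    polygonPoint g (4 * k + r + 2) (1 - t) 1 = _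
  have e1 : (4 * k + r + 2 : ℤ) = ((4 * k + r + 2 : ℕ) : ℤ) := by push_cast; rfl
  have e2 : (4 * k + r : ℤ) = ((4 * k + r : ℕ) : ℤ) := by push_cast; rfl
  rw [polygonPoint, polygonPoint, e1, e2, zpow_natCast, zpow_natCast, mul_smul, inv_smul_smul,
    crossing, mul_smul, mul_smul, simple_zero_smul_trianglePoint, sub_sub_cancel,
    simple_two_smul_trianglePoint g ht]

/-- The quotient of the hyperbolic plane by the surface group. -/
abbrev HypQuotient : Type := Quotient (MulAction.orbitRel (surfaceSubgroup g) HypPlane)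

/-- The image of a point in the quotient by the surface group. -/
noncomputable def toQuotient (x : HypPlane) : HypQuotient g := Quotient.mk _ x

instance : ContinuousConstSMul (surfaceSubgroup g) HypPlane where
  continuous_const_smul γ := continuous_const_smul γ.1

theorem toQuotient_eq_iff {x y : HypPlane} :
    toQuotient g x = toQuotient g y ↔ ∃ γ : surfaceSubgroup g, γ • y = x :=
  Quotient.eq''

theorem exists_discToQuotient : ∃ φ : SurfaceDisc → HypQuotient g,
    ∀ (n : ℤ) (t R : unitInterval),
      φ (polarPoint g R (n + t)) = toQuotient g (polygonPoint g n t R) := by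
  choose n t R h using exists_polarPoint_eq g
  refine ⟨fun d => toQuotient g (polygonPoint g (n d : ℕ) (t d) (R d)), fun m t' R' => ?_⟩
  refine congrArg (toQuotient g) ?_
  apply polygonPoint_eq_of_polarPoint_eq
  rw [Int.cast_natCast, h]

theorem exists_surfaceToQuotient : ∃ φ : StandardSurface g → HypQuotient g,
    ∀ (n : ℤ) (t R : unitInterval),
      φ (Quot.mk _ (polarPoint g R (n + t))) = toQuotient g (polygonPoint g n t R) := by
  obtain ⟨φ, hφ⟩ := exists_discToQuotient g
  have key : ∀ (k : ℕ) {r : ℕ}, r < 2 → ∀ t ∈ Set.Icc (0 : ℝ) 1,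
      φ (sidePoint g (4 * k + r + t)) = φ (sidePoint g (4 * k + r + 2 + (1 - t))) := by
    intro k r hr t ht
    have h1 := hφ (4 * k + r) ⟨t, ht⟩ 1
    have h2 := hφ (4 * k + r + 2) (unitInterval.symm ⟨t, ht⟩) 1
    push_cast [unitInterval.coe_symm_eq] at h1 h2
    rw [← polarPoint_one, ← polarPoint_one, h1, h2, toQuotient_eq_iff]
    exact ⟨_, sidePairing_smul_polygonPoint g k hr ht⟩
  refine ⟨Quot.lift φ fun d d' h => ?_, hφ⟩
  cases h with
  | a k hk t ht =>
    convert key k zero_lt_two t ht using 3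
    · push_cast; ring
    · push_cast; ring
  | b k hk t ht =>
    convert key k one_lt_two t ht using 3
    · push_cast; ring
    · push_cast; ring

theorem surfacePoint_add_mul (n m : ℤ) (t R : unitInterval) :
    surfacePoint g (n + 4 * g * m) t R = surfacePoint g n t R := by
  refine congrArg _ ((polarPoint_eq_iff g).2 ⟨rfl, Or.inr ⟨m, ?_⟩⟩)
  push_cast
  ring

/-- The point of the surface with given coordinates in the triangle of a flag. -/
noncomputable def flagPoint (f : PolygonFlag g) (t R : unitInterval) : StandardSurface g :=
  surfacePoint g (4 * f.1.val + (f.2.1 : ℕ)) (if f.2.2 then t else unitInterval.symm t) R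

theorem flagPoint_intCast (k : ℤ) (r : Fin 4) (b : Bool) (t R : unitInterval) :
    flagPoint g ((k : ZMod g), r, b) t R =
      surfacePoint g (4 * k + (r : ℕ)) (if b then t else unitInterval.symm t) R := by
  have h1 : (((k : ZMod g).val : ℕ) : ℤ) = k % g := ZMod.val_intCast k
  have h2 := Int.emod_add_mul_ediv k g
  rw [flagPoint, h1, ← surfacePoint_add_mul g (4 * k + (r : ℕ)) (-(k / g))]
  congr 1
  change 4 * (k % g) + ((r : ℕ) : ℤ) = _
  linear_combination 4 * h2

theorem flagPoint_flagStep_one_true (k : ZMod g) (r : Fin 4) (R : unitInterval) :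
    flagPoint g (flagStep g 1 (k, r, true)) 1 R = flagPoint g (k, r, true) 1 R := by
  obtain ⟨K, rfl⟩ : ∃ K : ℤ, (K : ZMod g) = k := ⟨k.val, by simp⟩
  have e1 : ((K : ZMod g) + 1) = ((K + 1 : ℤ) : ZMod g) := by push_cast; rfl
  rw [flagPoint_intCast, if_pos rfl, ← surfacePoint_add_one]
  change flagPoint g (if r = 3 then _ else _) 1 R = _
  split_ifs with hr
  · rw [e1, flagPoint_intCast, if_neg Bool.false_ne_true, unitInterval.symm_one, hr]
    congr 1
    change 4 * (K + 1) + ((0 : ℕ) : ℤ) = 4 * K + ((3 : ℕ) : ℤ) + 1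
    push_cast
    ring
  · rw [flagPoint_intCast, if_neg Bool.false_ne_true, unitInterval.symm_one]
    congr 1
    have : ((r + 1 : Fin 4) : ℕ) = r + 1 :=
      Fin.val_add_one_of_lt (lt_of_le_of_ne (Fin.le_last r) hr)
    rw [this]
    push_cast
    ring

/-- A point on a mirror belongs to both adjacent triangles. Apart from the centre R = 0, mirror 0 is
t = 1/2, mirror 1 is the edge t = 1 shared by consecutive sides, and mirror 2 is the boundary R = 1,
where the side identifications apply. -/
theorem flagPoint_flagStep {i : Fin 3} (f : PolygonFlag g) {t R : unitInterval}
    (h : traceForm (trianglePoint g t R).1 (mirror g i) = 0) :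
    flagPoint g (flagStep g i f) t R = flagPoint g f t R := by
  rcases eq_or_ne R 0 with rfl | hR
  · exact surfacePoint_zero g _ _ _ _
  have hR0 : (R : ℝ) ≠ 0 := fun e => hR (Subtype.ext e)
  obtain ⟨k, r, b⟩ := f
  obtain ⟨K, hK, rfl⟩ : ∃ K : ℕ, K < g ∧ (((K : ℕ) : ℤ) : ZMod g) = k :=
    ⟨k.val, ZMod.val_lt k, by simp⟩
  fin_cases i
  · have ht := (eq_zero_or_of_traceForm_zero g t.2 h).resolve_left hR0
    have hs : unitInterval.symm t = t := Subtype.ext (by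
      rw [unitInterval.coe_symm_eq, ht]
      norm_num)
    change flagPoint g (_, r, !b) t R = _
    rw [flagPoint_intCast, flagPoint_intCast, hs]
    simp
  · have ht : t = 1 := Subtype.ext ((eq_zero_or_of_traceForm_one g t.2 h).resolve_left hR0)
    subst ht
    change flagPoint g (flagStep g 1 _) 1 R = _
    cases b with
    | true => exact flagPoint_flagStep_one_true g _ _ _
    | false =>
      have h1 : flagStep g 1 (flagStep g 1 ((((K : ℕ) : ℤ) : ZMod g), r, false)) =
          ((((K : ℕ) : ℤ) : ZMod g), r, false) := by
        rw [← simple_smul_flag, ← simple_smul_flag, smul_smul,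
          CoxeterSystem.simple_mul_simple_self, one_smul]
      obtain ⟨k', r', h2⟩ : ∃ k' r', flagStep g 1 ((((K : ℕ) : ℤ) : ZMod g), r, false) =
          (k', r', true) := by
        change ∃ k' r', (if r = 0 then _ else _) = _
        split_ifs
        exacts [⟨_, _, rfl⟩, ⟨_, _, rfl⟩]
      rw [h2] at h1 ⊢
      rw [← flagPoint_flagStep_one_true, h1]
  · have hR1 : R = 1 := Subtype.ext ((traceForm_two_eq_zero_iff g t.2 R.2.1).1 h)
    subst hR1
    have key : ∀ r : Fin 4, ∀ t : unitInterval,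
        surfacePoint g (4 * K + ((r + 2 : Fin 4) : ℕ)) (unitInterval.symm t) 1 =
          surfacePoint g (4 * K + (r : ℕ)) t 1 := by
      intro r t
      have h0 := fun t => surfacePoint_symm g hK zero_lt_two t
      have h1 := fun t => surfacePoint_symm g hK one_lt_two t
      fin_cases r
      · exact (h0 t).symm
      · exact (h1 t).symm
      · simpa using h0 (unitInterval.symm t)
      · simpa [add_assoc] using h1 (unitInterval.symm t)
    change flagPoint g (_, r + 2, !b) t 1 = _
    rw [flagPoint_intCast, flagPoint_intCast, ← key r]
    cases b <;> simp

theorem flagPoint_smul {u : TriangleGroup g} {t R : unitInterval}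
    (hu : u ∈ Subgroup.closure {s | ∃ i, s = (triangleSystem g).simple i ∧
      traceForm (trianglePoint g t R).1 (mirror g i) = 0}) (f : PolygonFlag g) :
    flagPoint g (u • f) t R = flagPoint g f t R := by
  induction hu using Subgroup.closure_induction generalizing f with
  | mem s hs =>
    obtain ⟨i, rfl, hi⟩ := hs
    rw [simple_smul_flag, flagPoint_flagStep g f hi]
  | one => rw [one_smul]
  | mul u v _ _ hu hv => rw [mul_smul, hu, hv]
  | inv u _ hu => rw [← hu, smul_inv_smul]

theorem exists_flagPoint_eq (n : ℕ) (t R : unitInterval) :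
    ∃ (w : TriangleGroup g) (t' : unitInterval), 1 / 2 ≤ (t' : ℝ) ∧
      polygonPoint g n t R = w • trianglePoint g t' R ∧
      surfacePoint g n t R = flagPoint g (flagOf w) t' R := by
  obtain ⟨k, r, rfl⟩ : ∃ (k : ℕ) (r : Fin 4), n = 4 * k + r :=
    ⟨n / 4, ⟨n % 4, Nat.mod_lt _ (by norm_num)⟩, (Nat.div_add_mod n 4).symm⟩
  have h1 := flagOf_polygonRotation_pow (g := g) k r
  have h2 : ((k : ℕ) : ZMod g) = ((k : ℤ) : ZMod g) := by push_cast; rfl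
  rcases le_total (1 / 2) (t : ℝ) with h | h
  · refine ⟨polygonRotation g ^ (4 * k + (r : ℕ)), t, h, by rw [polygonPoint, zpow_natCast], ?_⟩
    rw [h1, h2, flagPoint_intCast, if_pos rfl]
    push_cast
    rfl
  · refine ⟨polygonRotation g ^ (4 * k + (r : ℕ)) * (triangleSystem g).simple 0,
      unitInterval.symm t, by rw [unitInterval.coe_symm_eq]; linarith, ?_, ?_⟩
    · rw [polygonPoint, zpow_natCast, mul_smul, simple_zero_smul_trianglePoint,
        unitInterval.coe_symm_eq, sub_sub_cancel]
    · rw [flagOf_mul_simple, h1, h2]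
      change _ = flagPoint g (_, r, false) _ R
      rw [flagPoint_intCast, if_neg Bool.false_ne_true, unitInterval.symm_symm]
      push_cast
      rfl

/-- Both points are folded into the chamber. Equivalent points of the chamber are equal, and the
transporting element is a product of reflections fixing the point; each of these changes the flag
without changing the point of the surface. -/
theorem surfacePoint_eq_of_toQuotient_eq {n n' : ℕ} {t t' R R' : unitInterval}
    (h : toQuotient g (polygonPoint g n t R) = toQuotient g (polygonPoint g n' t' R')) :
    surfacePoint g n t R = surfacePoint g n' t' R' := by
  obtain ⟨w, s, hs, h1, h2⟩ := exists_flagPoint_eq g n t R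
  obtain ⟨w', s', hs', h1', h2'⟩ := exists_flagPoint_eq g n' t' R'
  rw [h1, h1', toQuotient_eq_iff] at h
  obtain ⟨γ, hγ⟩ := h
  have h3 : (w⁻¹ * γ.1 * w') • trianglePoint g s' R' = trianglePoint g s R := by
    rw [mul_smul, mul_smul, inv_smul_eq_iff]
    exact hγ
  have h4 := trianglePoint_mem_chamber g s.2 hs R.2
  have h5 := trianglePoint_mem_chamber g s'.2 hs' R'.2
  obtain ⟨h6, h7⟩ := smul_eq_of_mem_chamber g (w⁻¹ * γ.1 * w') h5 (h3.symm ▸ h4)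
  have h8 : flagOf w = (w⁻¹ * γ.1 * w') • flagOf w' := by
    rw [flagOf, flagOf, smul_smul, mul_inv_cancel_right, mul_smul, mem_surfaceSubgroup.1 γ.2]
  obtain ⟨h9, h10⟩ := eq_of_trianglePoint_eq g s.2 s'.2 (h3.symm.trans h6)
  obtain rfl : R = R' := Subtype.ext h9
  rw [h2, h2', h8, ← flagPoint_smul g h7 (flagOf w')]
  rcases h10 with h10 | h10
  · obtain rfl : R = 0 := Subtype.ext h10
    exact surfacePoint_zero g _ _ _ _
  · rw [Subtype.ext h10]

theorem exists_toQuotient_polygonPoint_eq (x : HypPlane) :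
    ∃ (n : Fin (4 * g)) (t R : unitInterval),
      toQuotient g (polygonPoint g (n : ℕ) t R) = toQuotient g x := by
  obtain ⟨w, hw⟩ := exists_smul_mem_chamber g x
  obtain ⟨t, R, ht, -, hR, hx⟩ := exists_trianglePoint_eq g hw
  obtain ⟨k, r, b, hf⟩ : ∃ k r b, flagOf w⁻¹ = (k, r, b) := ⟨_, _, _, rfl⟩
  have hn : 4 * k.val + (r : ℕ) < 4 * g := by
    have := ZMod.val_lt k
    omega
  have h1 := flagOf_polygonRotation_pow (g := g) k.val r
  rw [ZMod.natCast_zmod_val] at h1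
  refine ⟨⟨_, hn⟩, if b then ⟨t, ht⟩ else unitInterval.symm ⟨t, ht⟩, ⟨R, hR⟩, ?_⟩
  cases b with
  | true =>
    rw [toQuotient_eq_iff]
    refine ⟨⟨_, mul_inv_mem_of_flagOf_eq (h1.trans hf.symm)⟩, ?_⟩
    change (polygonRotation g ^ (4 * k.val + (r : ℕ)) * w⁻¹⁻¹) • x = polygonPoint g
      ((4 * k.val + (r : ℕ) : ℕ) : ℤ) ((if true = true then ⟨t, ht⟩ else _ : unitInterval) : ℝ) R
    rw [mul_smul, inv_inv, ← hx, if_pos rfl, polygonPoint, zpow_natCast]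
  | false =>
    rw [toQuotient_eq_iff]
    have h2 : flagOf (polygonRotation g ^ (4 * k.val + (r : ℕ)) * (triangleSystem g).simple 0) =
        flagOf w⁻¹ := by
      rw [flagOf_mul_simple, h1, hf]
      rfl
    refine ⟨⟨_, mul_inv_mem_of_flagOf_eq h2⟩, ?_⟩
    change (polygonRotation g ^ (4 * k.val + (r : ℕ)) * (triangleSystem g).simple 0 * w⁻¹⁻¹) • x =
      polygonPoint g ((4 * k.val + (r : ℕ) : ℕ) : ℤ)
        ((if false = true then _ else unitInterval.symm ⟨t, ht⟩ : unitInterval) : ℝ) R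
    rw [mul_smul, inv_inv, ← hx, if_neg Bool.false_ne_true, polygonPoint, zpow_natCast, mul_smul,
      simple_zero_smul_trianglePoint, unitInterval.coe_symm_eq]

/-- Two quotients of a space with the same fibres are homeomorphic. -/
theorem nonempty_homeomorph_of_isQuotientMap {X Y Z : Type*} [TopologicalSpace X]
    [TopologicalSpace Y] [TopologicalSpace Z] {p : X → Y} {q : X → Z} (hp : IsQuotientMap p)
    (hq : IsQuotientMap q) (h : ∀ a b, p a = p b ↔ q a = q b) : Nonempty (Y ≃ₜ Z) := by
  let p' : C(X, Y) := ⟨p, hp.continuous⟩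
  let q' : C(X, Z) := ⟨q, hq.continuous⟩
  have hp' : IsQuotientMap p' := hp
  have hq' : IsQuotientMap q' := hq
  exact ⟨hp'.homeomorph.symm.trans ((Homeomorph.Quotient.congrRight h).trans hq'.homeomorph)⟩

/-- Both spaces are quotients of the compact space of 4g squares, with position on the side and
radius as coordinates, and the two maps have the same fibres. Continuous surjections from a compact
space onto the disc and onto the orbit space, which are Hausdorff, are quotient maps. -/
theorem nonempty_homeomorph_hypQuotient : Nonempty (HypQuotient g ≃ₜ StandardSurface g) := by
  let X := Fin (4 * g) × unitInterval × unitInterval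
  let J : X → SurfaceDisc := fun a => polarPoint g a.2.2 ((a.1 : ℕ) + a.2.1)
  let Φ : X → HypQuotient g := fun a => toQuotient g (polygonPoint g (a.1 : ℕ) a.2.1 a.2.2)
  have hJ : Continuous J := by
    refine (continuous_polarPoint g).comp (.prodMk (by fun_prop) (.add ?_ (by fun_prop)))
    exact (continuous_of_discreteTopology (f := fun n : Fin (4 * g) => ((n : ℕ) : ℝ))).comp
      continuous_fst
  have hΦ : Continuous Φ := by
    refine continuous_quotient_mk'.comp (continuous_prod_of_discrete_left.2 fun n => ?_)
    exact (continuous_const_smul (polygonRotation g ^ ((n : ℕ) : ℤ))).comp (continuous_trianglePoint g)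
  have hJq : IsQuotientMap J := hJ.isClosedMap.isQuotientMap hJ fun d => by
    obtain ⟨n, t, R, h⟩ := exists_polarPoint_eq g d
    exact ⟨(n, t, R), h⟩
  have hΦq : IsQuotientMap Φ := hΦ.isClosedMap.isQuotientMap hΦ fun x => by
    obtain ⟨x, rfl⟩ := Quotient.exists_rep x
    obtain ⟨n, t, R, h⟩ := exists_toQuotient_polygonPoint_eq g x
    exact ⟨(n, t, R), h⟩
  refine nonempty_homeomorph_of_isQuotientMap hΦq (isQuotientMap_quot_mk.comp hJq) fun a b => ?_
  constructor
  · exact fun h => surfacePoint_eq_of_toQuotient_eq g h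
  · intro h
    obtain ⟨φ, hφ⟩ := exists_surfaceToQuotient g
    have ha := hφ (a.1 : ℕ) a.2.1 a.2.2
    have hb := hφ (b.1 : ℕ) b.2.1 b.2.2
    rw [Int.cast_natCast] at ha hb
    exact ha.symm.trans ((congrArg φ h).trans hb)

end SurfaceQuotient

/-! ### Transport to the fundamental group -/

section Transport

theorem wordLength_image_le {Γ Γ' : Type*} [Group Γ] [Group Γ'] (e : Γ ≃* Γ') {T : Set Γ}
    (hT : Subgroup.closure T = ⊤) (γ : Γ') : wordLength (e '' T) γ ≤ wordLength T (e.symm γ) := by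
  obtain ⟨l, hl, hprod, hlen⟩ := exists_list_length_eq_wordLength hT (e.symm γ)
  rw [← hlen, ← List.length_map (f := e)]
  refine wordLength_le _ (fun x hx => ?_) ?_
  · obtain ⟨y, hy, rfl⟩ := List.mem_map.1 hx
    refine (hl y hy).imp (fun h => ⟨y, h, rfl⟩) fun h => ⟨y⁻¹, h, map_inv e y⟩
  · rw [← map_list_prod, hprod, MulEquiv.apply_symm_apply]

/-- Transport of a Fuchsian system along an isomorphism. -/
noncomputable def FuchsianSystem.transport {Γ Γ' : Type*} [Group Γ] [Group Γ']
    (D : FuchsianSystem Γ) (e : Γ ≃* Γ') : FuchsianSystem Γ' where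
  A := D.A.comp e.symm.toMonoidHom
  a := e ∘ D.a
  b := e ∘ D.b
  ν := D.ν
  one_lt_ν := D.one_lt_ν
  trace_a k := by simpa using D.trace_a k
  trace_b k := by simpa using D.trace_b k
  span_b V h1 h := D.span_b V h1 fun k => by simpa using h k
  exists_hom H _ x y hxy := by
    obtain ⟨θ, hθ⟩ := D.exists_hom H x y hxy
    exact ⟨θ.comp e.symm.toMonoidHom, fun k => by simpa using hθ k⟩
  exists_le := by
    obtain ⟨T, hT, hT', J, K, hJ, hK, h⟩ := D.exists_le
    refine ⟨e '' T, hT.image e, ?_, J, K, hJ, hK, fun γ => le_trans ?_ (h (e.symm γ))⟩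
    · have := congrArg (Subgroup.map e.toMonoidHom) hT'
      rw [MonoidHom.map_closure, Subgroup.map_top_of_surjective _ e.surjective] at this
      exact this
    · have : (wordLength (e '' T) γ : ℝ) ≤ wordLength T (e.symm γ) := by
        exact_mod_cast wordLength_image_le e hT' γ
      gcongr

theorem nonempty_mulEquiv_fundamentalGroup (g : ℕ) [Fact (4 ≤ g)] (S : Type*) [TopologicalSpace S]
    (hS : IsClosedOrientableSurface S g) (x : S) :
    Nonempty (surfaceSubgroup g ≃* FundamentalGroup S x) := by
  obtain ⟨φ⟩ := hS
  obtain ⟨ψ⟩ := nonempty_homeomorph_hypQuotient g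
  have h := (isQuotientCoveringMap_quotientMk_of_properlyDiscontinuousSMul
    (G := surfaceSubgroup g) (E := HypPlane)).homeomorph_comp (ψ.trans φ.symm)
  obtain ⟨e, he⟩ := h.surjective x
  -- The fundamental group is identified with the opposite of the group acting on the simply
  -- connected cover; inversion removes the opposite.
  exact ⟨(MulEquiv.inv' _).trans (h.fundamentalGroupEquiv ⟨e, he⟩).symm⟩

end Transport

theorem proposition4p2 (g : ℕ) (hg : 4 ≤ g) (S : Type*) [TopologicalSpace S]
    (hS : IsClosedOrientableSurface S g) (x : S) :
    (∃ ψ : FundamentalGroup S x →* Matrix.SpecialLinearGroup (Fin 4) ℝ,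
      IsQuasiIsometricEmbedding ψ ∧ ¬ IsLimitOfAnosov ψ) ∧
    (∃ ρ : FundamentalGroup S x →* Matrix.SpecialLinearGroup (Fin 6) ℝ,
      IsQuasiIsometricEmbedding ρ ∧ ¬ IsLimitOfAnosov ρ ∧ IsStronglyIrreducible ρ) := by
  have : Fact (4 ≤ g) := ⟨hg⟩
  obtain ⟨e⟩ := nonempty_mulEquiv_fundamentalGroup g S hS x
  let D := (surfaceFuchsianSystem g).transport e
  exact ⟨D.exists_rep_four, D.exists_rep_six⟩
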